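/- **Conventions.** An NFA $\mathcal A=(Q,E,\Sigma,s,F)$ has a finite set $Q$ of states, edges $E\subseteq Q\times Q\times\Sigma$, one initial state $s$ and final states $F\subseteq Q$; $\Sigma$ is a finite nonempty totally ordered alphabet, $\sigma=|\Sigma|\ge 1$. NFAs are assumed to satisfy the following: every character of $\Sigma$ labels at least one edge; all edges entering the same state $u$ carry the same label, written $\lambda(u)$; $s$ has no incoming edges, and $\lambda(s)=\#$, where $\#$ is smaller than every character; every state is reachable from $s$ and can reach a final state. A *co-lexicographic order* of $\mathcal A$ is a partial order $\le$ on $Q$ such that (1) $\lambda(u)<\lambda(v)$ implies $u<v$, and (2) for all edges $(u',u),(v',v)$ with $\lambda(u)=\lambda(v)$ and $u<v$ one has $u'\le v'$. $\mathcal A$ is *$p$-sortable* if, for some co-lexicographic order $\le$, the set $Q$ can be partitioned into exactly $p$ nonempty $\le$-chains; the *co-lexicographic width* of $\mathcal A$ is the least such $p$. An automaton is given as the list of its edges and of its final states (in any order, together with the number of states, the initial state and $\sigma$), with states and characters numbered from $0$ (characters in increasing order). Time is counted on a word RAM with unit-cost arithmetic, bitwise, shift, comparison and memory instructions on $w$-bit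 words, with initially zero memory outside the input. **Statement.** There are one word RAM program, which receives neither $p$ nor $w$ as input, and a constant $c$ such that the following hold. 1. There is a constant $C$ such that for all $p,n,\sigma$ with $\sigma\ge1$, all $p$-sortable NFAs $\mathcal A,\mathcal B$ with at most $n$ states each over the same alphabet of size $\sigma$, and every word size $w\ge c\,(p+\lfloor\log_2 n\rfloor)$, the program decides whether $\mathcal L(\mathcal A)=\mathcal L(\mathcal B)$ in at most $C\cdot 2^p(n-p+1)\,n^2\,\sigma$ steps. 2. In particular, NFA equivalence is fixed-parameter tractable with respect to the co-lexicographic width: there are constants $K,k$ such that for all NFAs $\mathcal A,\mathcal B$ over the same alphabet of size $\sigma\ge 1$, with $p$ the maximum of their co-lexicographic widths, $n$ the maximum of their numbers of states and every word size $w\ge c\,(p+\lfloor\log_2 n\rfloor)$, the program decides whether $\mathcal L(\mathcal A)=\mathcal L(\mathcal B)$ in at most $K\cdot 2^p\cdot L^k$ steps, where $L$ is the number of words of the input. -/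

import Mathlib

/-! ## Word RAM with unit-cost instructions -/

namespace WordRAM

/-- The arithmetic, bitwise and shift instructions on words. -/
inductive Op where
  | add | sub | mul | div | mod | band | bor | bxor | shl | shr

/-- The value of an instruction on two `w`-bit words, truncated to `w` bits. -/
def Op.eval (w : ℕ) : Op → ℕ → ℕ → ℕ
  | .add, x, y => (x + y) % 2 ^ w
  | .sub, x, y => (x + 2 ^ w - y) % 2 ^ w
  | .mul, x, y => (x * y) % 2 ^ w
  | .div, x, y => (x / y) % 2 ^ w
  | .mod, x, y => (x % y) % 2 ^ w
  | .band, x, y => (x &&& y) % 2 ^ w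
  | .bor, x, y => (x ||| y) % 2 ^ w
  | .bxor, x, y => (x ^^^ y) % 2 ^ w
  | .shl, x, y => (x <<< y) % 2 ^ w
  | .shr, x, y => (x >>> y) % 2 ^ w

/-- Comparisons of two registers. -/
inductive Test where
  | eq (a b : ℕ)
  | lt (a b : ℕ)

/-- Programs. A program is a finite syntactic object, so it uses finitely many registers and
constants, and it does not depend on the word size or on the input. -/
inductive Cmd where
  /-- `reg d := k` -/
  | const (d k : ℕ)
  /-- `reg d := reg a` -/
  | move (d a : ℕ)
  /-- `reg d := o (reg a) (reg b)` -/
  | op (o : Op) (d a b : ℕ)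
  /-- `reg d := mem (reg a)` -/
  | load (d a : ℕ)
  /-- `mem (reg a) := reg b` -/
  | store (a b : ℕ)
  | skip
  | seq (c₁ c₂ : Cmd)
  | ite (b : Test) (c₁ c₂ : Cmd)
  | loop (b : Test) (c : Cmd)

/-- Machine states: registers, and random access memory addressed by words. -/
structure State where
  reg : ℕ → ℕ
  mem : ℕ → ℕ

def Test.holds : Test → State → Prop
  | .eq a b, s => s.reg a = s.reg b
  | .lt a b, s => s.reg a < s.reg b

def State.setReg (s : State) (d x : ℕ) : State := { s with reg := Function.update s.reg d x }

def State.setMem (s : State) (a x : ℕ) : State := { s with mem := Function.update s.mem a x }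

/-- The start state: the input occupies the memory cells `0, 1, 2, …`, truncated to words; all
other cells and all registers are zero. -/
def State.init (w : ℕ) (input : List ℕ) : State where
  reg := fun _ => 0
  mem := fun i => input.getD i 0 % 2 ^ w

/-- `Exec w c s s' t`: with word size `w`, the program `c` started in state `s` halts in state `s'`
after exactly `t` steps. Every executed instruction costs one step, and so does every evaluation of
the test of a branch or of a loop (including the last one). -/
inductive Exec (w : ℕ) : Cmd → State → State → ℕ → Prop
  | const (d k : ℕ) (s : State) : Exec w (.const d k) s (s.setReg d (k % 2 ^ w)) 1
  | move (d a : ℕ) (s : State) : Exec w (.move d a) s (s.setReg d (s.reg a)) 1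
  | op (o : Op) (d a b : ℕ) (s : State) :
      Exec w (.op o d a b) s (s.setReg d (o.eval w (s.reg a) (s.reg b))) 1
  | load (d a : ℕ) (s : State) : Exec w (.load d a) s (s.setReg d (s.mem (s.reg a))) 1
  | store (a b : ℕ) (s : State) : Exec w (.store a b) s (s.setMem (s.reg a) (s.reg b)) 1
  | skip (s : State) : Exec w .skip s s 1
  | seq {c₁ c₂ : Cmd} {s s₁ s₂ : State} {t₁ t₂ : ℕ} :
      Exec w c₁ s s₁ t₁ → Exec w c₂ s₁ s₂ t₂ → Exec w (.seq c₁ c₂) s s₂ (t₁ + t₂)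
  | ite_true {b : Test} {c₁ c₂ : Cmd} {s s₁ : State} {t : ℕ} :
      b.holds s → Exec w c₁ s s₁ t → Exec w (.ite b c₁ c₂) s s₁ (t + 1)
  | ite_false {b : Test} {c₁ c₂ : Cmd} {s s₁ : State} {t : ℕ} :
      ¬ b.holds s → Exec w c₂ s s₁ t → Exec w (.ite b c₁ c₂) s s₁ (t + 1)
  | loop_done {b : Test} {c : Cmd} {s : State} : ¬ b.holds s → Exec w (.loop b c) s s 1
  | loop_step {b : Test} {c : Cmd} {s s₁ s₂ : State} {t₁ t₂ : ℕ} :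
      b.holds s → Exec w c s s₁ t₁ → Exec w (.loop b c) s₁ s₂ t₂ →
        Exec w (.loop b c) s s₂ (t₁ + t₂ + 1)

/-- The machine is deterministic: final state and running time are determined by the program, the
word size and the start state. -/
theorem Exec.deterministic {w : ℕ} {c : Cmd} {s s₁ s₂ : State} {t₁ t₂ : ℕ}
    (h₁ : Exec w c s s₁ t₁) (h₂ : Exec w c s s₂ t₂) : s₁ = s₂ ∧ t₁ = t₂ := by
  induction h₁ generalizing s₂ t₂ with
  | const | move | op | load | store | skip => cases h₂; exact ⟨rfl, rfl⟩
  | seq _ _ ih₁ ih₂ =>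
    cases h₂ with
    | seq a b =>
      obtain ⟨rfl, rfl⟩ := ih₁ a
      obtain ⟨rfl, rfl⟩ := ih₂ b
      exact ⟨rfl, rfl⟩
  | ite_true hb _ ih =>
    cases h₂ with
    | ite_true _ a => obtain ⟨rfl, rfl⟩ := ih a; exact ⟨rfl, rfl⟩
    | ite_false hb' _ => exact absurd hb hb'
  | ite_false hb _ ih =>
    cases h₂ with
    | ite_true hb' _ => exact absurd hb' hb
    | ite_false _ a => obtain ⟨rfl, rfl⟩ := ih a; exact ⟨rfl, rfl⟩
  | loop_done hb =>
    cases h₂ with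
    | loop_done => exact ⟨rfl, rfl⟩
    | loop_step hb' _ _ => exact absurd hb' hb
  | loop_step hb _ _ ih₁ ih₂ =>
    cases h₂ with
    | loop_done hb' => exact absurd hb hb'
    | loop_step _ a b =>
      obtain ⟨rfl, rfl⟩ := ih₁ a
      obtain ⟨rfl, rfl⟩ := ih₂ b
      exact ⟨rfl, rfl⟩

/-- With word size `w`, the program `c` started on `input` halts within `T` steps, and register `0`
then holds `1` if `P` is true and `0` if `P` is false. -/
def Cmd.DecidesWithin (c : Cmd) (w : ℕ) (input : List ℕ) (P : Prop) (T : ℕ) : Prop :=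
  ∃ (s : State) (t : ℕ), Exec w c (State.init w input) s t ∧ t ≤ T ∧
    (P → s.reg 0 = 1) ∧ (¬ P → s.reg 0 = 0)

end WordRAM

/-! ## Co-lexicographic orders of automata -/

namespace Colex

variable {α Q : Type*}

/-- The standing assumptions on automata: a unique initial state, without incoming edges;
input-consistency (all edges that enter a state have the same label); every state is reachable from
the initial state and can reach a final state; every character labels an edge. -/
structure IsAutomaton (M : NFA α Q) : Prop where
  unique_start : ∃ s, M.start = {s}
  start_no_edge : ∀ s ∈ M.start, ∀ u a, s ∉ M.step u a
  input_consistent : ∀ u u' v a b, v ∈ M.step u a → v ∈ M.step u' b → a = b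
  reachable : ∀ v, ∃ x : List α, v ∈ M.eval x
  coreachable : ∀ v, ∃ x : List α, ∃ f ∈ M.accept, f ∈ M.evalFrom {v} x
  effective : ∀ a, ∃ u v, v ∈ M.step u a

open Classical in
/-- The common label of the edges that enter `v`, and `⊥`, which is smaller than every character,
if there is no such edge. -/
noncomputable def inLabel (M : NFA α Q) (v : Q) : WithBot α :=
  if h : ∃ a u, v ∈ M.step u a then ((h.choose : α) : WithBot α) else ⊥

theorem inLabel_eq {M : NFA α Q} (hM : IsAutomaton M) {u v : Q} {a : α} (h : v ∈ M.step u a) :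
    inLabel M v = (a : WithBot α) := by
  have h' : ∃ a u, v ∈ M.step u a := ⟨a, u, h⟩
  obtain ⟨u', hu'⟩ := h'.choose_spec
  rw [inLabel, dif_pos h', hM.input_consistent _ _ _ _ _ hu' h]

/-- A co-lexicographic order of an automaton. -/
structure IsColexOrder [LinearOrder α] (M : NFA α Q) (le : Q → Q → Prop) : Prop where
  refl : ∀ u, le u u
  antisymm : ∀ u v, le u v → le v u → u = v
  trans : ∀ u v z, le u v → le v z → le u z
  axiom_one : ∀ u v, inLabel M u < inLabel M v → le u v ∧ u ≠ v
  axiom_two : ∀ u' u v' v a b, u ∈ M.step u' a → v ∈ M.step v' b → inLabel M u = inLabel M v →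
    le u v ∧ u ≠ v → le u' v'

/-- Some co-lexicographic order has a decomposition of the states into `p` (nonempty) chains, where
`chain u` is the index of the chain that contains `u`. -/
def Sortable [LinearOrder α] (M : NFA α Q) (p : ℕ) : Prop :=
  ∃ le : Q → Q → Prop, IsColexOrder M le ∧
    ∃ chain : Q → Fin p, Function.Surjective chain ∧ ∀ i, IsChain le {u | chain u = i}

/-- The co-lexicographic width. -/
noncomputable def width [LinearOrder α] (M : NFA α Q) : ℕ := sInf {p | Sortable M p}

end Colex

/-! ## Automata as inputs of a machine -/

namespace Colex

/-- The sequence of words that describes an automaton with states `0, …, m - 1`: the number of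
states, the initial state, the number of edges, the edges (source, target, label), the number of
final states, the final states. -/
def encodeData {m σ : ℕ} (s : Fin m) (es : List (Fin m × Fin m × Fin σ)) (fs : List (Fin m)) :
    List ℕ :=
  [m, (s : ℕ), es.length] ++ es.flatMap (fun e => [(e.1 : ℕ), (e.2.1 : ℕ), (e.2.2 : ℕ)]) ++
    fs.length :: fs.map (fun f => (f : ℕ))

/-- `l` describes `M`; edges and final states are listed without repetition, in any order. -/
def IsEncoding {m σ : ℕ} (M : NFA (Fin σ) (Fin m)) (l : List ℕ) : Prop :=
  ∃ (s : Fin m) (es : List (Fin m × Fin m × Fin σ)) (fs : List (Fin m)),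
    M.start = {s} ∧ es.Nodup ∧ (∀ u v a, (u, v, a) ∈ es ↔ v ∈ M.step u a) ∧
    fs.Nodup ∧ (∀ f, f ∈ fs ↔ f ∈ M.accept) ∧ l = encodeData s es fs

/-- `l` describes a pair of automata over the alphabet `{0, …, σ - 1}`. -/
def IsPairEncoding {m₁ m₂ σ : ℕ} (A : NFA (Fin σ) (Fin m₁)) (B : NFA (Fin σ) (Fin m₂))
    (l : List ℕ) : Prop :=
  ∃ l₁ l₂, IsEncoding A l₁ ∧ IsEncoding B l₂ ∧ l = σ :: (l₁ ++ l₂)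

end Colex

set_option linter.constructorNameAsVariable false

/-! The algorithm is the Hopcroft–Karp equivalence test, run on the powerset automata of both NFAs,
which are built on the fly. The NFAs sit side by side in one graph. The two start sets are merged;
then, for every queued pair `S`, `T` and every letter, the two successor sets are merged. A merge
inside one class changes no class; otherwise it joins two classes and queues the pair. The queued
pairs generate an equivalence relation that is preserved by transitions, so if no merged pair
disagrees on acceptance, the start sets accept the same words (`Graph.acc_iff_of_bisim`,
`Queue.correct`). Conversely both members of a pair are reached by a common word, so a disagreement
refutes equivalence. Every queued pair lowers the number of classes by one, hence at most `N` pairs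
are processed, where `N` bounds the number of reached sets. Per pair and letter the cost is two
scans of the edge list, two descents in a trie that stores characteristic sequences, and two root
searches of length at most `log N` (`runs_equivalence`).

The bound on `N` is `Colex.ncard_range_eval_le`. Compare words lexicographically from their last
letter. Pulling an inequality of states back along equal letters shows that the sets reached by
growing words move upwards in the co-lexicographic order (`Colex.not_lt_of_lex`) and are convex
within each chain. Fix the set `K` of chains that a reached set meets. Within these chains its
downward closure grows and its upward closure shrinks as the word grows (`Colex.parts_mono`), and
the set is the intersection of the two closures (`Colex.lowerPart_inter_upperPart`). So the size of
the first closure plus the size of the complement of the second determines the set among those with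
the same `K`. Each closure has between `|K|` and `|K| + n - p` elements, which leaves `2 * (n - p) +
1` values for each of the `2 ^ p` choices of `K`.

Input consistency bounds the number of edges by `n ^ 2` and the alphabet by `n`. Thus the logarithm
disappears in the cost of the edge scans, and the time is of order `2 ^ p * (n - p + 1) * n ^ 2 *
σ`.

To reach the word RAM, the test is written in a small language with unbounded numbers and arrays,
verified there by rules for total correctness with a step counter, and compiled with slowdown at
most `7` (`Steps.compile`); the word size is large enough to exclude overflow. -/

namespace ArrayLang

/-! ### A structured array language with a step counter -/

/-- Registers of the high-level machine. -/
inductive Var where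
  | res | z | one | ptr | sg | nn | en | s₀ | s₁ | s₂ | m | ec | i | u | v | l | fc
  | t | c | b | j | id | cnt | fresh | top | flag | p | e | x | y | a | fx | fy | gx | gy
  | qh | ql | bad
  deriving DecidableEq

/-- Arrays of the high-level machine. -/
inductive Arr where
  | src | dst | lab | acc | cur | nxt | row | start | ch | leaf | par | sz | qa | qb | nacc
  deriving DecidableEq

/-- States: registers, unbounded arrays and a step counter. -/
structure St where
  reg : Var → ℕ
  arr : Arr → ℕ → ℕ
  tick : ℕ

def St.tock (s : St) : St := { s with tick := s.tick + 1 }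

def St.set (s : St) (d : Var) (x : ℕ) : St :=
  { s with reg := Function.update s.reg d x, tick := s.tick + 1 }

def St.put (s : St) (k : Arr) (i x : ℕ) : St :=
  { s with arr := Function.update s.arr k (Function.update (s.arr k) i x), tick := s.tick + 1 }

@[simp] theorem St.tock_reg (s : St) : s.tock.reg = s.reg := rfl
@[simp] theorem St.tock_arr (s : St) : s.tock.arr = s.arr := rfl
@[simp] theorem St.tock_tick (s : St) : s.tock.tick = s.tick + 1 := rfl
@[simp] theorem St.set_reg (s : St) (d x v) :
    (s.set d x).reg v = if v = d then x else s.reg v := by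
  simp [St.set, Function.update_apply]
@[simp] theorem St.set_arr (s : St) (d x) : (s.set d x).arr = s.arr := rfl
@[simp] theorem St.set_tick (s : St) (d x) : (s.set d x).tick = s.tick + 1 := rfl
@[simp] theorem St.put_reg (s : St) (k i x) : (s.put k i x).reg = s.reg := rfl
@[simp] theorem St.put_arr (s : St) (k i x k') :
    (s.put k i x).arr k' = if k' = k then Function.update (s.arr k) i x else s.arr k' := by
  simp only [St.put, Function.update_apply]
@[simp] theorem St.put_tick (s : St) (k i x) : (s.put k i x).tick = s.tick + 1 := rfl

inductive Cond where
  | eq (a b : Var)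
  | lt (a b : Var)

def Cond.holds : Cond → St → Prop
  | .eq a b, s => s.reg a = s.reg b
  | .lt a b, s => s.reg a < s.reg b

/-- Structured programs over registers and arrays. -/
inductive Prog where
  | zero (d : Var)
  | move (d a : Var)
  | inc (d : Var)
  | add (d a b : Var)
  | input (d a : Var)
  | load (d : Var) (k : Arr) (a : Var)
  | store (k : Arr) (a b : Var)
  | seq (c₁ c₂ : Prog)
  | ite (b : Cond) (c₁ c₂ : Prog)
  | loop (b : Cond) (c : Prog)

infixr:60 " ;; " => Prog.seq

/-- Big-step semantics on unbounded numbers; sums must not exceed `B`. -/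
inductive Steps (B : ℕ) (inp : ℕ → ℕ) : Prog → St → St → Prop
  | zero (d s) : Steps B inp (.zero d) s (s.set d 0)
  | move (d a s) : Steps B inp (.move d a) s (s.set d (s.reg a))
  | inc (d s) : Steps B inp (.inc d) s (s.set d (s.reg d + 1))
  | add (d a b s) : s.reg a + s.reg b ≤ B →
      Steps B inp (.add d a b) s (s.set d (s.reg a + s.reg b))
  | input (d a s) : Steps B inp (.input d a) s (s.set d (inp (s.reg a)))
  | load (d k a s) : Steps B inp (.load d k a) s (s.set d (s.arr k (s.reg a)))
  | store (k a b s) : Steps B inp (.store k a b) s (s.put k (s.reg a) (s.reg b))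
  | seq {c₁ c₂ s s₁ s₂} : Steps B inp c₁ s s₁ → Steps B inp c₂ s₁ s₂ →
      Steps B inp (.seq c₁ c₂) s s₂
  | ite_true {b : Cond} {c₁ c₂ s s₁} : b.holds s → Steps B inp c₁ s.tock s₁ →
      Steps B inp (.ite b c₁ c₂) s s₁
  | ite_false {b : Cond} {c₁ c₂ s s₁} : ¬ b.holds s → Steps B inp c₂ s.tock s₁ →
      Steps B inp (.ite b c₁ c₂) s s₁
  | loop_done {b : Cond} {c s} : ¬ b.holds s → Steps B inp (.loop b c) s s.tock
  | loop_step {b : Cond} {c s s₁ s₂} : b.holds s → Steps B inp c s.tock s₁ →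
      Steps B inp (.loop b c) s₁ s₂ → Steps B inp (.loop b c) s s₂

/-- The clock never runs backwards, so a time bound at the end of a run also holds at every
intermediate state. -/
theorem Steps.tick_le {B inp c s s'} (h : Steps B inp c s s') : s.tick ≤ s'.tick := by
  induction h <;> (try simp at *) <;> omega

/-! ### Frames -/

def Prog.writesVar : Prog → Var → Bool
  | .zero d, v | .move d _, v | .inc d, v | .add d _ _, v | .input d _, v | .load d _ _, v =>
    decide (v = d)
  | .store _ _ _, _ => false
  | .seq c₁ c₂, v | .ite _ c₁ c₂, v => c₁.writesVar v || c₂.writesVar v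
  | .loop _ c, v => c.writesVar v

def Prog.writesArr : Prog → Arr → Bool
  | .store k _ _, k' => decide (k' = k)
  | .seq c₁ c₂, k | .ite _ c₁ c₂, k => c₁.writesArr k || c₂.writesArr k
  | .loop _ c, k => c.writesArr k
  | _, _ => false

/-- `s'` agrees with `s` on everything that `c` does not write. -/
structure Frame (c : Prog) (s s' : St) : Prop where
  reg : ∀ v, c.writesVar v = false → s'.reg v = s.reg v
  arr : ∀ k, c.writesArr k = false → s'.arr k = s.arr k

theorem Steps.frame {B inp c s s'} (h : Steps B inp c s s') : Frame c s s' := by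
  induction h with
  | zero | move | inc | add | input | load =>
    constructor <;> simp +contextual [Prog.writesVar]
  | store => constructor <;> simp +contextual [Prog.writesArr]
  | seq _ _ h₁ h₂ =>
    constructor
    · intro v hv
      simp only [Prog.writesVar, Bool.or_eq_false_iff] at hv
      rw [h₂.reg v hv.2, h₁.reg v hv.1]
    · intro v hv
      simp only [Prog.writesArr, Bool.or_eq_false_iff] at hv
      rw [h₂.arr v hv.2, h₁.arr v hv.1]
  | ite_true _ _ h | ite_false _ _ h =>
    constructor
    · intro v hv
      simp only [Prog.writesVar, Bool.or_eq_false_iff] at hv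
      rw [h.reg v (by simp [hv])]; rfl
    · intro v hv
      simp only [Prog.writesArr, Bool.or_eq_false_iff] at hv
      rw [h.arr v (by simp [hv])]; rfl
  | loop_done => exact ⟨fun _ _ => rfl, fun _ _ => rfl⟩
  | loop_step _ _ _ h₁ h₂ =>
    exact ⟨fun v hv => by rw [h₂.reg v hv, h₁.reg v hv]; rfl,
      fun v hv => by rw [h₂.arr v hv, h₁.arr v hv]; rfl⟩

/-! ### Total correctness -/

/-- Started in `s`, the program `c` halts in a state that satisfies `Q`. -/
def Runs (B : ℕ) (inp : ℕ → ℕ) (c : Prog) (s : St) (Q : St → Prop) : Prop :=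
  ∃ s', Steps B inp c s s' ∧ Q s'

section
variable {B : ℕ} {inp : ℕ → ℕ} {c c₁ c₂ : Prog} {s : St} {Q Q' : St → Prop}

/-- The frame comes for free here, so specifications of subprograms need not list what stays
unchanged. -/
theorem Runs.mono (h : Runs B inp c s Q) (hQ : ∀ s', Frame c s s' → Q s' → Q' s') :
    Runs B inp c s Q' :=
  let ⟨s', h₁, h₂⟩ := h
  ⟨s', h₁, hQ s' h₁.frame h₂⟩

@[simp] theorem runs_zero {d} : Runs B inp (.zero d) s Q ↔ Q (s.set d 0) :=
  ⟨fun ⟨_, h, hq⟩ => by cases h; exact hq, fun h => ⟨_, .zero _ _, h⟩⟩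

@[simp] theorem runs_move {d a} : Runs B inp (.move d a) s Q ↔ Q (s.set d (s.reg a)) :=
  ⟨fun ⟨_, h, hq⟩ => by cases h; exact hq, fun h => ⟨_, .move _ _ _, h⟩⟩

@[simp] theorem runs_inc {d} : Runs B inp (.inc d) s Q ↔ Q (s.set d (s.reg d + 1)) :=
  ⟨fun ⟨_, h, hq⟩ => by cases h; exact hq, fun h => ⟨_, .inc _ _, h⟩⟩

@[simp] theorem runs_add {d a b} : Runs B inp (.add d a b) s Q ↔
    s.reg a + s.reg b ≤ B ∧ Q (s.set d (s.reg a + s.reg b)) :=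
  ⟨fun ⟨_, h, hq⟩ => by cases h with | add _ _ _ _ h => exact ⟨h, hq⟩,
    fun h => ⟨_, .add _ _ _ _ h.1, h.2⟩⟩

@[simp] theorem runs_input {d a} : Runs B inp (.input d a) s Q ↔ Q (s.set d (inp (s.reg a))) :=
  ⟨fun ⟨_, h, hq⟩ => by cases h; exact hq, fun h => ⟨_, .input _ _ _, h⟩⟩

@[simp] theorem runs_load {d k a} :
    Runs B inp (.load d k a) s Q ↔ Q (s.set d (s.arr k (s.reg a))) :=
  ⟨fun ⟨_, h, hq⟩ => by cases h; exact hq, fun h => ⟨_, .load _ _ _ _, h⟩⟩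

@[simp] theorem runs_store {k a b} :
    Runs B inp (.store k a b) s Q ↔ Q (s.put k (s.reg a) (s.reg b)) :=
  ⟨fun ⟨_, h, hq⟩ => by cases h; exact hq, fun h => ⟨_, .store _ _ _ _, h⟩⟩

@[simp] theorem runs_seq :
    Runs B inp (c₁ ;; c₂) s Q ↔ Runs B inp c₁ s fun s' => Runs B inp c₂ s' Q :=
  ⟨fun ⟨_, h, hq⟩ => by cases h with | seq a b => exact ⟨_, a, _, b, hq⟩,
    fun ⟨_, a, _, b, hq⟩ => ⟨_, .seq a b, hq⟩⟩

theorem runs_ite {b : Cond} : Runs B inp (.ite b c₁ c₂) s Q ↔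
    (b.holds s → Runs B inp c₁ s.tock Q) ∧ (¬ b.holds s → Runs B inp c₂ s.tock Q) := by
  constructor
  · rintro ⟨s', h, hq⟩
    cases h with
    | ite_true hb h => exact ⟨fun _ => ⟨_, h, hq⟩, fun hb' => absurd hb hb'⟩
    | ite_false hb h => exact ⟨fun hb' => absurd hb' hb, fun _ => ⟨_, h, hq⟩⟩
  · rintro ⟨h₁, h₂⟩
    by_cases hb : b.holds s
    · obtain ⟨s', h, hq⟩ := h₁ hb
      exact ⟨s', .ite_true hb h, hq⟩
    · obtain ⟨s', h, hq⟩ := h₂ hb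
      exact ⟨s', .ite_false hb h, hq⟩

@[simp] theorem runs_ite_eq {a b : Var} : Runs B inp (.ite (.eq a b) c₁ c₂) s Q ↔
    (s.reg a = s.reg b → Runs B inp c₁ s.tock Q) ∧ (s.reg a ≠ s.reg b → Runs B inp c₂ s.tock Q) :=
  runs_ite

@[simp] theorem runs_ite_lt {a b : Var} : Runs B inp (.ite (.lt a b) c₁ c₂) s Q ↔
    (s.reg a < s.reg b → Runs B inp c₁ s.tock Q) ∧
      (¬ s.reg a < s.reg b → Runs B inp c₂ s.tock Q) :=
  runs_ite

/-- Loops with an invariant and a decreasing measure. -/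
theorem runs_loop {b : Cond} (I : St → Prop) (μ : St → ℕ) (h₀ : I s)
    (hstep : ∀ s', Frame c s s' → I s' → b.holds s' →
      Runs B inp c s'.tock fun s'' => I s'' ∧ μ s'' < μ s')
    (hdone : ∀ s', Frame c s s' → I s' → ¬ b.holds s' → Q s'.tock) :
    Runs B inp (.loop b c) s Q := by
  have key : ∀ n s', μ s' = n → Frame c s s' → I s' → Runs B inp (.loop b c) s' Q := by
    intro n
    induction n using Nat.strong_induction_on with
    | _ n ih =>
      intro s' hn hf hI
      by_cases hb : b.holds s'
      · obtain ⟨s₁, e₁, hI₁, hμ⟩ := hstep s' hf hI hb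
        have f₁ := e₁.frame
        obtain ⟨s₂, e₂, hq⟩ := ih (μ s₁) (hn ▸ hμ) s₁ rfl
          ⟨fun v hv => (f₁.reg v hv).trans (hf.reg v hv),
            fun v hv => (f₁.arr v hv).trans (hf.arr v hv)⟩ hI₁
        exact ⟨s₂, .loop_step hb e₁ e₂, hq⟩
      · exact ⟨_, .loop_done hb, hdone s' hf hI hb⟩
  exact key _ s rfl ⟨fun _ _ => rfl, fun _ _ => rfl⟩ h₀

/-- `for i := 0, …, n - 1 do c` -/
def Prog.for (i n : Var) (c : Prog) : Prog := .zero i ;; .loop (.lt i n) (c ;; .inc i)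

/-- Counting loops; the frame of the loop is available in the body and afterwards. -/
theorem runs_for {i n : Var} {c : Prog} (J : ℕ → St → Prop) (N : ℕ) (hN : s.reg n = N)
    (hi : c.writesVar i = false) (hn : c.writesVar n = false) (hne : n ≠ i)
    (h₀ : J 0 (s.set i 0))
    (hstep : ∀ k s', k < N → s'.reg i = k → s'.reg n = N → Frame (Prog.for i n c) s s' → J k s' →
      Runs B inp c s'.tock fun s'' => J (k + 1) (s''.set i (k + 1)))
    (hdone : ∀ s', Frame (Prog.for i n c) s s' → J N s' → Q s'.tock) :
    Runs B inp (Prog.for i n c) s Q := by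
  rw [Prog.for, runs_seq, runs_zero]
  have hframe : ∀ s', Frame (c ;; .inc i) (s.set i 0) s' → Frame (Prog.for i n c) s s' := by
    intro s' hf
    constructor
    · intro v hv
      simp only [Prog.for, Prog.writesVar, Bool.or_eq_false_iff, decide_eq_false_iff_not] at hv
      rw [hf.reg v (by simp [Prog.writesVar, hv])]
      simp [hv.1]
    · intro v hv
      simp only [Prog.for, Prog.writesArr, Bool.or_eq_false_iff] at hv
      rw [hf.arr v (by simp [Prog.writesArr, hv])]
      simp
  have hnn : (c ;; .inc i).writesVar n = false := by simp [Prog.writesVar, hn, hne]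
  refine runs_loop (fun s' => s'.reg i ≤ N ∧ J (s'.reg i) s') (fun s' => N - s'.reg i)
    ⟨by simp, by simpa using h₀⟩ ?_ ?_
  · rintro s' hf ⟨hle, hJ⟩ hb
    have hn' : s'.reg n = N := by rw [hf.reg n hnn]; simp [hne, hN]
    have hlt : s'.reg i < N := hn' ▸ hb
    rw [runs_seq]
    refine (hstep _ s' hlt rfl hn' (hframe _ hf) hJ).mono fun s'' hf' hJ' => ?_
    have : s''.reg i = s'.reg i := by rw [hf'.reg i hi]; rfl
    simp only [runs_inc, St.set_reg, if_true, this]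
    exact ⟨⟨hlt, hJ'⟩, by omega⟩
  · rintro s' hf ⟨hle, hJ⟩ hb
    have hn' : s'.reg n = N := by rw [hf.reg n hnn]; simp [hne, hN]
    have : s'.reg i = N := le_antisymm hle (not_lt.1 (hn' ▸ hb))
    exact hdone s' (hframe _ hf) (this ▸ hJ)

end

/-! ### Compilation to the word RAM -/

def Var.idx (v : Var) : ℕ := v.ctorIdx

def Arr.idx (k : Arr) : ℕ := k.ctorIdx

/-- Leaves the machine registers `100` and `101` free as scratch space for constants and addresses.
-/
theorem Var.idx_lt (v : Var) : v.idx < 100 := by cases v <;> decide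

theorem Arr.idx_lt (k : Arr) : k.idx < 15 := by cases k <;> decide

theorem Var.idx_injective : Function.Injective Var.idx := by
  intro a b h
  have := congrArg Var.ofNat h
  simpa [Var.idx, Var.ofNat_ctorIdx] using this

theorem Arr.idx_injective : Function.Injective Arr.idx := by
  intro a b h
  have := congrArg Arr.ofNat h
  simpa [Arr.idx, Arr.ofNat_ctorIdx] using this

open WordRAM

/-- The arrays are interleaved and fill the memory downwards from its last cell. -/
def addr (w : ℕ) (k : Arr) (i : ℕ) : ℕ := 2 ^ w - (i * 16 + (k.idx + 1))

def addrCmd (k : Arr) (a : Var) : Cmd :=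
  .seq (.const 100 16) <| .seq (.op .mul 101 a.idx 100) <| .seq (.const 100 (k.idx + 1)) <|
    .seq (.op .add 101 101 100) <| .seq (.const 100 0) (.op .sub 101 100 101)

def Cond.compile : Cond → Test
  | .eq a b => .eq a.idx b.idx
  | .lt a b => .lt a.idx b.idx

def Prog.compile : Prog → Cmd
  | .zero d => .const d.idx 0
  | .move d a => .move d.idx a.idx
  | .inc d => .seq (.const 100 1) (.op .add d.idx d.idx 100)
  | .add d a b => .op .add d.idx a.idx b.idx
  | .input d a => .load d.idx a.idx
  | .load d k a => .seq (addrCmd k a) (.load d.idx 101)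
  | .store k a b => .seq (addrCmd k a) (.store 101 b.idx)
  | .seq c₁ c₂ => .seq c₁.compile c₂.compile
  | .ite b c₁ c₂ => .ite b.compile c₁.compile c₂.compile
  | .loop b c => .loop b.compile c.compile

/-- The machine state `s` represents `h`, as far as array indices up to `D` are concerned. -/
structure Sim (w D : ℕ) (inp : ℕ → ℕ) (h : St) (s : State) : Prop where
  reg : ∀ v : Var, s.reg v.idx = h.reg v
  arr : ∀ k i, i ≤ D → s.mem (addr w k i) = h.arr k i
  inp : ∀ i ≤ D, s.mem i = inp i

/-- Sums and inputs are at most `B`, and every other step raises the largest value by at most one.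
Hence the clock bounds all values, which rules out overflow without a separate invariant for each
program. -/
structure Bounded (B : ℕ) (h : St) : Prop where
  reg : ∀ v, h.reg v ≤ B + h.tick
  arr : ∀ k i, h.arr k i ≤ B + h.tick

section
variable {w D B : ℕ} {inp : ℕ → ℕ} {h : St} {s : State}

theorem Sim.tock (hs : Sim w D inp h s) : Sim w D inp h.tock s := ⟨hs.reg, hs.arr, hs.inp⟩

theorem Bounded.tock (hb : Bounded B h) : Bounded B h.tock :=
  ⟨fun v => (hb.reg v).trans (by simp), fun k i => (hb.arr k i).trans (by simp)⟩

theorem Sim.set (hs : Sim w D inp h s) (d : Var) (x : ℕ) :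
    Sim w D inp (h.set d x) (s.setReg d.idx x) := by
  refine ⟨fun v => ?_, hs.arr, hs.inp⟩
  simp only [State.setReg, Function.update_apply, St.set_reg, Var.idx_injective.eq_iff, hs.reg]

theorem Bounded.set (hb : Bounded B h) (d : Var) {x : ℕ} (hx : x ≤ B + h.tick + 1) :
    Bounded B (h.set d x) := by
  refine ⟨fun v => ?_, fun k i => (hb.arr k i).trans (by simp)⟩
  have := hb.reg v
  simp only [St.set_reg, St.set_tick]
  split <;> omega

theorem Sim.scratch (hs : Sim w D inp h s) {d : ℕ} (hd : 100 ≤ d) (x : ℕ) :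
    Sim w D inp h (s.setReg d x) := by
  refine ⟨fun v => ?_, hs.arr, hs.inp⟩
  have := v.idx_lt
  simp only [State.setReg, Function.update_apply, hs.reg]
  rw [if_neg (by omega)]

/-- The offset `k.idx + 1` lies between `1` and `15`, so it is the residue modulo `16` of the
distance to the end of the memory. The bound on `2 ^ w` keeps the truncated subtraction exact. -/
theorem addr_injective (hw : 17 * (D + 2) ≤ 2 ^ w) {k k' : Arr} {i i' : ℕ} (hi : i ≤ D)
    (hi' : i' ≤ D) (h : addr w k i = addr w k' i') : k = k' ∧ i = i' := by
  have := k.idx_lt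
  have := k'.idx_lt
  unfold addr at h
  have : k.idx = k'.idx ∧ i = i' := by omega
  exact ⟨Arr.idx_injective this.1, this.2⟩

theorem Sim.put (hw : 17 * (D + 2) ≤ 2 ^ w) (hs : Sim w D inp h s) (k : Arr) {i : ℕ} (hi : i ≤ D)
    (x : ℕ) : Sim w D inp (h.put k i x) (s.setMem (addr w k i) x) := by
  refine ⟨hs.reg, fun k' i' hi' => ?_, fun i' hi' => ?_⟩
  · simp only [State.setMem, Function.update_apply, St.put_arr]
    by_cases hk : k' = k ∧ i' = i
    · simp [hk]
    · rw [if_neg fun h => hk (addr_injective hw hi' hi h), hs.arr _ _ hi']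
      split
      · next hk' => subst hk'; rw [Function.update_of_ne fun h => hk ⟨rfl, h⟩]
      · rfl
  · have := k.idx_lt
    simp only [State.setMem, Function.update_apply]
    -- The arrays use at most `16 * D + 15` cells at the top; the factor `17` in `hw` keeps them
    -- clear of the input cells `0, …, D`.
    rw [if_neg (by unfold addr; omega), hs.inp _ hi']

theorem Bounded.put (hb : Bounded B h) (k : Arr) (i : ℕ) {x : ℕ} (hx : x ≤ B + h.tick + 1) :
    Bounded B (h.put k i x) := by
  refine ⟨fun v => (hb.reg v).trans (by simp), fun k' i' => ?_⟩
  have := hb.arr k' i'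
  have := hb.arr k i'
  simp only [St.put_arr, St.put_tick]
  split
  · rw [Function.update_apply]; split <;> omega
  · omega

theorem exec_addrCmd (hw : 17 * (D + 2) ≤ 2 ^ w) (hs : Sim w D inp h s) (k : Arr) (a : Var)
    (ha : h.reg a ≤ D) :
    ∃ s', Exec w (addrCmd k a) s s' 6 ∧ Sim w D inp h s' ∧ s'.reg 101 = addr w k (h.reg a) := by
  have hk := k.idx_lt
  have ha' := a.idx_lt
  refine ⟨_, .seq (.const _ _ _) (.seq (.op _ _ _ _ _) (.seq (.const _ _ _) (.seq (.op _ _ _ _ _)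
    (.seq (.const _ _ _) (.op _ _ _ _ _))))), ?_, ?_⟩
  · refine (((((hs.scratch ?_ _).scratch ?_ _).scratch ?_ _).scratch ?_ _).scratch ?_ _).scratch
      ?_ _ <;> norm_num
  · have h1 : a.idx ≠ 100 := by omega
    simp only [State.setReg, Function.update_apply, Op.eval, h1, if_true, if_false,
      Nat.reduceEqDiff, hs.reg, addr]
    have e1 : 16 % 2 ^ w = 16 := Nat.mod_eq_of_lt (by omega)
    have e2 : (k.idx + 1) % 2 ^ w = k.idx + 1 := Nat.mod_eq_of_lt (by omega)
    have e3 : h.reg a * 16 % 2 ^ w = h.reg a * 16 := Nat.mod_eq_of_lt (by omega)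
    have e4 : (h.reg a * 16 + (k.idx + 1)) % 2 ^ w = h.reg a * 16 + (k.idx + 1) :=
      Nat.mod_eq_of_lt (by omega)
    rw [e1, e2, e3, e4, Nat.zero_mod, zero_add]
    -- The offset is positive because of its `+ 1`, so the difference is below `2 ^ w` and survives
    -- the reduction.
    exact Nat.mod_eq_of_lt (by omega)

theorem Cond.compile_holds (hs : Sim w D inp h s) (b : Cond) :
    b.compile.holds s ↔ b.holds h := by
  cases b <;> simp [Cond.compile, Cond.holds, Test.holds, hs.reg]

/-- A run of a program is simulated by the compiled program, with constant slowdown and without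
overflows, if the word size is large enough. -/
theorem Steps.compile {T : ℕ} {c : Prog} {h h' : St} (hst : Steps B inp c h h')
    (hinp : ∀ i, inp i ≤ B) (hT : h'.tick ≤ T) (hw : 17 * (B + T + 2) ≤ 2 ^ w)
    (hb : Bounded B h) {s : State} (hs : Sim w (B + T) inp h s) :
    Bounded B h' ∧ ∃ s' t, Exec w c.compile s s' t ∧ Sim w (B + T) inp h' s' ∧
      t + 7 * h.tick ≤ 7 * h'.tick := by
  -- The factor `7` comes from loads and stores: six instructions for the address and one for the
  -- access. By `Bounded` all indices stay within `B + T`, the range covered by `Sim`.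
  induction hst generalizing s with
  | zero d h =>
    refine ⟨hb.set _ (by omega), _, _, .const _ _ _, ?_, by simp; omega⟩
    rw [Nat.zero_mod]; exact hs.set _ _
  | move d a h =>
    refine ⟨hb.set _ ((hb.reg a).trans (by omega)), _, _, .move _ _ _, ?_, by simp; omega⟩
    rw [hs.reg]; exact hs.set _ _
  | inc d h =>
    have h1 := hb.reg d
    simp only [St.set_tick] at hT
    refine ⟨hb.set _ (by omega), _, _, .seq (.const _ _ _) (.op _ _ _ _ _), ?_, by simp; omega⟩
    have hs' := hs.scratch (le_refl 100) (1 % 2 ^ w)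
    convert hs'.set d _ using 2
    rw [hs'.reg]
    simp only [Op.eval, State.setReg, Function.update_self]
    rw [Nat.mod_eq_of_lt (a := 1) (by omega), Nat.mod_eq_of_lt (by omega)]
  | add d a b h hab =>
    refine ⟨hb.set _ (by omega), _, _, .op _ _ _ _ _, ?_, by simp; omega⟩
    convert hs.set d _ using 2
    rw [hs.reg, hs.reg, Op.eval, Nat.mod_eq_of_lt (by omega)]
  | input d a h =>
    have h1 := hb.reg a
    simp only [St.set_tick] at hT
    refine ⟨hb.set _ ((hinp _).trans (by omega)), _, _, .load _ _ _, ?_, by simp; omega⟩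
    convert hs.set d _ using 2
    rw [hs.reg, hs.inp _ (by omega)]
  | load d k a h =>
    have h1 := hb.reg a
    simp only [St.set_tick] at hT
    obtain ⟨s', e, hs', ha⟩ := exec_addrCmd hw hs k a (by omega)
    refine ⟨hb.set _ ((hb.arr _ _).trans (by omega)), _, _, .seq e (.load _ _ _), ?_, by simp; omega⟩
    convert hs'.set d _ using 2
    rw [ha, hs'.arr _ _ (by omega)]
  | store k a b h =>
    have h1 := hb.reg a
    simp only [St.put_tick] at hT
    obtain ⟨s', e, hs', ha⟩ := exec_addrCmd hw hs k a (by omega)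
    refine ⟨hb.put _ _ ((hb.reg _).trans (by omega)), _, _, .seq e (.store _ _ _), ?_,
      by simp; omega⟩
    rw [ha, hs'.reg]
    exact hs'.put hw _ (by omega) _
  | seq h₁ h₂ ih₁ ih₂ =>
    obtain ⟨b₁, s₁, t₁, e₁, hs₁, l₁⟩ := ih₁ (h₂.tick_le.trans hT) hb hs
    obtain ⟨b₂, s₂, t₂, e₂, hs₂, l₂⟩ := ih₂ hT b₁ hs₁
    exact ⟨b₂, s₂, _, .seq e₁ e₂, hs₂, by omega⟩
  | ite_true hc _ ih =>
    obtain ⟨b₁, s₁, t₁, e₁, hs₁, l₁⟩ := ih hT hb.tock hs.tock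
    exact ⟨b₁, s₁, _, .ite_true ((Cond.compile_holds hs _).2 hc) e₁, hs₁, by simp at l₁; omega⟩
  | ite_false hc _ ih =>
    obtain ⟨b₁, s₁, t₁, e₁, hs₁, l₁⟩ := ih hT hb.tock hs.tock
    exact ⟨b₁, s₁, _, .ite_false (mt (Cond.compile_holds hs _).1 hc) e₁, hs₁, by simp at l₁; omega⟩
  | loop_done hc =>
    exact ⟨hb.tock, s, _, .loop_done (mt (Cond.compile_holds hs _).1 hc), hs.tock, by simp; omega⟩
  | loop_step hc _ h₂ ih₁ ih₂ =>
    obtain ⟨b₁, s₁, t₁, e₁, hs₁, l₁⟩ := ih₁ (h₂.tick_le.trans hT) hb.tock hs.tock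
    obtain ⟨b₂, s₂, t₂, e₂, hs₂, l₂⟩ := ih₂ hT b₁ hs₁
    exact ⟨b₂, s₂, _, .loop_step ((Cond.compile_holds hs _).2 hc) e₁ e₂, hs₂,
      by simp at l₁; omega⟩

end

end ArrayLang

namespace ArrayLang

/-! ### Subset construction, tries and union-find -/

/-- A finite automaton with states `0, …, nn - 1` given by arrays. -/
structure Graph where
  nn : ℕ
  en : ℕ
  sg : ℕ
  src : ℕ → ℕ
  dst : ℕ → ℕ
  lab : ℕ → ℕ
  acc : ℕ → ℕ
  dst_lt : ∀ e < en, dst e < nn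
  src_lt : ∀ e < en, src e < nn

namespace Graph

variable (G : Graph)

def step (S : Set ℕ) (a : ℕ) : Set ℕ := {v | ∃ e < G.en, G.lab e = a ∧ G.src e ∈ S ∧ G.dst e = v}

def eval (S : Set ℕ) (w : List ℕ) : Set ℕ := w.foldl G.step S

def Acc (S : Set ℕ) : Prop := ∃ f ∈ S, G.acc f ≠ 0

def Word (w : List ℕ) : Prop := ∀ a ∈ w, a < G.sg

/-- The sets reached from `S₁` or from `S₂`. -/
def reached (S₁ S₂ : Set ℕ) : Set (Set ℕ) :=
  {S | ∃ w, G.Word w ∧ (S = G.eval S₁ w ∨ S = G.eval S₂ w)}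

theorem step_lt {S : Set ℕ} {a : ℕ} : ∀ j ∈ G.step S a, j < G.nn := by
  rintro j ⟨e, he, -, -, rfl⟩
  exact G.dst_lt e he

theorem eval_snoc (S : Set ℕ) (w : List ℕ) (a : ℕ) :
    G.eval S (w ++ [a]) = G.step (G.eval S w) a := by
  simp [eval]

variable {G}

theorem Word.snoc {w : List ℕ} (hw : G.Word w) {a : ℕ} (ha : a < G.sg) : G.Word (w ++ [a]) := by
  intro b hb
  rcases List.mem_append.1 hb with h | h
  · exact hw b h
  · simp at h; omega

/-- An equivalence relation on sets that is generated by a set of pairs which it preserves. -/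
theorem acc_iff_of_bisim {r : Set ℕ → Set ℕ → Prop} {S T : Set ℕ}
    (hacc : ∀ S T, r S T → (G.Acc S ↔ G.Acc T))
    (hstep : ∀ S T, r S T → ∀ a < G.sg, Relation.EqvGen r (G.step S a) (G.step T a))
    (h : Relation.EqvGen r S T) {w : List ℕ} (hw : G.Word w) :
    G.Acc (G.eval S w) ↔ G.Acc (G.eval T w) := by
  -- Bisimulation up to equivalence: a letter acts as a function on sets, so it is enough that
  -- generators are mapped into the generated relation.
  have hs : ∀ S T, Relation.EqvGen r S T → ∀ a < G.sg,
      Relation.EqvGen r (G.step S a) (G.step T a) := by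
    intro S T h a ha
    induction h with
    | rel _ _ h => exact hstep _ _ h a ha
    | refl => exact .refl _
    | symm _ _ _ ih => exact .symm _ _ ih
    | trans _ _ _ _ _ ih₁ ih₂ => exact .trans _ _ _ ih₁ ih₂
  induction w generalizing S T with
  | nil =>
    show G.Acc S ↔ G.Acc T
    induction h with
    | rel _ _ h => exact hacc _ _ h
    | refl => rfl
    | symm _ _ _ ih => exact ih.symm
    | trans _ _ _ _ _ ih₁ ih₂ => exact ih₁.trans ih₂
  | cons a w ih =>
    exact ih (hs _ _ h a (hw a (by simp))) fun b hb => hw b (by simp [hb])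

end Graph

/-! ### Tries of characteristic sequences -/

open Classical in
/-- The characteristic sequence of `S` on `0, …, n - 1`, last element first. -/
noncomputable def rbits (S : Set ℕ) : ℕ → List Bool
  | 0 => []
  | n + 1 => decide (n ∈ S) :: rbits S n

theorem mem_iff_of_rbits_eq {S T : Set ℕ} {n : ℕ} (h : rbits S n = rbits T n) :
    ∀ j < n, j ∈ S ↔ j ∈ T := by
  induction n with
  | zero => simp
  | succ n ih =>
    simp only [rbits, List.cons.injEq, decide_eq_decide] at h
    intro j hj
    rcases Nat.lt_succ_iff_lt_or_eq.1 hj with h' | rfl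
    · exact ih h.2 j h'
    · exact h.1

theorem eq_of_rbits_eq {S T : Set ℕ} {n : ℕ} (h : rbits S n = rbits T n) (hS : ∀ j ∈ S, j < n)
    (hT : ∀ j ∈ T, j < n) : S = T := by
  ext j
  exact ⟨fun hj => (mem_iff_of_rbits_eq h j (hS j hj)).1 hj,
    fun hj => (mem_iff_of_rbits_eq h j (hT j hj)).2 hj⟩

/-- In the trie with children `ch t`, `ch t + 1` of `t`, the sequence `l` (last element first)
leads from the root `0` to `t`. -/
def IsPath (ch : ℕ → ℕ) : List Bool → ℕ → Prop
  | [], t => t = 0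
  | b :: l, t => ∃ u, IsPath ch l u ∧ ch u ≠ 0 ∧ t = ch u + b.toNat

theorem IsPath.unique {ch : ℕ → ℕ} {l : List Bool} {t t' : ℕ} (h : IsPath ch l t)
    (h' : IsPath ch l t') : t = t' := by
  induction l generalizing t t' with
  | nil => exact Eq.trans h (Eq.symm h')
  | cons b l ih =>
    obtain ⟨u, hu, -, rfl⟩ := h
    obtain ⟨u', hu', -, rfl⟩ := h'
    rw [ih hu hu']

/-- Allocation only fills empty child pointers, so existing paths survive it. -/
theorem IsPath.mono {ch ch' : ℕ → ℕ} (hc : ∀ t, ch t ≠ 0 → ch' t = ch t) {l : List Bool} {t : ℕ}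
    (h : IsPath ch l t) : IsPath ch' l t := by
  induction l generalizing t with
  | nil => exact h
  | cons b l ih =>
    obtain ⟨u, hu, h0, rfl⟩ := h
    exact ⟨u, ih hu, by rw [hc u h0]; exact h0, by rw [hc u h0]⟩

/-- The trie `ch`, `leaf` is a dictionary for the sets `K 1, …, K cnt`; `P t` is the sequence that
leads to `t`. -/
structure Trie (nn cnt : ℕ) (K : ℕ → Set ℕ) (P : ℕ → List Bool) (fresh : ℕ) (ch leaf : ℕ → ℕ) :
    Prop where
  root : P 0 = []
  pos : 1 ≤ fresh
  child : ∀ t, ch t ≠ 0 → t < fresh ∧ ch t + 1 < fresh ∧ P (ch t) = false :: P t ∧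
    P (ch t + 1) = true :: P t
  leaf_spec : ∀ t, leaf t ≠ 0 → t < fresh ∧ leaf t ≤ cnt ∧ P t = rbits (K (leaf t)) nn
  node : ∀ x, 1 ≤ x → x ≤ cnt → ∃ t, IsPath ch (rbits (K x) nn) t ∧ leaf t = x

namespace Trie

variable {nn cnt fresh : ℕ} {K : ℕ → Set ℕ} {P : ℕ → List Bool} {ch leaf : ℕ → ℕ}

/-- Equal sets have equal bit sequences, these lead to a single trie node, and that node carries a
single leaf value. -/
theorem key_injective (h : Trie nn cnt K P fresh ch leaf) {x y : ℕ} (hx : 1 ≤ x) (hx' : x ≤ cnt)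
    (hy : 1 ≤ y) (hy' : y ≤ cnt) (hxy : K x = K y) : x = y := by
  obtain ⟨t, ht, rfl⟩ := h.node x hx hx'
  obtain ⟨u, hu, rfl⟩ := h.node y hy hy'
  rw [hxy] at ht
  rw [ht.unique hu]

/-- The siblings are created together at `fresh` and `fresh + 1`. All nodes in use are below `fresh`
and keep their labels, and `ch t = 0` ensures that no path is cut. -/
theorem alloc (h : Trie nn cnt K P fresh ch leaf) {t : ℕ} (ht : t < fresh) (h0 : ch t = 0) :
    Trie nn cnt K
      (Function.update (Function.update P fresh (false :: P t)) (fresh + 1) (true :: P t))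
      (fresh + 2) (Function.update ch t fresh) leaf := by
  have hpos := h.pos
  have hP : ∀ u < fresh, Function.update (Function.update P fresh (false :: P t)) (fresh + 1)
      (true :: P t) u = P u := fun u hu => by
    rw [Function.update_of_ne (by omega), Function.update_of_ne (by omega)]
  refine ⟨?_, by omega, fun u hu => ?_, fun u hu => ?_, fun x hx hx' => ?_⟩
  · rw [hP _ (by omega), h.root]
  · by_cases hut : u = t
    · subst hut
      simp only [Function.update_self]
      rw [hP _ ht, Function.update_of_ne (by omega), Function.update_self]
      exact ⟨by omega, by omega, rfl, rfl⟩
    · rw [Function.update_of_ne hut] at hu ⊢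
      obtain ⟨h1, h2, h3, h4⟩ := h.child u hu
      rw [hP _ (by omega), hP _ (by omega), hP _ (by omega)]
      exact ⟨by omega, by omega, h3, h4⟩
  · obtain ⟨h1, h2, h3⟩ := h.leaf_spec u hu
    rw [hP _ h1]
    exact ⟨by omega, h2, h3⟩
  · obtain ⟨u, hu, hl⟩ := h.node x hx hx'
    refine ⟨u, hu.mono fun v hv => ?_, hl⟩
    rw [Function.update_of_ne]
    rintro rfl
    exact hv h0

/-- The value `0` marks an absent leaf, so `h0` guarantees that no earlier key loses its node. -/
theorem insert (h : Trie nn cnt K P fresh ch leaf) {t : ℕ} {S : Set ℕ} (ht : t < fresh)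
    (hp : IsPath ch (rbits S nn) t) (hP : P t = rbits S nn) (h0 : leaf t = 0) :
    Trie nn (cnt + 1) (Function.update K (cnt + 1) S) P fresh ch
      (Function.update leaf t (cnt + 1)) := by
  refine ⟨h.root, h.pos, h.child, fun u hu => ?_, fun x hx hx' => ?_⟩
  · by_cases hut : u = t
    · subst hut
      simp only [Function.update_self]
      exact ⟨ht, le_rfl, hP⟩
    · rw [Function.update_of_ne hut] at hu ⊢
      obtain ⟨h1, h2, h3⟩ := h.leaf_spec u hu
      rw [Function.update_of_ne (by omega)]
      exact ⟨h1, by omega, h3⟩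
  · by_cases hxc : x = cnt + 1
    · subst hxc
      exact ⟨t, by rwa [Function.update_self], Function.update_self ..⟩
    · obtain ⟨u, hu, hl⟩ := h.node x hx (by omega)
      refine ⟨u, by rwa [Function.update_of_ne hxc], ?_⟩
      rw [Function.update_of_ne, hl]
      rintro rfl
      omega

end Trie

/-! ### Union-find with union by size -/

/-- Union-find forests with union by size on the nodes `1, …, cnt`; `par x = 0` for roots. `R x` is
the root of the tree of `x`. -/
structure UnionFind (cnt : ℕ) (par sz R : ℕ → ℕ) : Prop where
  par_le : ∀ x, par x ≤ cnt
  R_le : ∀ x, 1 ≤ x → x ≤ cnt → R x ≤ cnt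
  root : ∀ x, 1 ≤ x → x ≤ cnt → par x = 0 → R x = x
  up : ∀ x, par x ≠ 0 → x ≤ cnt ∧ R (par x) = R x ∧ 2 * sz x ≤ sz (par x)
  pos : ∀ x, 1 ≤ x → x ≤ cnt → 1 ≤ sz x ∧ sz x ≤ cnt
  sum : ∑ x ∈ Finset.Icc 1 cnt with par x = 0, sz x = cnt

def roots (cnt : ℕ) (par : ℕ → ℕ) : Finset ℕ := {x ∈ Finset.Icc 1 cnt | par x = 0}

namespace UnionFind

variable {cnt : ℕ} {par sz R : ℕ → ℕ}

theorem par_succ (h : UnionFind cnt par sz R) : par (cnt + 1) = 0 := by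
  by_contra h0
  have := (h.up _ h0).1
  omega

theorem roots_succ (h : UnionFind cnt par sz R) :
    roots (cnt + 1) par = insert (cnt + 1) (roots cnt par) := by
  ext x
  have := h.par_succ
  simp only [roots, Finset.mem_filter, Finset.mem_Icc, Finset.mem_insert]
  constructor
  · rintro ⟨⟨h1, h2⟩, h3⟩
    by_cases hx : x = cnt + 1
    · exact .inl hx
    · exact .inr ⟨⟨h1, by omega⟩, h3⟩
  · rintro (rfl | ⟨⟨h1, h2⟩, h3⟩)
    · exact ⟨⟨by omega, le_rfl⟩, this⟩
    · exact ⟨⟨h1, by omega⟩, h3⟩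

theorem notMem_roots : cnt + 1 ∉ roots cnt par := by
  simp [roots]

theorem card_roots_succ (h : UnionFind cnt par sz R) :
    (roots (cnt + 1) par).card = (roots cnt par).card + 1 := by
  rw [h.roots_succ, Finset.card_insert_of_notMem notMem_roots]

theorem push (h : UnionFind cnt par sz R) :
    UnionFind (cnt + 1) par (Function.update sz (cnt + 1) 1)
      (Function.update R (cnt + 1) (cnt + 1)) := by
  refine ⟨fun x => (h.par_le x).trans (by omega), fun x hx hx' => ?_, fun x hx hx' h0 => ?_, fun x h0 => ?_,
    fun x hx hx' => ?_, ?_⟩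
  · by_cases hxc : x = cnt + 1
    · subst hxc; simp
    · rw [Function.update_of_ne hxc]
      exact (h.R_le x hx (by omega)).trans (by omega)
  · by_cases hxc : x = cnt + 1
    · subst hxc; simp
    · rw [Function.update_of_ne hxc]
      exact h.root x hx (by omega) h0
  · obtain ⟨h1, h2, h3⟩ := h.up x h0
    have := h.par_le x
    simp only [Function.update_of_ne (show x ≠ cnt + 1 by omega),
      Function.update_of_ne (show par x ≠ cnt + 1 by omega)]
    exact ⟨by omega, h2, h3⟩
  · by_cases hxc : x = cnt + 1
    · subst hxc; simp
    · rw [Function.update_of_ne hxc]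
      have := h.pos x hx (by omega)
      omega
  · have hr := h.roots_succ
    have hs := h.sum
    rw [roots] at hr
    rw [hr, Finset.sum_insert notMem_roots, Function.update_self, roots,
      Finset.sum_congr rfl fun x hx => ?_, hs, add_comm]
    rw [Function.update_of_ne]
    simp only [Finset.mem_filter, Finset.mem_Icc] at hx
    omega

variable {r₁ r₂ : ℕ}

theorem roots_link (h1 : 1 ≤ r₁) (h1' : r₁ ≤ cnt) (hp1 : par r₁ = 0) :
    roots cnt par = insert r₁ (roots cnt (Function.update par r₁ r₂)) := by
  ext x
  simp only [roots, Finset.mem_filter, Finset.mem_Icc, Finset.mem_insert]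
  by_cases hx : x = r₁
  · subst hx; simp [h1, h1', hp1]
  · simp [hx]

theorem notMem_roots_link (h2 : 1 ≤ r₂) : r₁ ∉ roots cnt (Function.update par r₁ r₂) := by
  simp only [roots, Finset.mem_filter, Function.update_self]
  omega

theorem card_roots_link (h1 : 1 ≤ r₁) (h1' : r₁ ≤ cnt) (hp1 : par r₁ = 0) (h2 : 1 ≤ r₂) :
    (roots cnt par).card = (roots cnt (Function.update par r₁ r₂)).card + 1 := by
  rw [roots_link h1 h1' hp1, Finset.card_insert_of_notMem (notMem_roots_link h2)]

/-- The sizes of the roots sum to `cnt`. This bounds the size of a joined tree, and later the only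
sum that the merging program computes. -/
theorem add_le (h : UnionFind cnt par sz R) (h1 : 1 ≤ r₁) (h1' : r₁ ≤ cnt) (hp1 : par r₁ = 0)
    (h2 : 1 ≤ r₂) (h2' : r₂ ≤ cnt) (hp2 : par r₂ = 0) (hne : r₁ ≠ r₂) :
    sz r₁ + sz r₂ ≤ cnt := by
  rw [← h.sum, ← Finset.sum_pair hne]
  refine Finset.sum_le_sum_of_subset fun x hx => ?_
  simp only [Finset.mem_insert, Finset.mem_singleton] at hx
  rcases hx with rfl | rfl <;> simp [*]

/-- Union by size preserves `2 * sz x ≤ sz (par x)`: for the new edge this is `hsz`, and for old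
edges into `r₂` it holds because the size of `r₂` only grows. The size of `r₁` is frozen from now
on. -/
theorem link (h : UnionFind cnt par sz R) (h1 : 1 ≤ r₁) (h1' : r₁ ≤ cnt) (hp1 : par r₁ = 0)
    (h2 : 1 ≤ r₂) (h2' : r₂ ≤ cnt) (hp2 : par r₂ = 0) (hne : r₁ ≠ r₂) (hsz : sz r₁ ≤ sz r₂) :
    UnionFind cnt (Function.update par r₁ r₂) (Function.update sz r₂ (sz r₁ + sz r₂))
      (fun x => if R x = r₁ then r₂ else R x) := by
  have hR1 := h.root r₁ h1 h1' hp1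
  have hR2 := h.root r₂ h2 h2' hp2
  have hadd := h.add_le h1 h1' hp1 h2 h2' hp2 hne
  refine ⟨fun x => ?_, fun x hx hx' => ?_, fun x hx hx' h0 => ?_, fun x h0 => ?_,
    fun x hx hx' => ?_, ?_⟩
  · rw [Function.update_apply]
    split
    · exact h2'
    · exact h.par_le x
  · show (if R x = r₁ then r₂ else R x) ≤ cnt
    split
    · exact h2'
    · exact h.R_le x hx hx'
  · rw [Function.update_apply] at h0
    split at h0
    · omega
    · next hxr =>
      have := h.root x hx hx' h0
      simp [this, hxr]
  · by_cases hx : x = r₁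
    · subst hx
      simp only [Function.update_self, Function.update_of_ne hne, hR2, hR1, if_true, hne.symm,
        if_false]
      exact ⟨h1', trivial, by omega⟩
    · rw [Function.update_of_ne hx] at h0 ⊢
      obtain ⟨e1, e2, e3⟩ := h.up x h0
      have hx2 : x ≠ r₂ := by rintro rfl; exact h0 hp2
      refine ⟨e1, by simp only [e2], ?_⟩
      rw [Function.update_of_ne hx2, Function.update_apply]
      split
      · next he => rw [he] at e3; omega
      · exact e3
  · have := h.pos x hx hx'
    rw [Function.update_apply]
    split
    · have := h.pos _ h2 h2'
      omega
    · exact this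
  · have hs := h.sum
    have e := roots_link (r₂ := r₂) h1 h1' hp1
    have hn := notMem_roots_link (cnt := cnt) (par := par) (r₁ := r₁) h2
    have hmem : r₂ ∈ roots cnt (Function.update par r₁ r₂) := by
      simp [roots, h2, h2', hne.symm, hp2]
    change ∑ x ∈ roots cnt par, sz x = cnt at hs
    change ∑ x ∈ roots cnt (Function.update par r₁ r₂), _ = cnt
    rw [e, Finset.sum_insert hn, ← Finset.add_sum_erase _ _ hmem] at hs
    rw [← Finset.add_sum_erase _ _ hmem, Function.update_self,
      Finset.sum_congr rfl fun x hx => Function.update_of_ne (Finset.ne_of_mem_erase hx) _ _]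
    omega

end UnionFind

/-! ### The invariant of the equivalence test -/

/-- The sets of the nodes, the labels of the trie and the roots of the forest. -/
structure Ghost where
  K : ℕ → Set ℕ
  P : ℕ → List Bool
  R : ℕ → ℕ

/-- The state holds the graph `G`. -/
structure Static (G : Graph) (s : St) : Prop where
  z : s.reg .z = 0
  one : s.reg .one = 1
  nn : s.reg .nn = G.nn
  en : s.reg .en = G.en
  sg : s.reg .sg = G.sg
  src : s.arr .src = G.src
  dst : s.arr .dst = G.dst
  lab : s.arr .lab = G.lab
  acc : s.arr .acc = G.acc

open Classical in
/-- The rows of the nodes and their acceptance flags. -/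
structure Rows (G : Graph) (K : ℕ → Set ℕ) (cnt top : ℕ) (row start nacc : ℕ → ℕ) : Prop where
  lt : ∀ x, 1 ≤ x → x ≤ cnt → ∀ j ∈ K x, j < G.nn
  start_le : ∀ x, 1 ≤ x → x ≤ cnt → start x + G.nn ≤ top
  row_iff : ∀ x, 1 ≤ x → x ≤ cnt → ∀ j < G.nn, row (start x + j) ≠ 0 ↔ j ∈ K x
  nacc_eq : ∀ x, 1 ≤ x → x ≤ cnt → nacc x = if G.Acc (K x) then 1 else 0

/-- The queue of the pairs that were merged. -/
structure Queue (G : Graph) (S₁ S₂ : Set ℕ) (K : ℕ → Set ℕ) (R par : ℕ → ℕ) (cnt ql bad : ℕ)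
    (qa qb : ℕ → ℕ) : Prop where
  reach : ∀ x, 1 ≤ x → x ≤ cnt → K x ∈ G.reached S₁ S₂
  pair : ∀ i < ql, (1 ≤ qa i ∧ qa i ≤ cnt) ∧ (1 ≤ qb i ∧ qb i ≤ cnt) ∧
    ∃ w, G.Word w ∧ K (qa i) = G.eval S₁ w ∧ K (qb i) = G.eval S₂ w
  good : bad = 0 → ∀ i < ql, G.Acc (K (qa i)) ↔ G.Acc (K (qb i))
  wrong : bad ≠ 0 → ∃ w, G.Word w ∧ ¬ (G.Acc (G.eval S₁ w) ↔ G.Acc (G.eval S₂ w))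
  conn : ∀ x y, 1 ≤ x → x ≤ cnt → 1 ≤ y → y ≤ cnt → R x = R y →
    Relation.EqvGen (fun S T => ∃ i < ql, S = K (qa i) ∧ T = K (qb i)) (K x) (K y)
  count : ql + (roots cnt par).card = cnt

/-- Nodes with sets `S` and `T` were merged. -/
def Linked (K : ℕ → Set ℕ) (R : ℕ → ℕ) (cnt : ℕ) (S T : Set ℕ) : Prop :=
  ∃ x y, (1 ≤ x ∧ x ≤ cnt) ∧ (1 ≤ y ∧ y ≤ cnt) ∧ K x = S ∧ K y = T ∧ R x = R y

/-- The ghost data are not stored in the machine; each specification below provides new ghost data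
for the final state. -/
structure Inv (G : Graph) (S₁ S₂ : Set ℕ) (g : Ghost) (s : St) : Prop where
  static : Static G s
  trie : Trie G.nn (s.reg .cnt) g.K g.P (s.reg .fresh) (s.arr .ch) (s.arr .leaf)
  rows : Rows G g.K (s.reg .cnt) (s.reg .top) (s.arr .row) (s.arr .start) (s.arr .nacc)
  uf : UnionFind (s.reg .cnt) (s.arr .par) (s.arr .sz) g.R
  queue : Queue G S₁ S₂ g.K g.R (s.arr .par) (s.reg .cnt) (s.reg .ql) (s.reg .bad) (s.arr .qa)
    (s.arr .qb)

/-- Later states of the same run. -/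
structure Extends (g : Ghost) (s : St) (g' : Ghost) (s' : St) : Prop where
  cnt : s.reg .cnt ≤ s'.reg .cnt
  key : ∀ x, 1 ≤ x → x ≤ s.reg .cnt → g'.K x = g.K x
  linked : ∀ S T, Linked g.K g.R (s.reg .cnt) S T → Linked g'.K g'.R (s'.reg .cnt) S T

theorem Extends.refl (g : Ghost) (s s' : St) (h : s'.reg .cnt = s.reg .cnt) :
    Extends g s g s' :=
  ⟨h.ge, fun _ _ _ => rfl, fun _ _ hl => by rwa [h]⟩

theorem Extends.trans {g g' g'' : Ghost} {s s' s'' : St} (h : Extends g s g' s')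
    (h' : Extends g' s' g'' s'') : Extends g s g'' s'' :=
  ⟨h.cnt.trans h'.cnt, fun x hx hx' => (h'.key x hx (hx'.trans h.cnt)).trans (h.key x hx hx'),
    fun S T hl => h'.linked S T (h.linked S T hl)⟩

/-- The keys of the nodes are reached sets, and the trie makes them pairwise distinct. -/
theorem Inv.cnt_le {G : Graph} {S₁ S₂ : Set ℕ} {g : Ghost} {s : St} (h : Inv G S₁ S₂ g s)
    (hfin : (G.reached S₁ S₂).Finite) : s.reg .cnt ≤ (G.reached S₁ S₂).ncard := by
  have h1 : ((Finset.Icc 1 (s.reg .cnt) : Finset ℕ) : Set ℕ).ncard = s.reg .cnt := by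
    rw [Set.ncard_coe_finset, Nat.card_Icc]; omega
  rw [← h1]
  refine Set.ncard_le_ncard_of_injOn g.K (fun x hx => ?_) (fun x hx y hy hxy => ?_) hfin
  · simp only [Finset.coe_Icc, Set.mem_Icc] at hx
    exact h.queue.reach x hx.1 hx.2
  · simp only [Finset.coe_Icc, Set.mem_Icc] at hx hy
    exact h.trie.key_injective hx.1 hx.2 hy.1 hy.2 hxy

/-- If all successors of the queued pairs are merged, the test has decided the equivalence. -/
theorem Queue.correct {G : Graph} {S₁ S₂ : Set ℕ} {K : ℕ → Set ℕ} {R par : ℕ → ℕ}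
    {cnt ql bad : ℕ} {qa qb : ℕ → ℕ} (h : Queue G S₁ S₂ K R par cnt ql bad qa qb)
    (h₀ : Linked K R cnt S₁ S₂)
    (hdone : ∀ i < ql, ∀ a < G.sg, Linked K R cnt (G.step (K (qa i)) a) (G.step (K (qb i)) a)) :
    bad = 0 ↔ ∀ w, G.Word w → (G.Acc (G.eval S₁ w) ↔ G.Acc (G.eval S₂ w)) := by
  have hl : ∀ S T, Linked K R cnt S T →
      Relation.EqvGen (fun S T => ∃ i < ql, S = K (qa i) ∧ T = K (qb i)) S T := by
    rintro S T ⟨x, y, hx, hy, rfl, rfl, hR⟩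
    exact h.conn x y hx.1 hx.2 hy.1 hy.2 hR
  constructor
  · intro hb w hw
    refine Graph.acc_iff_of_bisim ?_ ?_ (hl _ _ h₀) hw
    · rintro _ _ ⟨i, hi, rfl, rfl⟩
      exact h.good hb i hi
    · rintro _ _ ⟨i, hi, rfl, rfl⟩ a ha
      exact hl _ _ (hdone i hi a ha)
  · intro hw
    by_contra hb
    obtain ⟨w, hw', hn⟩ := h.wrong hb
    exact hn (hw w hw')

end ArrayLang

namespace ArrayLang

/-! ### Finding the node of a set -/

/-- One step down the trie, along bit `j` of `nxt`. -/
def descend : Prog :=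
  .load .c .ch .t ;;
  .ite (.eq .c .z) (.move .c .fresh ;; .store .ch .t .c ;; .inc .fresh ;; .inc .fresh) (.zero .b) ;;
  .load .b .nxt .j ;; .move .t .c ;; .ite (.lt .z .b) (.inc .t) (.zero .b)

/-- Copy bit `j` of `nxt` to the current row. -/
def copyBit : Prog :=
  .load .b .nxt .j ;; .store .row .top .b ;; .inc .top ;;
  .ite (.lt .z .b) (.load .c .acc .j ;; .ite (.lt .z .c) (.move .flag .one) (.zero .c)) (.zero .c)

/-- Make a new node for the set in `nxt`, at the leaf `t`. -/
def newNode : Prog :=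
  .inc .cnt ;; .move .id .cnt ;; .store .leaf .t .id ;; .store .start .id .top ;; .zero .flag ;;
  .for .j .nn copyBit ;; .store .nacc .id .flag ;; .store .sz .id .one

/-- Let `id` be the node of the set in `nxt`. -/
def lookup : Prog :=
  .zero .t ;; .for .j .nn descend ;; .load .id .leaf .t ;; .ite (.eq .id .z) newNode (.zero .c)

section
variable {B : ℕ} {inp : ℕ → ℕ} {G : Graph} {S₁ S₂ : Set ℕ} {g : Ghost} {s : St} {S : Set ℕ}

theorem Static.frame (h : Static G s) {c : Prog} {s' : St} (hF : Frame c s s')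
    (hr : (∀ v ∈ [Var.z, .one, .nn, .en, .sg], c.writesVar v = false) := by decide)
    (ha : (∀ v ∈ [Arr.src, .dst, .lab, .acc], c.writesArr v = false) := by decide) :
    Static G s' := by
  simp only [List.forall_mem_cons, List.not_mem_nil, IsEmpty.forall_iff, implies_true,
    and_true] at hr ha
  obtain ⟨r1, r2, r3, r4, r5⟩ := hr
  obtain ⟨a1, a2, a3, a4⟩ := ha
  exact ⟨(hF.reg _ r1).trans h.z, (hF.reg _ r2).trans h.one, (hF.reg _ r3).trans h.nn,
    (hF.reg _ r4).trans h.en, (hF.reg _ r5).trans h.sg, (hF.arr _ a1).trans h.src,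
    (hF.arr _ a2).trans h.dst, (hF.arr _ a3).trans h.lab, (hF.arr _ a4).trans h.acc⟩

theorem runs_descend {cnt : ℕ} {K P} {k : ℕ} {leaf : ℕ → ℕ} (hz : s.reg .z = 0) (hj : s.reg .j = k)
    (hn : s.arr .nxt k ≠ 0 ↔ k ∈ S)
    (hT : Trie G.nn cnt K P (s.reg .fresh) (s.arr .ch) leaf)
    (hp : IsPath (s.arr .ch) (rbits S k) (s.reg .t)) (hP : P (s.reg .t) = rbits S k)
    (ht : s.reg .t < s.reg .fresh) :
    Runs B inp descend s fun s' => ∃ P', Trie G.nn cnt K P' (s'.reg .fresh) (s'.arr .ch) leaf ∧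
      IsPath (s'.arr .ch) (rbits S (k + 1)) (s'.reg .t) ∧ P' (s'.reg .t) = rbits S (k + 1) ∧
      s'.reg .t < s'.reg .fresh ∧ s'.tick ≤ s.tick + 10 := by
  have hpos := hT.pos
  -- Four cases: whether the children of `t` exist, and whether the bit is set. Missing children are
  -- allocated on the spot, and an increment selects the child for the bit one.
  by_cases hc : s.arr .ch (s.reg .t) = 0 <;> by_cases hb : s.arr .nxt k = 0 <;>
    simp only [hb, ne_eq, not_true_eq_false, not_false_eq_true, false_iff, true_iff] at hn <;>
    simp [descend, hc, hz, hj, hb, Nat.pos_iff_ne_zero]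
  · refine ⟨_, hT.alloc ht hc, ⟨s.reg .t, hp.mono fun u hu => ?_, ?_, ?_⟩, ?_⟩
    · rw [Function.update_of_ne]; rintro rfl; exact hu hc
    · rw [Function.update_self]; omega
    · rw [Function.update_self]; simp [hn]
    · rw [Function.update_of_ne (by omega), Function.update_self, hP]; simp [rbits, hn]
  · refine ⟨_, hT.alloc ht hc, ⟨s.reg .t, hp.mono fun u hu => ?_, ?_, ?_⟩, ?_⟩
    · rw [Function.update_of_ne]; rintro rfl; exact hu hc
    · rw [Function.update_self]; omega
    · rw [Function.update_self]; simp [hn]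
    · rw [Function.update_self, hP]; simp [rbits, hn]
  · obtain ⟨h1, h2, h3, h4⟩ := hT.child _ hc
    refine ⟨P, hT, ⟨_, hp, hc, by simp [hn]⟩, ?_, by omega⟩
    rw [h3, hP]; simp [rbits, hn]
  · obtain ⟨h1, h2, h3, h4⟩ := hT.child _ hc
    refine ⟨P, hT, ⟨_, hp, hc, by simp [hn]⟩, ?_, by omega⟩
    rw [h4, hP]; simp [rbits, hn]

theorem runs_copyBits (hs : Static G s) (hn : ∀ j < G.nn, s.arr .nxt j ≠ 0 ↔ j ∈ S)
    (hf : s.reg .flag = 0) :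
    Runs B inp (.for .j .nn copyBit) s fun s' => s'.reg .top = s.reg .top + G.nn ∧
      (∀ i < s.reg .top, s'.arr .row i = s.arr .row i) ∧
      (∀ j < G.nn, s'.arr .row (s.reg .top + j) ≠ 0 ↔ j ∈ S) ∧
      (s'.reg .flag = 0 ∨ s'.reg .flag = 1) ∧
      (s'.reg .flag ≠ 0 ↔ ∃ j < G.nn, j ∈ S ∧ G.acc j ≠ 0) ∧
      s'.tick ≤ s.tick + 2 + 12 * G.nn := by
  refine runs_for (fun k s' => s'.reg .top = s.reg .top + k ∧
      (∀ i < s.reg .top, s'.arr .row i = s.arr .row i) ∧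
      (∀ j < k, s'.arr .row (s.reg .top + j) ≠ 0 ↔ j ∈ S) ∧
      (s'.reg .flag = 0 ∨ s'.reg .flag = 1) ∧
      (s'.reg .flag ≠ 0 ↔ ∃ j < k, j ∈ S ∧ G.acc j ≠ 0) ∧
      s'.tick ≤ s.tick + 1 + 12 * k) G.nn hs.nn rfl rfl (by decide) ?_ ?_ ?_
  · simp [hf]
  · rintro k s' hk hj - hF ⟨h1, h2, h3, h4, h5, h6⟩
    have hz : s'.reg .z = 0 := (hs.frame hF).z
    have ho : s'.reg .one = 1 := (hs.frame hF).one
    have ha : s'.arr .acc = G.acc := (hs.frame hF).acc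
    have hx : s'.arr .nxt = s.arr .nxt := hF.arr .nxt rfl
    have hnk := hn k hk
    have hrow : ∀ v, (v ≠ 0 ↔ k ∈ S) → ∀ j < k + 1,
        Function.update (s'.arr .row) (s.reg .top + k) v (s.reg .top + j) ≠ 0 ↔ j ∈ S := by
      intro v hv j hj
      rcases Nat.lt_succ_iff_lt_or_eq.1 hj with h | rfl
      · rw [Function.update_of_ne (by omega)]; exact h3 j h
      · rw [Function.update_self]; exact hv
    have hold : ∀ v, ∀ i < s.reg .top, Function.update (s'.arr .row) (s.reg .top + k) v i =
        s.arr .row i := by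
      intro v i hi
      rw [Function.update_of_ne (by omega)]; exact h2 i hi
    have hex : (∃ j ≤ k, j ∈ S ∧ ¬ G.acc j = 0) ↔
        (∃ j < k, j ∈ S ∧ ¬ G.acc j = 0) ∨ (k ∈ S ∧ ¬ G.acc k = 0) := by
      constructor
      · rintro ⟨j, hj, hh⟩
        rcases Nat.lt_or_eq_of_le hj with h | rfl
        · exact .inl ⟨j, h, hh⟩
        · exact .inr hh
      · rintro (⟨j, hj, hh⟩ | hh)
        · exact ⟨j, by omega, hh⟩
        · exact ⟨k, by omega, hh⟩
    by_cases hb : s.arr .nxt k = 0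
    · have hkS : k ∉ S := by rw [← hnk]; simpa using hb
      simp only [copyBit, runs_seq, runs_load, runs_store, runs_inc, runs_ite_lt, runs_zero,
        runs_move]
      simp [hz, hj, hx, hb, h1, hkS, hex]
      exact ⟨by omega, hold 0, by simpa using hrow 0 (by simpa using hkS), h4,
        by simpa using h5, by omega⟩
    · have hkS : k ∈ S := hnk.1 hb
      by_cases hc : G.acc k = 0
      · simp only [copyBit, runs_seq, runs_load, runs_store, runs_inc, runs_ite_lt, runs_zero,
          runs_move]
        simp [hz, hj, hx, hb, h1, hkS, hex, ha, hc, Nat.pos_iff_ne_zero]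
        exact ⟨by omega, hold _, by simpa using hrow _ (by simpa using hnk), h4,
          by simpa using h5, by omega⟩
      · simp only [copyBit, runs_seq, runs_load, runs_store, runs_inc, runs_ite_lt, runs_zero,
          runs_move]
        simp [hz, hj, hx, hb, h1, hkS, hex, ha, hc, ho, Nat.pos_iff_ne_zero]
        exact ⟨by omega, hold _, by simpa using hrow _ (by simpa using hnk), by omega⟩
  · rintro s' hF ⟨h1, h2, h3, h4, h5, h6⟩
    exact ⟨h1, h2, h3, h4, h5, by simp; omega⟩

theorem runs_newNode (hI : Inv G S₁ S₂ g s) (hS : S ∈ G.reached S₁ S₂) (hlt : ∀ j ∈ S, j < G.nn)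
    (hn : ∀ j < G.nn, s.arr .nxt j ≠ 0 ↔ j ∈ S) (ht : s.reg .t < s.reg .fresh)
    (hp : IsPath (s.arr .ch) (rbits S G.nn) (s.reg .t)) (hP : g.P (s.reg .t) = rbits S G.nn)
    (h0 : s.arr .leaf (s.reg .t) = 0) :
    Runs B inp newNode s fun s' => ∃ g', Inv G S₁ S₂ g' s' ∧ Extends g s g' s' ∧
      (1 ≤ s'.reg .id ∧ s'.reg .id ≤ s'.reg .cnt) ∧ g'.K (s'.reg .id) = S ∧
      s'.tick ≤ s.tick + 9 + 12 * G.nn := by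
  have hs := hI.static
  simp only [newNode, runs_seq, runs_inc, runs_move, runs_store, runs_zero]
  refine (runs_copyBits (S := S) (G := G) ?_ ?_ ?_).mono fun s' hF hs' => ?_
  · constructor <;> simp [hs.z, hs.one, hs.nn, hs.en, hs.sg, hs.src, hs.dst, hs.lab, hs.acc]
  · simpa using hn
  · simp
  have hF' : Frame (newNode) s s' := by
    constructor
    · intro v hv
      simp [newNode, Prog.writesVar] at hv
      rw [hF.reg v (by simp [hv])]
      simp [hv]
    · intro v hv
      simp [newNode, Prog.writesArr] at hv
      rw [hF.arr v (by simp [hv])]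
      simp [hv]
  have hs1 : Static G s' := hs.frame hF'
  obtain ⟨h1, h2, h3, h4, h5, h6⟩ := hs'
  simp at h1 h2 h3 h6
  have e_t : s'.reg .t = s.reg .t := hF'.reg _ rfl
  have e_cnt : s'.reg .cnt = s.reg .cnt + 1 := by rw [hF.reg _ rfl]; simp
  have e_id : s'.reg .id = s.reg .cnt + 1 := by rw [hF.reg _ rfl]; simp
  have e_leaf : s'.arr .leaf = Function.update (s.arr .leaf) (s.reg .t) (s.reg .cnt + 1) := by
    rw [hF.arr _ rfl]; simp
  have e_start : s'.arr .start =
      Function.update (s.arr .start) (s.reg .cnt + 1) (s.reg .top) := by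
    rw [hF.arr _ rfl]; simp
  have e_fresh : s'.reg .fresh = s.reg .fresh := hF'.reg _ rfl
  have e_ch : s'.arr .ch = s.arr .ch := hF'.arr _ rfl
  have e_par : s'.arr .par = s.arr .par := hF'.arr _ rfl
  have e_sz : s'.arr .sz = s.arr .sz := by rw [hF.arr _ rfl]; simp
  have e_nacc : s'.arr .nacc = s.arr .nacc := by rw [hF.arr _ rfl]; simp
  have e_ql : s'.reg .ql = s.reg .ql := hF'.reg _ rfl
  have e_bad : s'.reg .bad = s.reg .bad := hF'.reg _ rfl
  have e_qa : s'.arr .qa = s.arr .qa := hF'.arr _ rfl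
  have e_qb : s'.arr .qb = s.arr .qb := hF'.arr _ rfl
  set n := s.reg .cnt with hndef
  have hK : ∀ x ≤ n, Function.update g.K (n + 1) S x = g.K x := fun x hx =>
    Function.update_of_ne (by omega) _ _
  have hR : ∀ x ≤ n, Function.update g.R (n + 1) (n + 1) x = g.R x := fun x hx =>
    Function.update_of_ne (by omega) _ _
  have hq := hI.queue
  rw [← hndef] at hq
  have huf := hI.uf
  rw [← hndef] at huf
  have hroot := huf.R_le
  refine ⟨⟨Function.update g.K (n + 1) S, g.P, Function.update g.R (n + 1) (n + 1)⟩,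
    ⟨?_, ?_, ?_, ?_, ?_⟩, ⟨?_, ?_, ?_⟩, ?_, ?_, ?_⟩
  · constructor <;> simp [hs1.z, hs1.one, hs1.nn, hs1.en, hs1.sg, hs1.src, hs1.dst, hs1.lab, hs1.acc]
  · simp [e_cnt, e_fresh, e_ch, e_leaf]
    exact hI.trie.insert ht hp hP h0
  · simp [e_cnt, e_id, e_start, h1, e_nacc]
    have hr := hI.rows
    rw [← hndef] at hr
    refine ⟨fun x hx hx' => ?_, fun x hx hx' => ?_, fun x hx hx' => ?_, fun x hx hx' => ?_⟩ <;>
      by_cases hxn : x = n + 1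
    · subst hxn; simpa using hlt
    · rw [hK _ (by omega)]; exact hr.lt x hx (by omega)
    · subst hxn; simp
    · rw [Function.update_of_ne hxn]
      have := hr.start_le x hx (by omega)
      omega
    · subst hxn; simpa using h3
    · rw [Function.update_of_ne hxn, hK _ (by omega)]
      intro j hj
      have := hr.start_le x hx (by omega)
      rw [h2 _ (by omega)]
      exact hr.row_iff x hx (by omega) j hj
    · subst hxn
      simp only [Function.update_self]
      have : G.Acc S ↔ s'.reg .flag ≠ 0 := by
        rw [h5]
        exact ⟨fun ⟨f, hf, ha⟩ => ⟨f, hlt f hf, hf, ha⟩, fun ⟨f, _, hf, ha⟩ => ⟨f, hf, ha⟩⟩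
      rcases h4 with h | h <;> simp [this, h]
    · rw [Function.update_of_ne hxn, hK _ (by omega)]
      exact hr.nacc_eq x hx (by omega)
  · simp [e_cnt, e_par, e_sz, e_id, hs1.one]
    exact huf.push
  · simp [e_cnt, e_par, e_ql, e_bad, e_qa, e_qb]
    refine ⟨fun x hx hx' => ?_, fun i hi => ?_, fun hb i hi => ?_, hq.wrong, ?_, ?_⟩
    · by_cases hxn : x = n + 1
      · subst hxn; simpa using hS
      · rw [hK _ (by omega)]; exact hq.reach x hx (by omega)
    · obtain ⟨⟨a1, a2⟩, ⟨b1, b2⟩, hw⟩ := hq.pair i hi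
      rw [hK _ a2, hK _ b2]
      exact ⟨⟨a1, by omega⟩, ⟨b1, by omega⟩, hw⟩
    · obtain ⟨⟨a1, a2⟩, ⟨b1, b2⟩, -⟩ := hq.pair i hi
      rw [hK _ a2, hK _ b2]
      exact hq.good hb i hi
    · intro x y hx hx' hy hy' hxy
      -- The new node forms a class of its own: by `R_le` the roots of the older nodes are at most
      -- `n`, which excludes the mixed cases.
      by_cases hxn : x = n + 1 <;> by_cases hyn : y = n + 1
      · rw [hxn, hyn]; exact .refl _
      · rw [hxn, Function.update_self, hR y (by omega)] at hxy
        have := hroot y hy (by omega); omega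
      · rw [hyn, Function.update_self, hR x (by omega)] at hxy
        have := hroot x hx (by omega); omega
      · rw [hR _ (by omega), hR _ (by omega)] at hxy
        rw [hK _ (by omega), hK _ (by omega)]
        refine (hq.conn x y hx (by omega) hy (by omega) hxy).mono ?_
        rintro _ _ ⟨i, hi, rfl, rfl⟩
        obtain ⟨⟨a1, a2⟩, ⟨b1, b2⟩, -⟩ := hq.pair i hi
        exact ⟨i, hi, by rw [hK _ a2], by rw [hK _ b2]⟩
    · rw [huf.card_roots_succ, ← add_assoc, hq.count]
  · rw [St.put_reg, St.put_reg, e_cnt]; exact Nat.le_succ n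
  · intro x hx hx'; exact hK x hx'
  · rintro _ _ ⟨x, y, hx, hy, rfl, rfl, hxy⟩
    refine ⟨x, y, ⟨hx.1, ?_⟩, ⟨hy.1, ?_⟩, hK _ hx.2, hK _ hy.2, ?_⟩
    · simp [e_cnt]; omega
    · simp [e_cnt]; omega
    · exact (hR _ hx.2).trans (hxy.trans (hR _ hy.2).symm)
  · simp [e_id, e_cnt]
  · simp [e_id]
  · simp; omega

theorem runs_lookup (hI : Inv G S₁ S₂ g s) (hS : S ∈ G.reached S₁ S₂) (hlt : ∀ j ∈ S, j < G.nn)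
    (hn : ∀ j < G.nn, s.arr .nxt j ≠ 0 ↔ j ∈ S) :
    Runs B inp lookup s fun s' => ∃ g', Inv G S₁ S₂ g' s' ∧ Extends g s g' s' ∧
      (1 ≤ s'.reg .id ∧ s'.reg .id ≤ s'.reg .cnt) ∧ g'.K (s'.reg .id) = S ∧
      s'.tick ≤ s.tick + 20 + 30 * G.nn := by
  have hs := hI.static
  simp only [lookup, runs_seq, runs_zero]
  refine runs_for (fun k s' => ∃ P', Trie G.nn (s.reg .cnt) g.K P' (s'.reg .fresh) (s'.arr .ch)
      (s.arr .leaf) ∧ IsPath (s'.arr .ch) (rbits S k) (s'.reg .t) ∧ P' (s'.reg .t) = rbits S k ∧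
      s'.reg .t < s'.reg .fresh ∧ s'.tick ≤ s.tick + 2 + 12 * k) G.nn (by simp [hs.nn]) rfl rfl
      (by decide) ?_ ?_ ?_
  · have := hI.trie.pos
    exact ⟨g.P, by simpa using hI.trie, by simp [rbits, IsPath], by simp [rbits, hI.trie.root],
      by simpa [Nat.succ_le_iff] using this, by simp⟩
  · rintro k s' hk hj - hF ⟨P', h1, h2, h3, h4, h5⟩
    have hz : s'.reg .z = 0 := by rw [hF.reg .z rfl]; simpa using hs.z
    have hx : s'.arr .nxt = s.arr .nxt := hF.arr .nxt rfl
    refine (runs_descend (s := s'.tock) (k := k) (S := S) (G := G) hz hj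
      (by simpa [hx] using hn k hk) h1 h2 h3 h4).mono ?_
    rintro s'' - ⟨P'', a1, a2, a3, a4, a5⟩
    refine ⟨P'', by simpa using a1, by simpa using a2, by simpa using a3, by simpa using a4, ?_⟩
    simp at a5 ⊢
    omega
  · rintro s' hF ⟨P', h1, h2, h3, h4, h5⟩
    have hF' : Frame lookup s s' := by
      constructor
      · intro v hv
        simp [lookup, Prog.writesVar] at hv
        rw [hF.reg v (by simp [hv])]
        simp [hv]
      · intro v hv
        simp [lookup, Prog.writesArr] at hv
        rw [hF.arr v (by simp [hv])]
        simp
    have hs' : Static G s' := hs.frame hF'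
    have hr : ∀ v : Var, v ∉ [Var.t, .j, .c, .b, .fresh] → s'.reg v = s.reg v := by
      intro v hv
      simp at hv
      rw [hF.reg v (by simp [Prog.for, descend, Prog.writesVar, hv])]
      simp [hv]
    have ha : ∀ v : Arr, v ≠ .ch → s'.arr v = s.arr v := by
      intro v hv
      rw [hF.arr v (by simp [Prog.for, descend, Prog.writesArr, hv])]
      simp
    have hI' : Inv G S₁ S₂ ⟨g.K, P', g.R⟩ s' := by
      refine ⟨hs', ?_, ?_, ?_, ?_⟩
      · rw [hr .cnt (by decide), ha .leaf (by decide)]; exact h1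
      · rw [hr .cnt (by decide), hr .top (by decide), ha .row (by decide), ha .start (by decide),
          ha .nacc (by decide)]
        exact hI.rows
      · rw [hr .cnt (by decide), ha .par (by decide), ha .sz (by decide)]
        exact hI.uf
      · rw [hr .cnt (by decide), hr .ql (by decide), hr .bad (by decide), ha .par (by decide),
          ha .qa (by decide), ha .qb (by decide)]
        exact hI.queue
    have hex : Extends g s ⟨g.K, P', g.R⟩ s' := by
      refine ⟨(hr .cnt (by decide)).ge, fun _ _ _ => rfl, fun S T h => ?_⟩
      rw [hr .cnt (by decide)]; exact h
    have hleaf := ha .leaf (by decide)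
    have hnxt : s'.arr .nxt = s.arr .nxt := ha .nxt (by decide)
    -- A nonzero leaf at the end of the path names a node whose key has the same bits as `S`. Both
    -- sets live below `G.nn`, so they coincide.
    have hK : s.arr .leaf (s'.reg .t) ≠ 0 → g.K (s.arr .leaf (s'.reg .t)) = S ∧
        s.arr .leaf (s'.reg .t) ≤ s.reg .cnt := by
      intro h0
      obtain ⟨-, l1, l2⟩ := h1.leaf_spec _ h0
      exact ⟨eq_of_rbits_eq (l2.symm.trans h3) (hI.rows.lt _ (by omega) l1) hlt, l1⟩
    have hI'' : ∀ x, Inv G S₁ S₂ ⟨g.K, P', g.R⟩ ((s'.tock.set .id x).tock) := fun x =>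
      ⟨by constructor <;>
          simp [hs'.z, hs'.one, hs'.nn, hs'.en, hs'.sg, hs'.src, hs'.dst, hs'.lab, hs'.acc],
        by simpa using hI'.trie, by simpa using hI'.rows, by simpa using hI'.uf,
        by simpa using hI'.queue⟩
    simp only [runs_load, runs_ite_eq, runs_zero]
    refine ⟨fun h0 => ?_, fun h0 => ?_⟩
    · refine (runs_newNode (hI'' _) hS hlt (by simpa [hnxt] using hn) (by simpa using h4)
        (by simpa using h2) (by simpa using h3) ?_).mono ?_
      · simpa [hs'.z] using h0
      · rintro s'' - ⟨g'', a1, a2, a3, a4, a5⟩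
        refine ⟨g'', a1, ⟨?_, ?_, ?_⟩, a3, a4, ?_⟩
        · have := a2.cnt
          simpa [hr .cnt (by decide)] using this
        · intro x hx hx'
          exact a2.key x hx (by simpa [hr .cnt (by decide)] using hx')
        · intro S T hl
          exact a2.linked S T (by simpa [hr .cnt (by decide)] using hl)
        · simp at a5
          omega
    · simp [hs'.z, hleaf] at h0
      obtain ⟨k1, k2⟩ := hK h0
      have hI3 := hI'' (s'.arr .leaf (s'.reg .t))
      refine ⟨⟨g.K, P', g.R⟩, ⟨?_, ?_, ?_, ?_, ?_⟩, ⟨?_, ?_, ?_⟩, ?_, ?_, ?_⟩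
      · constructor <;>
          simp [hs'.z, hs'.one, hs'.nn, hs'.en, hs'.sg, hs'.src, hs'.dst, hs'.lab, hs'.acc]
      · simpa using hI'.trie
      · simpa using hI'.rows
      · simpa using hI'.uf
      · simpa using hI'.queue
      · simp [hr .cnt (by decide)]
      · intro x hx hx'; rfl
      · intro S T hl; simpa [hr .cnt (by decide)] using hl
      · simp [hleaf, hr .cnt (by decide)]; omega
      · simpa [hleaf] using k1
      · simp; omega

end
end ArrayLang

namespace ArrayLang

/-! ### Successor sets -/

def loadBit : Prog :=
  .load .b .row .p ;; .store .cur .j .b ;; .store .nxt .j .z ;; .inc .p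

def followEdge : Prog :=
  .load .l .lab .e ;;
  .ite (.eq .l .a)
    (.load .i .src .e ;; .load .b .cur .i ;;
      .ite (.lt .z .b) (.load .i .dst .e ;; .store .nxt .i .one) (.zero .b))
    (.zero .b)

/-- Store the successor set of the node `x` under the letter `a` in `nxt`. -/
def expand : Prog :=
  .load .p .start .x ;; .for .j .nn loadBit ;; .for .e .en followEdge

/-- Let `id` be the successor of the node `x` under the letter `a`. -/
def succ : Prog := expand ;; lookup

section
variable {B : ℕ} {inp : ℕ → ℕ} {G : Graph} {S₁ S₂ : Set ℕ} {g : Ghost} {s s' : St} {S : Set ℕ}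

def invVars : List Var := [.z, .one, .nn, .en, .sg, .cnt, .fresh, .top, .ql, .bad]

def invArrs : List Arr :=
  [.src, .dst, .lab, .acc, .ch, .leaf, .row, .start, .nacc, .par, .sz, .qa, .qb]

theorem Inv.congr (h : Inv G S₁ S₂ g s) (hr : ∀ v ∈ invVars, s'.reg v = s.reg v)
    (ha : ∀ k ∈ invArrs, s'.arr k = s.arr k) : Inv G S₁ S₂ g s' := by
  simp only [invVars, invArrs, List.forall_mem_cons, List.not_mem_nil, IsEmpty.forall_iff,
    implies_true, and_true] at hr ha
  obtain ⟨r1, r2, r3, r4, r5, r6, r7, r8, r9, r10⟩ := hr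
  obtain ⟨a1, a2, a3, a4, a5, a6, a7, a8, a9, a10, a11, a12, a13⟩ := ha
  obtain ⟨h1, h2, h3, h4, h5⟩ := h
  refine ⟨?_, ?_, ?_, ?_, ?_⟩
  · constructor <;> simp [*, h1.z, h1.one, h1.nn, h1.en, h1.sg, h1.src, h1.dst, h1.lab, h1.acc]
  · rwa [r6, r7, a5, a6]
  · rwa [r6, r8, a7, a8, a9]
  · rwa [r6, a10, a11]
  · rwa [a10, r6, r9, r10, a12, a13]

theorem Inv.frame (h : Inv G S₁ S₂ g s) {c : Prog} (hF : Frame c s s')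
    (hr : ∀ v ∈ invVars, c.writesVar v = false := by decide)
    (ha : ∀ k ∈ invArrs, c.writesArr k = false := by decide) : Inv G S₁ S₂ g s' :=
  h.congr (fun v hv => hF.reg v (hr v hv)) fun k hk => hF.arr k (ha k hk)

theorem Inv.set (h : Inv G S₁ S₂ g s) (d : Var) (x : ℕ) (hd : d ∉ invVars := by decide) :
    Inv G S₁ S₂ g (s.set d x) :=
  h.congr (fun v hv => by rw [St.set_reg, if_neg]; rintro rfl; exact hd hv) fun _ _ => rfl

theorem Inv.tock (h : Inv G S₁ S₂ g s) : Inv G S₁ S₂ g s.tock :=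
  h.congr (fun _ _ => rfl) fun _ _ => rfl

theorem Inv.put (h : Inv G S₁ S₂ g s) (k : Arr) (i x : ℕ) (hd : k ∉ invArrs := by decide) :
    Inv G S₁ S₂ g (s.put k i x) :=
  h.congr (fun _ _ => rfl) fun v hv => by rw [St.put_arr, if_neg]; rintro rfl; exact hd hv

/-- The row of the node is first unpacked into `cur` and `nxt` is cleared; then the whole edge list
is scanned, which makes the cost linear in `nn + en` for every letter. -/
theorem runs_expand (hI : Inv G S₁ S₂ g s) (hx : 1 ≤ s.reg .x) (hx' : s.reg .x ≤ s.reg .cnt) :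
    Runs B inp expand s fun s' =>
      (∀ j < G.nn, s'.arr .nxt j ≠ 0 ↔ j ∈ G.step (g.K (s.reg .x)) (s.reg .a)) ∧
      s'.tick ≤ s.tick + 5 + 6 * G.nn + 10 * G.en := by
  have hs := hI.static
  simp only [expand, runs_seq, runs_load]
  have hrow := hI.rows.row_iff _ hx hx'
  refine runs_for (fun k s' => s'.reg .p = s.arr .start (s.reg .x) + k ∧
    (∀ j < k, s'.arr .cur j ≠ 0 ↔ j ∈ g.K (s.reg .x)) ∧ (∀ j < k, s'.arr .nxt j = 0) ∧
    s'.tick ≤ s.tick + 2 + 6 * k) G.nn (by simp [hs.nn]) rfl rfl (by decide) ?_ ?_ ?_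
  · simp
  · rintro k s' hk hj - hF ⟨h1, h2, h3, h4⟩
    have hz : s'.reg .z = 0 := by rw [hF.reg _ rfl]; simpa using hs.z
    have hr : s'.arr .row = s.arr .row := by rw [hF.arr _ rfl]; rfl
    simp only [loadBit, runs_seq, runs_load, runs_store, runs_inc]
    simp only [St.put_reg, St.set_reg, St.put_arr, St.set_arr, reduceCtorEq, if_false, if_true,
      St.tock_reg, St.tock_arr, St.set_tick, St.put_tick, St.tock_tick, h1, hj, hr, hz]
    refine ⟨by omega, fun j hj => ?_, fun j hj => ?_, by omega⟩
    · rcases Nat.lt_succ_iff_lt_or_eq.1 hj with h | rfl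
      · rw [Function.update_of_ne (by omega)]; exact h2 j h
      · rw [Function.update_self]; exact hrow j hk
    · rcases Nat.lt_succ_iff_lt_or_eq.1 hj with h | rfl
      · rw [Function.update_of_ne (by omega)]; exact h3 j h
      · rw [Function.update_self]
  · rintro s₁ hF₁ ⟨-, h2, h3, h4⟩
    have hs₁ : Static G s₁ := by
      have : Static G (s.set .p (s.arr .start (s.reg .x))) := (hI.set _ _).static
      exact this.frame hF₁
    have ha₁ : s₁.reg .a = s.reg .a := by rw [hF₁.reg _ rfl]; simp
    refine runs_for (fun k s' =>
      (∀ j < G.nn, s'.arr .nxt j ≠ 0 ↔ ∃ e < k, G.lab e = s.reg .a ∧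
        G.src e ∈ g.K (s.reg .x) ∧ G.dst e = j) ∧
      s'.tick ≤ s.tick + 4 + 6 * G.nn + 10 * k) G.en (by simp [hs₁.en]) rfl rfl (by decide)
      ?_ ?_ ?_
    · refine ⟨fun j hj => ?_, ?_⟩
      · simp [h3 j hj]
      · simp; omega
    · rintro k s' hk he - hF ⟨h5, h6⟩
      have hs' : Static G s' := by
        have : Static G s₁.tock := ⟨hs₁.z, hs₁.one, hs₁.nn, hs₁.en, hs₁.sg, hs₁.src, hs₁.dst,
          hs₁.lab, hs₁.acc⟩
        exact this.frame hF
      have ha' : s'.reg .a = s.reg .a := by rw [hF.reg _ rfl]; exact ha₁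
      have hc : s'.arr .cur = s₁.arr .cur := by rw [hF.arr _ rfl]; rfl
      have hex : ∀ j, (∃ e < k + 1, G.lab e = s.reg .a ∧ G.src e ∈ g.K (s.reg .x) ∧ G.dst e = j) ↔
          (∃ e < k, G.lab e = s.reg .a ∧ G.src e ∈ g.K (s.reg .x) ∧ G.dst e = j) ∨
            (G.lab k = s.reg .a ∧ G.src k ∈ g.K (s.reg .x) ∧ G.dst k = j) := by
        intro j
        constructor
        · rintro ⟨e, he, hh⟩
          rcases Nat.lt_succ_iff_lt_or_eq.1 he with h | rfl
          · exact .inl ⟨e, h, hh⟩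
          · exact .inr hh
        · rintro (⟨e, he, hh⟩ | hh)
          · exact ⟨e, by omega, hh⟩
          · exact ⟨k, by omega, hh⟩
      have hsrc := h2 _ (G.src_lt k hk)
      simp only [followEdge, runs_seq, runs_load, runs_store, runs_zero, runs_ite_eq, runs_ite_lt]
      simp only [St.set_reg, St.put_arr, St.set_arr, reduceCtorEq, if_false, if_true,
        St.tock_reg, St.tock_arr, St.set_tick, St.put_tick, St.tock_tick, he, ha', hs'.lab, hs'.src,
        hs'.dst, hs'.z, hs'.one, hc, Nat.pos_iff_ne_zero, hsrc, hex]
      refine ⟨fun hl => ⟨fun hm => ⟨fun j hj => ?_, by omega⟩,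
        fun hm => ⟨fun j hj => ?_, by omega⟩⟩, fun hl => ⟨fun j hj => ?_, by omega⟩⟩
      · by_cases hjd : j = G.dst k
        · subst hjd; simp [hl, hm]
        · rw [Function.update_of_ne hjd, h5 j hj]
          simp [Ne.symm hjd]
      · rw [h5 j hj]; simp [hm]
      · rw [h5 j hj]; simp [hl]
    · rintro s₂ hF₂ ⟨h5, h6⟩
      refine ⟨h5, ?_⟩
      simp; omega

theorem runs_succ (hI : Inv G S₁ S₂ g s) (hx : 1 ≤ s.reg .x) (hx' : s.reg .x ≤ s.reg .cnt)
    (ha : s.reg .a < G.sg) :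
    Runs B inp succ s fun s' => ∃ g', Inv G S₁ S₂ g' s' ∧ Extends g s g' s' ∧
      (1 ≤ s'.reg .id ∧ s'.reg .id ≤ s'.reg .cnt) ∧
      g'.K (s'.reg .id) = G.step (g.K (s.reg .x)) (s.reg .a) ∧
      s'.tick ≤ s.tick + 25 + 40 * (G.nn + G.en) := by
  rw [succ, runs_seq]
  refine (runs_expand hI hx hx').mono fun s' hF ⟨h1, h2⟩ => ?_
  have hI' : Inv G S₁ S₂ g s' := hI.frame hF
  have hcnt : s'.reg .cnt = s.reg .cnt := hF.reg _ rfl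
  refine (runs_lookup hI' ?_ (fun j hj => G.step_lt j hj) h1).mono ?_
  -- A word that reaches the set of `x`, extended by the letter, reaches the successor set.
  · obtain ⟨w, hw, h⟩ := hI.queue.reach _ hx hx'
    refine ⟨w ++ [s.reg .a], hw.snoc ha, ?_⟩
    rw [Graph.eval_snoc, Graph.eval_snoc]
    rcases h with h | h <;> simp [h]
  · rintro s'' - ⟨g', a1, a2, a3, a4, a5⟩
    exact ⟨g', a1, (Extends.refl g s s' hcnt).trans a2, a3, a4, by omega⟩

/-! ### Merging two nodes -/

/-- Let `f` be the root of the tree of the node `u`. -/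
def findRoot (f u : Var) : Prog :=
  .move f u ;; .load .t .par f ;; .loop (.lt .z .t) (.move f .t ;; .load .t .par f)

/-- Sizes at least double along each parent edge and never exceed `cnt`, so the path to the root has
at most `log₂ cnt` edges. In the loop invariant `k` counts the edges followed so far. -/
theorem runs_findRoot {cnt : ℕ} {R : ℕ → ℕ} {f u : Var} (hf : f ∉ [Var.z, .t])
    (hz : s.reg .z = 0)
    (h : UnionFind cnt (s.arr .par) (s.arr .sz) R) (hu : 1 ≤ s.reg u) (hu' : s.reg u ≤ cnt) :
    Runs B inp (findRoot f u) s fun s' => (1 ≤ s'.reg f ∧ s'.reg f ≤ cnt) ∧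
      s.arr .par (s'.reg f) = 0 ∧ R (s'.reg f) = R (s.reg u) ∧
      s'.tick ≤ s.tick + 3 + 3 * Nat.log 2 cnt := by
  simp only [List.mem_cons, List.not_mem_nil, or_false, not_or] at hf
  simp only [findRoot, runs_seq, runs_move, runs_load]
  refine runs_loop (fun s' => (1 ≤ s'.reg f ∧ s'.reg f ≤ cnt) ∧ s'.reg .z = 0 ∧
    s'.arr .par = s.arr .par ∧ s'.reg .t = s.arr .par (s'.reg f) ∧ R (s'.reg f) = R (s.reg u) ∧
    ∃ k, 2 ^ k ≤ s.arr .sz (s'.reg f) ∧ s'.tick ≤ s.tick + 2 + 3 * k)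
    (fun s' => cnt - s.arr .sz (s'.reg f)) ?_ ?_ ?_
  · have := (h.pos _ hu hu').1
    simp [hf.2, hz, hu, hu', Ne.symm hf.1]
    exact ⟨0, by simpa using this⟩
  · rintro s' - ⟨⟨h1, h2⟩, h3, h4, h5, h6, k, h7, h8⟩ hb
    have hb' : s.arr .par (s'.reg f) ≠ 0 := by
      simp only [Cond.holds, h3, h5] at hb; omega
    obtain ⟨-, e2, e3⟩ := h.up _ hb'
    have hle := h.par_le (s'.reg f)
    have hp := h.pos _ (Nat.pos_of_ne_zero hb') hle
    have hp0 := h.pos _ h1 h2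
    simp [hf.2, h3, h4, h5, Ne.symm hf.1, e2, h6]
    refine ⟨⟨⟨by omega, hle⟩, k + 1, by rw [pow_succ]; omega, by omega⟩, by omega⟩
  · rintro s' - ⟨h1, h3, h4, h5, h6, k, h7, h8⟩ hb
    have hb' : s.arr .par (s'.reg f) = 0 := by
      simp only [Cond.holds, h3, h5] at hb; omega
    refine ⟨h1, hb', h6, ?_⟩
    have hk : k ≤ Nat.log 2 cnt :=
      Nat.le_log_of_pow_le (by norm_num) (h7.trans (h.pos _ h1.1 h1.2).2)
    simp; omega

/-- Compare the acceptance flags of the nodes `u` and `v`. -/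
def compareFlags : Prog :=
  .load .x .nacc .u ;; .load .y .nacc .v ;; .ite (.eq .x .y) (.zero .c) (.move .bad .one)

/-- Queue the pair of the nodes `u` and `v`, and join the trees with roots `fx` and `fy`. -/
def joinTrees : Prog :=
  .store .qa .ql .u ;; .store .qb .ql .v ;; .inc .ql ;;
  .load .gx .sz .fx ;; .load .gy .sz .fy ;; .add .c .gx .gy ;;
  .ite (.lt .gx .gy) (.store .par .fx .fy ;; .store .sz .fy .c)
    (.store .par .fy .fx ;; .store .sz .fx .c)

/-- Merge the nodes `u` and `v`. -/
def merge : Prog :=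
  compareFlags ;; findRoot .fx .u ;; findRoot .fy .v ;; .ite (.eq .fx .fy) (.zero .c) joinTrees

theorem runs_compareFlags (hI : Inv G S₁ S₂ g s) (hu : 1 ≤ s.reg .u) (hu' : s.reg .u ≤ s.reg .cnt)
    (hv : 1 ≤ s.reg .v) (hv' : s.reg .v ≤ s.reg .cnt)
    (hw : ∃ w, G.Word w ∧ g.K (s.reg .u) = G.eval S₁ w ∧ g.K (s.reg .v) = G.eval S₂ w) :
    Runs B inp compareFlags s fun s' => Inv G S₁ S₂ g s' ∧
      (s'.reg .bad = 0 → (G.Acc (g.K (s.reg .u)) ↔ G.Acc (g.K (s.reg .v)))) ∧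
      s'.tick ≤ s.tick + 4 := by
  classical
  have hs := hI.static
  have eu := hI.rows.nacc_eq _ hu hu'
  have ev := hI.rows.nacc_eq _ hv hv'
  simp only [compareFlags, runs_seq, runs_load, runs_ite_eq, runs_move, runs_zero]
  simp only [St.set_reg, St.set_arr, reduceCtorEq, if_false, if_true,
    St.tock_reg, St.set_tick, St.tock_tick, eu, ev, hs.one]
  refine ⟨fun h => ⟨?_, fun _ => ?_, by omega⟩, fun h => ⟨?_, by simp, by omega⟩⟩
  · exact ((((hI.set .x _).set .y _).tock).set .c _)
  · by_cases a1 : G.Acc (g.K (s.reg .u)) <;> by_cases a2 : G.Acc (g.K (s.reg .v)) <;> simp_all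
  · have h3 := (((hI.set .x (s.arr .nacc (s.reg .u))).set .y (s.arr .nacc (s.reg .v))).tock)
    have h4 := h3.static
    have hq := hI.queue
    refine ⟨?_, by simpa using h3.trie, by simpa using h3.rows, by simpa using h3.uf, ?_⟩
    · constructor <;> simp [hs.z, hs.one, hs.nn, hs.en, hs.sg, hs.src, hs.dst, hs.lab, hs.acc]
    · simp
      -- The word that leads the two start sets to the present pair is accepted by exactly one side.
      refine ⟨hq.reach, hq.pair, by simp, fun _ => ?_, hq.conn, hq.count⟩
      obtain ⟨w, hw, e1, e2⟩ := hw
      refine ⟨w, hw, ?_⟩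
      rw [← e1, ← e2]
      intro hiff
      exact h (if_congr hiff rfl rfl)

/-- The new pair, as an additional generator, connects the two joined classes, and one root fewer
balances one queue entry more. The hypothesis `hr` covers both directions because the sizes decide
which root is attached. -/
theorem Queue.link {K : ℕ → Set ℕ} {R par : ℕ → ℕ} {cnt ql bad : ℕ} {qa qb : ℕ → ℕ}
    (h : Queue G S₁ S₂ K R par cnt ql bad qa qb) {u v r₁ r₂ : ℕ}
    (hu : 1 ≤ u ∧ u ≤ cnt) (hv : 1 ≤ v ∧ v ≤ cnt)
    (hw : ∃ w, G.Word w ∧ K u = G.eval S₁ w ∧ K v = G.eval S₂ w)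
    (hacc : bad = 0 → (G.Acc (K u) ↔ G.Acc (K v)))
    (h1 : 1 ≤ r₁ ∧ r₁ ≤ cnt) (hp1 : par r₁ = 0) (h2 : 1 ≤ r₂)
    (hr : R u = r₁ ∧ R v = r₂ ∨ R v = r₁ ∧ R u = r₂) :
    Queue G S₁ S₂ K (fun x => if R x = r₁ then r₂ else R x) (Function.update par r₁ r₂) cnt
      (ql + 1) bad (Function.update qa ql u) (Function.update qb ql v) := by
  have hqa : ∀ i < ql, Function.update qa ql u i = qa i := fun i hi =>
    Function.update_of_ne (by omega) _ _
  have hqb : ∀ i < ql, Function.update qb ql v i = qb i := fun i hi =>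
    Function.update_of_ne (by omega) _ _
  refine ⟨h.reach, fun i hi => ?_, fun hb i hi => ?_, h.wrong, ?_, ?_⟩
  · rcases Nat.lt_succ_iff_lt_or_eq.1 hi with h' | rfl
    · rw [hqa i h', hqb i h']; exact h.pair i h'
    · simpa using ⟨hu, hv, hw⟩
  · rcases Nat.lt_succ_iff_lt_or_eq.1 hi with h' | rfl
    · rw [hqa i h', hqb i h']; exact h.good hb i h'
    · simpa using hacc hb
  · set E := Relation.EqvGen fun S T => ∃ i < ql + 1, S = K (Function.update qa ql u i) ∧
      T = K (Function.update qb ql v i)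
    have hE : ∀ x y, 1 ≤ x ∧ x ≤ cnt → 1 ≤ y ∧ y ≤ cnt → R x = R y → E (K x) (K y) := by
      intro x y hx hy hxy
      refine (h.conn x y hx.1 hx.2 hy.1 hy.2 hxy).mono ?_
      rintro _ _ ⟨i, hi, rfl, rfl⟩
      exact ⟨i, by omega, by rw [hqa i hi], by rw [hqb i hi]⟩
    have huv : E (K u) (K v) := .rel _ _ ⟨ql, by omega, by simp, by simp⟩
    -- From the class of `r₁` to the class of `r₂`: through the new pair, in whichever orientation
    -- it was queued.
    have hcross : ∀ x y, 1 ≤ x ∧ x ≤ cnt → 1 ≤ y ∧ y ≤ cnt → R x = r₁ → R y = r₂ →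
        E (K x) (K y) := by
      intro x y hx hy hx1 hy2
      rcases hr with ⟨e1, e2⟩ | ⟨e1, e2⟩
      · exact .trans _ _ _ (hE x u hx hu (by rw [hx1, e1]))
          (.trans _ _ _ huv (hE v y hv hy (by rw [hy2, e2])))
      · exact .trans _ _ _ (hE x v hx hv (by rw [hx1, e1]))
          (.trans _ _ _ (.symm _ _ huv) (hE u y hu hy (by rw [hy2, e2])))
    intro x y hx hx' hy hy' hxy
    by_cases hx1 : R x = r₁ <;> by_cases hy1 : R y = r₁ <;> simp only [hx1, hy1, if_true, if_false] at hxy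
    · exact hE x y ⟨hx, hx'⟩ ⟨hy, hy'⟩ (hx1.trans hy1.symm)
    · exact hcross x y ⟨hx, hx'⟩ ⟨hy, hy'⟩ hx1 hxy.symm
    · exact .symm _ _ (hcross y x ⟨hy, hy'⟩ ⟨hx, hx'⟩ hy1 hxy)
    · exact hE x y ⟨hx, hx'⟩ ⟨hy, hy'⟩ hxy
  · have := h.count
    rw [UnionFind.card_roots_link h1.1 h1.2 hp1 h2] at this
    omega

theorem runs_joinTrees (hI : Inv G S₁ S₂ g s) (hB : s.reg .cnt ≤ B)
    (hu : 1 ≤ s.reg .u ∧ s.reg .u ≤ s.reg .cnt)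
    (hv : 1 ≤ s.reg .v ∧ s.reg .v ≤ s.reg .cnt)
    (hw : ∃ w, G.Word w ∧ g.K (s.reg .u) = G.eval S₁ w ∧ g.K (s.reg .v) = G.eval S₂ w)
    (hacc : s.reg .bad = 0 → (G.Acc (g.K (s.reg .u)) ↔ G.Acc (g.K (s.reg .v))))
    (hx : 1 ≤ s.reg .fx ∧ s.reg .fx ≤ s.reg .cnt) (hpx : s.arr .par (s.reg .fx) = 0)
    (hRx : g.R (s.reg .fx) = g.R (s.reg .u))
    (hy : 1 ≤ s.reg .fy ∧ s.reg .fy ≤ s.reg .cnt) (hpy : s.arr .par (s.reg .fy) = 0)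
    (hRy : g.R (s.reg .fy) = g.R (s.reg .v)) (hne : s.reg .fx ≠ s.reg .fy) :
    Runs B inp joinTrees s fun s' => ∃ g', Inv G S₁ S₂ g' s' ∧ Extends g s g' s' ∧
      Linked g'.K g'.R (s'.reg .cnt) (g.K (s.reg .u)) (g.K (s.reg .v)) ∧
      s.reg .ql ≤ s'.reg .ql ∧
      (∀ i < s.reg .ql, s'.arr .qa i = s.arr .qa i ∧ s'.arr .qb i = s.arr .qb i) ∧
      s'.tick ≤ s.tick + 9 := by
  have hs := hI.static
  have huf := hI.uf
  have hq := hI.queue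
  have ht := hI.trie
  have hr := hI.rows
  have hRx' := huf.root _ hx.1 hx.2 hpx
  have hRy' := huf.root _ hy.1 hy.2 hpy
  -- Discharges the side condition `≤ B` of the addition.
  have hsum := huf.add_le hx.1 hx.2 hpx hy.1 hy.2 hpy hne
  have hlink : ∀ r₁ r₂, (g.R (s.reg .u) = r₁ ∧ g.R (s.reg .v) = r₂ ∨
      g.R (s.reg .v) = r₁ ∧ g.R (s.reg .u) = r₂) →
      Linked g.K (fun x => if g.R x = r₁ then r₂ else g.R x) (s.reg .cnt) (g.K (s.reg .u))
        (g.K (s.reg .v)) := by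
    intro r₁ r₂ h
    refine ⟨_, _, hu, hv, rfl, rfl, ?_⟩
    rcases h with ⟨h1, h2⟩ | ⟨h1, h2⟩ <;> simp [h1, h2]
  have hmono : ∀ r₁ r₂ S T, Linked g.K g.R (s.reg .cnt) S T →
      Linked g.K (fun x => if g.R x = r₁ then r₂ else g.R x) (s.reg .cnt) S T := by
    rintro r₁ r₂ _ _ ⟨x, y, h1, h2, rfl, rfl, h⟩
    exact ⟨x, y, h1, h2, rfl, rfl, by simp only [h]⟩
  simp only [joinTrees, runs_seq, runs_load, runs_store, runs_inc, runs_add, runs_ite_lt]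
  simp only [St.put_reg, St.set_reg, St.put_arr, St.set_arr, reduceCtorEq, if_false, if_true,
    St.tock_reg, St.tock_arr, St.set_tick, St.put_tick, St.tock_tick]
  have hqs : ∀ i < s.reg .ql, Function.update (s.arr .qa) (s.reg .ql) (s.reg .u) i = s.arr .qa i ∧
      Function.update (s.arr .qb) (s.reg .ql) (s.reg .v) i = s.arr .qb i := fun i hi =>
    ⟨Function.update_of_ne (by omega) _ _, Function.update_of_ne (by omega) _ _⟩
  refine ⟨by omega, fun hlt => ?_, fun hlt => ?_⟩
  · have hr12 : g.R (s.reg .u) = s.reg .fx ∧ g.R (s.reg .v) = s.reg .fy :=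
      ⟨hRx.symm.trans hRx', hRy.symm.trans hRy'⟩
    refine ⟨⟨g.K, g.P, fun x => if g.R x = s.reg .fx then s.reg .fy else g.R x⟩,
      ⟨?_, ?_, ?_, ?_, ?_⟩, ⟨by simp, fun _ _ _ => rfl, by simpa using hmono _ _⟩,
      by simpa using hlink _ _ (.inl hr12), by omega, hqs, by omega⟩
    · constructor <;> simp [hs.z, hs.one, hs.nn, hs.en, hs.sg, hs.src, hs.dst, hs.lab, hs.acc]
    · simpa using ht
    · simpa using hr
    · simpa using huf.link hx.1 hx.2 hpx hy.1 hy.2 hpy hne hlt.le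
    · simpa using hq.link hu hv hw hacc hx hpx hy.1 (.inl hr12)
  · have hr12 : g.R (s.reg .v) = s.reg .fy ∧ g.R (s.reg .u) = s.reg .fx :=
      ⟨hRy.symm.trans hRy', hRx.symm.trans hRx'⟩
    refine ⟨⟨g.K, g.P, fun x => if g.R x = s.reg .fy then s.reg .fx else g.R x⟩,
      ⟨?_, ?_, ?_, ?_, ?_⟩, ⟨by simp, fun _ _ _ => rfl, by simpa using hmono _ _⟩,
      by simpa using hlink _ _ (.inr hr12), by omega, hqs, by omega⟩
    · constructor <;> simp [hs.z, hs.one, hs.nn, hs.en, hs.sg, hs.src, hs.dst, hs.lab, hs.acc]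
    · simpa using ht
    · simpa using hr
    · simpa [add_comm] using huf.link hy.1 hy.2 hpy hx.1 hx.2 hpx hne.symm (not_lt.1 hlt)
    · simpa using hq.link hu hv hw hacc hy hpy hx.1 (.inr hr12)

theorem runs_merge (hI : Inv G S₁ S₂ g s) (hB : s.reg .cnt ≤ B)
    (hu : 1 ≤ s.reg .u ∧ s.reg .u ≤ s.reg .cnt)
    (hv : 1 ≤ s.reg .v ∧ s.reg .v ≤ s.reg .cnt)
    (hw : ∃ w, G.Word w ∧ g.K (s.reg .u) = G.eval S₁ w ∧ g.K (s.reg .v) = G.eval S₂ w) :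
    Runs B inp merge s fun s' => ∃ g', Inv G S₁ S₂ g' s' ∧ Extends g s g' s' ∧
      Linked g'.K g'.R (s'.reg .cnt) (g.K (s.reg .u)) (g.K (s.reg .v)) ∧
      s.reg .ql ≤ s'.reg .ql ∧
      (∀ i < s.reg .ql, s'.arr .qa i = s.arr .qa i ∧ s'.arr .qb i = s.arr .qb i) ∧
      s'.tick ≤ s.tick + 20 + 6 * Nat.log 2 (s.reg .cnt) := by
  simp only [merge, runs_seq]
  refine (runs_compareFlags hI hu.1 hu.2 hv.1 hv.2 hw).mono fun s₁ hF₁ ⟨hI₁, hacc₁, t₁⟩ => ?_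
  have e1 : ∀ v : Var, v ∉ [Var.x, .y, .c, .bad] → s₁.reg v = s.reg v := fun v hv =>
    hF₁.reg v (by simp at hv; simp [compareFlags, Prog.writesVar, hv])
  have e1a : s₁.arr = s.arr := funext fun k => hF₁.arr k rfl
  have c1 := e1 .cnt (by decide)
  have u1 := e1 .u (by decide)
  have v1 := e1 .v (by decide)
  refine (runs_findRoot (f := .fx) (u := .u) (by decide) hI₁.static.z hI₁.uf (by omega)
    (by omega)).mono fun s₂ hF₂ ⟨h₂, p₂, r₂, t₂⟩ => ?_
  have hI₂ := hI₁.frame hF₂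
  have e2 : ∀ v : Var, v ∉ [Var.fx, .t] → s₂.reg v = s₁.reg v := fun v hv =>
    hF₂.reg v (by simp at hv; simp [findRoot, Prog.writesVar, hv])
  have e2a : s₂.arr = s₁.arr := funext fun k => hF₂.arr k rfl
  have c2 := e2 .cnt (by decide)
  have u2 := e2 .u (by decide)
  have v2 := e2 .v (by decide)
  refine (runs_findRoot (f := .fy) (u := .v) (by decide) hI₂.static.z hI₂.uf (by omega)
    (by omega)).mono fun s₃ hF₃ ⟨h₃, p₃, r₃, t₃⟩ => ?_
  have hI₃ := hI₂.frame hF₃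
  have e3 : ∀ v : Var, v ∉ [Var.fy, .t] → s₃.reg v = s₂.reg v := fun v hv =>
    hF₃.reg v (by simp at hv; simp [findRoot, Prog.writesVar, hv])
  have e3a : s₃.arr = s₂.arr := funext fun k => hF₃.arr k rfl
  have c3 := e3 .cnt (by decide)
  have u3 := e3 .u (by decide)
  have v3 := e3 .v (by decide)
  have fx3 := e3 .fx (by decide)
  have b3 := (e3 .bad (by decide)).trans (e2 .bad (by decide))
  have q3 := ((e3 .ql (by decide)).trans (e2 .ql (by decide))).trans (e1 .ql (by decide))
  have a3 : s₃.arr = s.arr := e3a.trans (e2a.trans e1a)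
  have uu := u3.trans (u2.trans u1)
  have vv := v3.trans (v2.trans v1)
  have cc := c3.trans (c2.trans c1)
  rw [c1] at t₂ h₂
  rw [c2, c1] at t₃ h₃
  rw [u1] at r₂
  rw [v2, v1] at r₃
  rw [e1a] at p₂
  rw [e2a, e1a] at p₃
  simp only [runs_ite_eq, runs_zero]
  refine ⟨fun heq => ?_, fun hne => ?_⟩
  · refine ⟨g, hI₃.tock.set _ _, Extends.refl _ _ _ (by simpa using cc),
      ⟨_, _, by simpa [cc] using hu, by simpa [cc] using hv, rfl, rfl, ?_⟩, by simp [q3], ?_,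
      by simp; omega⟩
    · rw [← r₂, ← r₃, ← fx3, heq]
    · simp [a3]
  · refine (runs_joinTrees hI₃.tock (by simpa [cc] using hB) (by simpa [uu, cc] using hu)
      (by simpa [vv, cc] using hv) (by simpa [uu, vv] using hw)
      (by simpa [uu, vv, b3] using hacc₁) (by simpa [fx3, cc] using h₂) (by simpa [fx3, a3] using p₂)
      (by simpa [fx3, uu] using r₂) (by simpa [cc] using h₃) (by simpa [a3] using p₃)
      (by simpa [vv] using r₃) hne).mono ?_
    rintro s₄ - ⟨g', b1, b2, b3, b4, b5, b6⟩
    refine ⟨g', b1, (Extends.refl g s s₃.tock cc).trans b2, by simpa [uu, vv] using b3,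
      by simpa [q3] using b4, by simpa [q3, a3] using b5, ?_⟩
    simp at b6
    omega

end
end ArrayLang

namespace ArrayLang

/-! ### The equivalence test -/

/-- Merge the successors of the pair number `qh` under the letter `a`. -/
def mergeSuccs : Prog :=
  .load .x .qa .qh ;; succ ;; .move .u .id ;; .load .x .qb .qh ;; succ ;; .move .v .id ;; merge

def processPair : Prog := .for .a .sg mergeSuccs ;; .inc .qh

/-- Merge the two start nodes. -/
def seed : Prog :=
  .inc .fresh ;; .store .nxt .s₁ .one ;; lookup ;; .move .u .id ;; .store .nxt .s₁ .z ;;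
  .store .nxt .s₂ .one ;; lookup ;; .move .v .id ;; merge

/-- Decide whether the states `s₁` and `s₂` accept the same words. -/
def equivalence : Prog :=
  seed ;; .zero .qh ;; .loop (.lt .qh .ql) processPair ;;
  .ite (.eq .bad .z) (.move .res .one) (.zero .res)

section
variable {B : ℕ} {inp : ℕ → ℕ} {G : Graph} {S₁ S₂ : Set ℕ} {g : Ghost} {s : St}

/-- The cost of processing one pair and one letter, if there are at most `N` nodes. -/
def Graph.cost (G : Graph) (N : ℕ) : ℕ := 100 + 80 * (G.nn + G.en) + 6 * Nat.log 2 N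

/-- The slack `+ 2` in the time bound pays for the test and the increment of the surrounding loop
over the letters. -/
theorem runs_mergeSuccs (hfin : (G.reached S₁ S₂).Finite) {N : ℕ}
    (hN : (G.reached S₁ S₂).ncard ≤ N) (hB : N ≤ B) (hI : Inv G S₁ S₂ g s)
    (hq : s.reg .qh < s.reg .ql) (ha : s.reg .a < G.sg) :
    Runs B inp mergeSuccs s fun s' => ∃ g', Inv G S₁ S₂ g' s' ∧ Extends g s g' s' ∧
      Linked g'.K g'.R (s'.reg .cnt)
        (G.step (g.K (s.arr .qa (s.reg .qh))) (s.reg .a))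
        (G.step (g.K (s.arr .qb (s.reg .qh))) (s.reg .a)) ∧
      s.reg .ql ≤ s'.reg .ql ∧
      (∀ i < s.reg .ql, s'.arr .qa i = s.arr .qa i ∧ s'.arr .qb i = s.arr .qb i) ∧
      s'.tick + 2 ≤ s.tick + G.cost N := by
  obtain ⟨⟨a1, a2⟩, ⟨b1, b2⟩, w, hw, wa, wb⟩ := hI.queue.pair _ hq
  simp only [mergeSuccs, runs_seq, runs_load, runs_move]
  refine (runs_succ (hI.set .x _) (by simpa using a1) (by simpa using a2)
    (by simpa using ha)).mono fun s₁ hF₁ ⟨g₁, I₁, X₁, i₁, k₁, t₁⟩ => ?_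
  simp at k₁ t₁
  have q₁ : s₁.reg .qh = s.reg .qh := by rw [hF₁.reg _ rfl]; simp
  have l₁ : s₁.reg .ql = s.reg .ql := by rw [hF₁.reg _ rfl]; simp
  have y₁ : s₁.reg .a = s.reg .a := by rw [hF₁.reg _ rfl]; simp
  have qa₁ : s₁.arr .qa = s.arr .qa := by rw [hF₁.arr _ rfl]; simp
  have qb₁ : s₁.arr .qb = s.arr .qb := by rw [hF₁.arr _ rfl]; simp
  have c₁ : s.reg .cnt ≤ s₁.reg .cnt := by simpa using X₁.cnt
  -- The first successor may create nodes, but the keys of existing nodes persist, so the second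
  -- component of the pair is still the same set.
  have kb : g₁.K (s.arr .qb (s.reg .qh)) = g.K (s.arr .qb (s.reg .qh)) :=
    X₁.key _ b1 (by simpa using b2)
  refine (runs_succ ((I₁.set .u _).set .x _) (by simpa [q₁, qb₁] using b1)
    (by simpa [q₁, qb₁] using b2.trans c₁) (by simpa [y₁] using ha)).mono
    fun s₂ hF₂ ⟨g₂, I₂, X₂, i₂, k₂, t₂⟩ => ?_
  simp [q₁, qb₁, y₁, kb] at k₂ t₂
  have u₂ : s₂.reg .u = s₁.reg .id := by rw [hF₂.reg _ rfl]; simp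
  have l₂ : s₂.reg .ql = s₁.reg .ql := by rw [hF₂.reg _ rfl]; simp
  have qa₂ : s₂.arr .qa = s₁.arr .qa := by rw [hF₂.arr _ rfl]; simp
  have qb₂ : s₂.arr .qb = s₁.arr .qb := by rw [hF₂.arr _ rfl]; simp
  have c₂ : s₁.reg .cnt ≤ s₂.reg .cnt := by simpa using X₂.cnt
  have ku : g₂.K (s₁.reg .id) = g₁.K (s₁.reg .id) := X₂.key _ i₁.1 (by simpa using i₁.2)
  have hcN := (I₂.cnt_le hfin).trans hN
  refine (runs_merge (I₂.set .v _) (by simpa using hcN.trans hB)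
    (by simpa [u₂] using ⟨i₁.1, i₁.2.trans c₂⟩) (by simpa using i₂) ?_).mono
    fun s₃ hF₃ ⟨g₃, I₃, X₃, L₃, q₃, e₃, t₃⟩ => ?_
  · refine ⟨w ++ [s.reg .a], hw.snoc ha, ?_, ?_⟩
    · simp [u₂, ku, k₁, Graph.eval_snoc, wa]
    · simp [k₂, Graph.eval_snoc, wb]
  · simp [u₂, ku, k₁, k₂] at L₃
    simp [l₂, l₁] at q₃ e₃
    simp at t₃
    have hlog : Nat.log 2 (s₂.reg .cnt) ≤ Nat.log 2 N := Nat.log_mono_right hcN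
    refine ⟨g₃, I₃, ⟨?_, ?_, ?_⟩, L₃, q₃, fun i hi => ?_, ?_⟩
    · have := X₃.cnt; simp at this; omega
    · intro x hx hx'
      rw [X₃.key x hx (by simp; omega), X₂.key x hx (by simp; omega), X₁.key x hx (by simpa using hx')]
    · intro S T h
      exact X₃.linked S T (by simpa using X₂.linked S T (by simpa using X₁.linked S T (by simpa using h)))
    · have := e₃ i hi
      rwa [qa₂, qa₁, qb₂, qb₁] at this
    · unfold Graph.cost
      omega

theorem runs_processPair (hfin : (G.reached S₁ S₂).Finite) {N : ℕ}
    (hN : (G.reached S₁ S₂).ncard ≤ N) (hB : N ≤ B) (hI : Inv G S₁ S₂ g s)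
    (hq : s.reg .qh < s.reg .ql) :
    Runs B inp processPair s fun s' => ∃ g', Inv G S₁ S₂ g' s' ∧ Extends g s g' s' ∧
      (∀ a < G.sg, Linked g'.K g'.R (s'.reg .cnt) (G.step (g.K (s.arr .qa (s.reg .qh))) a)
        (G.step (g.K (s.arr .qb (s.reg .qh))) a)) ∧
      s.reg .ql ≤ s'.reg .ql ∧
      (∀ i < s.reg .ql, s'.arr .qa i = s.arr .qa i ∧ s'.arr .qb i = s.arr .qb i) ∧
      s'.reg .qh = s.reg .qh + 1 ∧ s'.tick ≤ s.tick + 3 + G.sg * G.cost N := by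
  simp only [processPair, runs_seq, runs_inc]
  refine runs_for (fun k s' => ∃ g', Inv G S₁ S₂ g' s' ∧ Extends g s g' s' ∧
      (∀ a < k, Linked g'.K g'.R (s'.reg .cnt) (G.step (g.K (s.arr .qa (s.reg .qh))) a)
        (G.step (g.K (s.arr .qb (s.reg .qh))) a)) ∧
      s.reg .ql ≤ s'.reg .ql ∧
      (∀ i < s.reg .ql, s'.arr .qa i = s.arr .qa i ∧ s'.arr .qb i = s.arr .qb i) ∧
      s'.tick ≤ s.tick + 1 + k * G.cost N) G.sg hI.static.sg rfl rfl (by decide) ?_ ?_ ?_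
  · exact ⟨g, hI.set _ _, Extends.refl _ _ _ (by simp), by simp, by simp, by simp, by simp⟩
  · rintro k s' hk ha - hF ⟨g', h1, h2, h3, h4, h5, h6⟩
    have hqh : s'.reg .qh = s.reg .qh := hF.reg _ rfl
    -- The queue may have grown under earlier letters, but the entry being processed is intact.
    have h5q := h5 _ hq
    obtain ⟨⟨a1, a2⟩, ⟨b1, b2⟩, -⟩ := hI.queue.pair _ hq
    refine (runs_mergeSuccs hfin hN hB h1.tock (by simpa [hqh] using hq.trans_le h4)
      (by simpa [ha] using hk)).mono fun s'' hF' ⟨g'', k1, k2, k3, k4, k5, k6⟩ => ?_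
    simp [hqh, ha, h5q, h2.key _ a1 a2, h2.key _ b1 b2] at k3 k4 k5 k6
    refine ⟨g'', k1.set _ _, ⟨?_, ?_, ?_⟩, fun a ha => ?_, ?_, ?_, ?_⟩
    · have := k2.cnt; have := h2.cnt; simp at *; omega
    · intro x hx hx'
      rw [k2.key x hx (hx'.trans h2.cnt), h2.key x hx hx']
    · intro S T h
      simpa using k2.linked S T (h2.linked S T h)
    · rcases Nat.lt_succ_iff_lt_or_eq.1 ha with h | rfl
      · simpa using k2.linked _ _ (h3 a h)
      · simpa using k3
    · simpa using h4.trans k4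
    · intro i hi
      obtain ⟨e1, e2⟩ := k5 i (hi.trans_le h4)
      obtain ⟨e3, e4⟩ := h5 i hi
      exact ⟨e1.trans e3, e2.trans e4⟩
    · rw [St.set_tick, Nat.succ_mul]
      omega
  · rintro s' hF ⟨g', h1, h2, h3, h4, h5, h6⟩
    have hqh : s'.reg .qh = s.reg .qh := hF.reg _ rfl
    refine ⟨g', h1.tock.set _ _, ⟨by simpa using h2.cnt, h2.key, by simpa using h2.linked⟩,
      by simpa using h3, by simpa using h4, by simpa using h5, by simp [hqh], ?_⟩
    simp
    omega

/-- The states in which the equivalence test is started: the graph is given and everything else is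
empty. -/
structure Ready (G : Graph) (s : St) : Prop where
  static : Static G s
  reg : ∀ v ∈ [Var.cnt, .fresh, .top, .ql, .bad], s.reg v = 0
  arr : ∀ k ∈ [Arr.ch, .leaf, .par, .nxt], s.arr k = 0

theorem runs_seed (hs : Ready G s) (h1 : s.reg .s₁ < G.nn) (h2 : s.reg .s₂ < G.nn)
    (hfin : (G.reached {s.reg .s₁} {s.reg .s₂}).Finite) {N : ℕ}
    (hN : (G.reached {s.reg .s₁} {s.reg .s₂}).ncard ≤ N) (hB : N ≤ B) :
    Runs B inp seed s fun s' => ∃ g', Inv G {s.reg .s₁} {s.reg .s₂} g' s' ∧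
      Linked g'.K g'.R (s'.reg .cnt) {s.reg .s₁} {s.reg .s₂} ∧
      s'.tick + 2 ≤ s.tick + G.cost N := by
  obtain ⟨hst, hr, ha⟩ := hs
  simp only [List.forall_mem_cons, List.not_mem_nil, IsEmpty.forall_iff, implies_true,
    and_true] at hr ha
  obtain ⟨r1, r2, r3, r4, r5⟩ := hr
  obtain ⟨a1, a2, a3, a4⟩ := ha
  set S₁ : Set ℕ := {s.reg .s₁} with hS₁
  set S₂ : Set ℕ := {s.reg .s₂} with hS₂
  have w0 : G.Word [] := by simp [Graph.Word]
  simp only [seed, runs_seq, runs_inc, runs_store, runs_move]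
  -- The trie root occupies the cell `0`, so `fresh` has to be raised to `1` before the invariant
  -- holds for the empty dictionary.
  have hI : Inv G S₁ S₂ ⟨fun _ => ∅, fun _ => [], fun _ => 0⟩
      ((s.set .fresh (s.reg .fresh + 1)).put .nxt (s.reg .s₁) 1) := by
    refine ⟨?_, ?_, ?_, ?_, ?_⟩
    · constructor <;> simp [hst.z, hst.one, hst.nn, hst.en, hst.sg, hst.src, hst.dst, hst.lab, hst.acc]
    · constructor <;> simp [r1, r2, a1, a2]
      omega
    · constructor <;> simp [r1] <;> omega
    · constructor <;> simp [r1, a3] <;> omega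
    · constructor <;> simp [r1, r4, r5, a3, roots] <;> omega
  have hone := hst.one
  rw [St.set_reg, if_neg (by decide), St.set_reg, if_neg (by decide), hone]
  refine (runs_lookup (S := S₁) hI ⟨[], w0, .inl rfl⟩
    (by simpa [hS₁] using h1) ?_).mono fun s₁ hF₁ ⟨g₁, I₁, X₁, i₁, k₁, t₁⟩ => ?_
  · intro j hj
    simp [a4, hS₁, Function.update_apply]
  have n₁ : s₁.arr .nxt = Function.update (0 : ℕ → ℕ) (s.reg .s₁) 1 := by
    rw [hF₁.arr _ rfl]; simp [a4]
  have e₁ : s₁.reg .s₁ = s.reg .s₁ := by rw [hF₁.reg _ rfl]; simp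
  have e₂ : s₁.reg .s₂ = s.reg .s₂ := by rw [hF₁.reg _ rfl]; simp
  refine (runs_lookup (S := S₂) (((I₁.set .u _).put .nxt _ _).put .nxt _ _) ⟨[], w0, .inr rfl⟩
    (by simpa [hS₂] using h2) ?_).mono fun s₂ hF₂ ⟨g₂, I₂, X₂, i₂, k₂, t₂⟩ => ?_
  · intro j hj
    simp [n₁, e₁, e₂, I₁.static.z, I₁.static.one, hS₂, Function.update_apply]
  have u₂ : s₂.reg .u = s₁.reg .id := by rw [hF₂.reg _ rfl]; simp
  have c₂ : s₁.reg .cnt ≤ s₂.reg .cnt := by simpa using X₂.cnt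
  have ku : g₂.K (s₁.reg .id) = g₁.K (s₁.reg .id) := X₂.key _ i₁.1 (by simpa using i₁.2)
  have hcN := (I₂.cnt_le hfin).trans hN
  refine (runs_merge (I₂.set .v _) (by simpa using hcN.trans hB)
    (by simpa [u₂] using ⟨i₁.1, i₁.2.trans c₂⟩) (by simpa using i₂) ?_).mono
    fun s₃ hF₃ ⟨g₃, I₃, X₃, L₃, q₃, e₃, t₃⟩ => ?_
  · exact ⟨[], w0, by simp [u₂, ku, k₁, Graph.eval], by simp [k₂, Graph.eval]⟩
  · simp [u₂, ku, k₁, k₂] at L₃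
    simp at t₁ t₂ t₃
    have hlog : Nat.log 2 (s₂.reg .cnt) ≤ Nat.log 2 N := Nat.log_mono_right hcN
    refine ⟨g₃, I₃, L₃, ?_⟩
    unfold Graph.cost
    omega

theorem runs_equivalence (hs : Ready G s) (h1 : s.reg .s₁ < G.nn) (h2 : s.reg .s₂ < G.nn)
    (hfin : (G.reached {s.reg .s₁} {s.reg .s₂}).Finite) {N : ℕ}
    (hN : (G.reached {s.reg .s₁} {s.reg .s₂}).ncard ≤ N) (hB : N ≤ B) :
    Runs B inp equivalence s fun s' =>
      ((∀ w, G.Word w → (G.Acc (G.eval {s.reg .s₁} w) ↔ G.Acc (G.eval {s.reg .s₂} w))) →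
        s'.reg .res = 1) ∧
      (¬ (∀ w, G.Word w → (G.Acc (G.eval {s.reg .s₁} w) ↔ G.Acc (G.eval {s.reg .s₂} w))) →
        s'.reg .res = 0) ∧
      s'.tick ≤ s.tick + 2 + G.cost N + N * (4 + G.sg * G.cost N) := by
  simp only [equivalence, runs_seq, runs_zero]
  refine (runs_seed hs h1 h2 hfin hN hB).mono fun s₁ hF₁ ⟨g₁, I₁, L₁, t₁⟩ => ?_
  set S₁ : Set ℕ := {s.reg .s₁}
  set S₂ : Set ℕ := {s.reg .s₂}
  -- Invariant: the successors of all pairs before `qh` are merged. When `qh` reaches `ql`, this is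
  -- the hypothesis of `Queue.correct`.
  refine runs_loop (fun s' => ∃ g', Inv G S₁ S₂ g' s' ∧ Linked g'.K g'.R (s'.reg .cnt) S₁ S₂ ∧
    (∀ i < s'.reg .qh, ∀ a < G.sg, Linked g'.K g'.R (s'.reg .cnt)
      (G.step (g'.K (s'.arr .qa i)) a) (G.step (g'.K (s'.arr .qb i)) a)) ∧
    s'.reg .qh ≤ s'.reg .ql ∧
    s'.tick ≤ s₁.tick + 1 + s'.reg .qh * (4 + G.sg * G.cost N)) (fun s' => N - s'.reg .qh) ?_ ?_ ?_
  · exact ⟨g₁, I₁.set _ _, by simpa using L₁, by simp, by simp, by simp⟩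
  · rintro s' - ⟨g', k1, k2, k3, k4, k5⟩ hb
    have hb' : s'.reg .qh < s'.reg .ql := hb
    have hcN := (k1.cnt_le hfin).trans hN
    -- Queue entries and roots together number `cnt`; this bounds the number of iterations by `N`.
    have hql : s'.reg .ql ≤ s'.reg .cnt := by have := k1.queue.count; omega
    refine (runs_processPair hfin hN hB k1.tock hb').mono
      fun s'' hF ⟨g'', m1, m2, m3, m4, m5, m6, m7⟩ => ?_
    simp at m3 m4 m5 m6 m7
    refine ⟨⟨g'', m1, m2.linked _ _ k2, fun i hi a ha => ?_, by omega, ?_⟩, by omega⟩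
    · have hil : i < s'.reg .ql := by omega
      obtain ⟨⟨a1, a2⟩, ⟨b1, b2⟩, -⟩ := k1.queue.pair i hil
      rw [(m5 i hil).1, (m5 i hil).2, m2.key _ a1 a2, m2.key _ b1 b2]
      rw [m6] at hi
      rcases Nat.lt_succ_iff_lt_or_eq.1 hi with h | rfl
      · exact m2.linked _ _ (k3 i h a ha)
      · exact m3 a ha
    · rw [m6, Nat.succ_mul]
      omega
  · rintro s' - ⟨g', k1, k2, k3, k4, k5⟩ hb
    have hb' : s'.reg .qh = s'.reg .ql := by simp only [Cond.holds] at hb; omega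
    have hcN := (k1.cnt_le hfin).trans hN
    have hql : s'.reg .ql ≤ s'.reg .cnt := by have := k1.queue.count; omega
    have hcorr := k1.queue.correct k2 fun i hi => k3 i (by omega)
    have hle : s'.reg .qh * (4 + G.sg * G.cost N) ≤ N * (4 + G.sg * G.cost N) :=
      Nat.mul_le_mul_right _ (by omega)
    rw [← hcorr]
    simp only [runs_ite_eq, runs_move, runs_zero]
    simp [k1.static.z, k1.static.one]
    constructor <;> intro hbad <;> simp [hbad] <;> omega

end
end ArrayLang

namespace ArrayLang

/-! ### Graphs that contain nondeterministic automata -/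

/-- The automaton `M` is the part of `G` on the states `ι u`. -/
structure Graph.Embeds (G : Graph) {m σ : ℕ} (M : NFA (Fin σ) (Fin m)) (ι : Fin m → ℕ) :
    Prop where
  inj : Function.Injective ι
  edge : ∀ u v a, v ∈ M.step u a → ∃ e < G.en, G.src e = ι u ∧ G.dst e = ι v ∧ G.lab e = a
  of_edge : ∀ e < G.en, ∀ u, G.src e = ι u →
    ∃ v, ∃ a : Fin σ, v ∈ M.step u a ∧ G.dst e = ι v ∧ G.lab e = a
  acc : ∀ u, G.acc (ι u) ≠ 0 ↔ u ∈ M.accept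
  sg : G.sg = σ

namespace Graph.Embeds

variable {G : Graph} {m σ : ℕ} {M : NFA (Fin σ) (Fin m)} {ι : Fin m → ℕ}

/-- By `of_edge` no edge leaves the part of `M`, so the two automata inside `G` never mix. -/
theorem step_image (h : G.Embeds M ι) (S : Set (Fin m)) (a : Fin σ) :
    G.step (ι '' S) a = ι '' M.stepSet S a := by
  ext x
  constructor
  · rintro ⟨e, he, hl, ⟨u, hu, hus⟩, rfl⟩
    obtain ⟨v, b, hv, hd, hb⟩ := h.of_edge e he u hus.symm
    obtain rfl : a = b := Fin.ext (hl.symm.trans hb)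
    exact ⟨v, NFA.mem_stepSet.2 ⟨u, hu, hv⟩, hd.symm⟩
  · rintro ⟨v, hv, rfl⟩
    obtain ⟨u, hu, huv⟩ := NFA.mem_stepSet.1 hv
    obtain ⟨e, he, hs, hd, hl⟩ := h.edge u v a huv
    exact ⟨e, he, hl, ⟨u, hu, hs.symm⟩, hd⟩

theorem eval_image (h : G.Embeds M ι) (S : Set (Fin m)) (w : List (Fin σ)) :
    G.eval (ι '' S) (w.map Fin.val) = ι '' M.evalFrom S w := by
  induction w generalizing S with
  | nil => rfl
  | cons a w ih =>
    rw [NFA.evalFrom_cons, ← ih, ← h.step_image]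
    rfl

theorem acc_image (h : G.Embeds M ι) (S : Set (Fin m)) :
    G.Acc (ι '' S) ↔ ∃ u ∈ S, u ∈ M.accept := by
  constructor
  · rintro ⟨_, ⟨u, hu, rfl⟩, ha⟩
    exact ⟨u, hu, (h.acc u).1 ha⟩
  · rintro ⟨u, hu, ha⟩
    exact ⟨_, ⟨u, hu, rfl⟩, (h.acc u).2 ha⟩

theorem exists_word (h : G.Embeds M ι) {w : List ℕ} (hw : G.Word w) :
    ∃ x : List (Fin σ), w = x.map Fin.val := by
  induction w with
  | nil => exact ⟨[], rfl⟩
  | cons a w ih =>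
    obtain ⟨x, rfl⟩ := ih fun b hb => hw b (by simp [hb])
    exact ⟨⟨a, h.sg ▸ hw a (by simp)⟩ :: x, by simp⟩

theorem word_map (h : G.Embeds M ι) (x : List (Fin σ)) : G.Word (x.map Fin.val) := by
  intro b hb
  obtain ⟨a, -, rfl⟩ := List.mem_map.1 hb
  rw [h.sg]
  exact a.2

theorem acc_eval (h : G.Embeds M ι) {s : Fin m} (hs : M.start = {s}) (x : List (Fin σ)) :
    G.Acc (G.eval {ι s} (x.map Fin.val)) ↔ x ∈ M.accepts := by
  rw [← Set.image_singleton, h.eval_image, h.acc_image, ← hs]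
  exact ⟨fun ⟨u, h1, h2⟩ => ⟨u, h2, h1⟩, fun ⟨u, h1, h2⟩ => ⟨u, h2, h1⟩⟩

variable {m' : ℕ} {M' : NFA (Fin σ) (Fin m')} {ι' : Fin m' → ℕ}

theorem accepts_eq_iff (h : G.Embeds M ι) (h' : G.Embeds M' ι') {s : Fin m} {s' : Fin m'}
    (hs : M.start = {s}) (hs' : M'.start = {s'}) :
    M.accepts = M'.accepts ↔
      ∀ w, G.Word w → (G.Acc (G.eval {ι s} w) ↔ G.Acc (G.eval {ι' s'} w)) := by
  constructor
  · intro heq w hw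
    obtain ⟨x, rfl⟩ := h.exists_word hw
    rw [h.acc_eval hs, h'.acc_eval hs', heq]
  · intro hw
    ext x
    rw [← h.acc_eval hs, ← h'.acc_eval hs']
    exact hw _ (h.word_map x)

/-- The reached sets of `G` are copies of sets from the two powerset constructions, so their numbers
simply add up. -/
theorem reached_subset (h : G.Embeds M ι) (h' : G.Embeds M' ι') {s : Fin m} {s' : Fin m'}
    (hs : M.start = {s}) (hs' : M'.start = {s'}) :
    G.reached {ι s} {ι' s'} ⊆
      (fun S => ι '' S) '' Set.range M.eval ∪ (fun S => ι' '' S) '' Set.range M'.eval := by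
  rintro S ⟨w, hw, hS⟩
  obtain ⟨x, rfl⟩ := h.exists_word hw
  rcases hS with rfl | rfl
  · left
    refine ⟨_, ⟨x, rfl⟩, ?_⟩
    rw [← Set.image_singleton, h.eval_image, ← hs]
    rfl
  · right
    refine ⟨_, ⟨x, rfl⟩, ?_⟩
    rw [← Set.image_singleton, h'.eval_image, ← hs']
    rfl

theorem reached_finite (h : G.Embeds M ι) (h' : G.Embeds M' ι') {s : Fin m} {s' : Fin m'}
    (hs : M.start = {s}) (hs' : M'.start = {s'}) : (G.reached {ι s} {ι' s'}).Finite :=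
  (((Set.toFinite _).image _).union ((Set.toFinite _).image _)).subset (h.reached_subset h' hs hs')

theorem ncard_reached_le (h : G.Embeds M ι) (h' : G.Embeds M' ι') {s : Fin m} {s' : Fin m'}
    (hs : M.start = {s}) (hs' : M'.start = {s'}) :
    (G.reached {ι s} {ι' s'}).ncard ≤ (Set.range M.eval).ncard + (Set.range M'.eval).ncard :=
  (Set.ncard_le_ncard (h.reached_subset h' hs hs')
    (((Set.toFinite _).image _).union ((Set.toFinite _).image _))).trans <|
    (Set.ncard_union_le _ _).trans <| Nat.add_le_add (Set.ncard_image_le (Set.toFinite _))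
      (Set.ncard_image_le (Set.toFinite _))

end Graph.Embeds

/-! ### Reading the input -/

def readNext (d : Var) : Prog := .input d .ptr ;; .inc .ptr

def readEdge : Prog :=
  readNext .u ;; .add .u .nn .u ;; .store .src .en .u ;;
  readNext .v ;; .add .v .nn .v ;; .store .dst .en .v ;;
  readNext .l ;; .store .lab .en .l ;; .inc .en

def readFinal : Prog := readNext .u ;; .add .u .nn .u ;; .store .acc .u .one

/-- Read an automaton. The number `nn` of the states read before is added to all states. -/
def readAutomaton (s₀ : Var) : Prog :=
  readNext .m ;; readNext s₀ ;; .add s₀ .nn s₀ ;; readNext .ec ;; .for .i .ec readEdge ;;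
  readNext .fc ;; .for .i .fc readFinal ;; .add .nn .nn .m

def readInput : Prog := .inc .one ;; readNext .sg ;; readAutomaton .s₁ ;; readAutomaton .s₂

/-- From position `p` on, `inp` holds the list. -/
def HoldsAt (inp : ℕ → ℕ) : ℕ → List ℕ → Prop
  | _, [] => True
  | p, x :: l => inp p = x ∧ HoldsAt inp (p + 1) l

section
variable {B : ℕ} {inp : ℕ → ℕ} {s : St} {m σ : ℕ}

theorem holdsAt_append {p : ℕ} {l l' : List ℕ} :
    HoldsAt inp p (l ++ l') ↔ HoldsAt inp p l ∧ HoldsAt inp (p + l.length) l' := by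
  induction l generalizing p with
  | nil => simp [HoldsAt]
  | cons x l ih =>
    simp only [List.cons_append, HoldsAt, ih, List.length_cons, and_assoc]
    rw [show p + 1 + l.length = p + (l.length + 1) by omega]

/-- The prefix `l'` is there for the induction; the application takes it empty. -/
theorem holdsAt_getD (l l' : List ℕ) :
    HoldsAt (fun i => (l' ++ l).getD i 0) l'.length l := by
  induction l generalizing l' with
  | nil => trivial
  | cons x l ih =>
    refine ⟨by simp, ?_⟩
    have := ih (l' ++ [x])
    simpa using this

theorem HoldsAt.edge {es : List (Fin m × Fin m × Fin σ)} {p : ℕ}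
    (h : HoldsAt inp p (es.flatMap fun e => [(e.1 : ℕ), (e.2.1 : ℕ), (e.2.2 : ℕ)])) {k : ℕ}
    (hk : k < es.length) :
    inp (p + 3 * k) = es[k].1 ∧ inp (p + 3 * k + 1) = es[k].2.1 ∧
      inp (p + 3 * k + 2) = es[k].2.2 := by
  induction es generalizing p k with
  | nil => simp at hk
  | cons e es ih =>
    simp only [List.flatMap_cons, List.cons_append, List.nil_append, HoldsAt] at h
    cases k with
    | zero => exact ⟨h.1, h.2.1, h.2.2.1⟩
    | succ k =>
      have := ih h.2.2.2 (k := k) (by simpa using hk)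
      rw [show p + 1 + 1 + 1 + 3 * k = p + 3 * (k + 1) by omega] at this
      exact this

theorem HoldsAt.final {fs : List (Fin m)} {p : ℕ}
    (h : HoldsAt inp p (fs.map Fin.val)) {k : ℕ} (hk : k < fs.length) :
    inp (p + k) = fs[k] := by
  induction fs generalizing p k with
  | nil => simp at hk
  | cons e es ih =>
    simp only [List.map_cons, HoldsAt] at h
    cases k with
    | zero => exact h.1
    | succ k =>
      have := ih h.2 (k := k) (by simpa using hk)
      rwa [show p + 1 + k = p + (k + 1) by omega] at this

theorem runs_readEdges {es : List (Fin m × Fin m × Fin σ)}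
    (h : HoldsAt inp (s.reg .ptr) (es.flatMap fun e => [(e.1 : ℕ), (e.2.1 : ℕ), (e.2.2 : ℕ)]))
    (hB : s.reg .nn + m ≤ B) (hec : s.reg .ec = es.length) :
    Runs B inp (.for .i .ec readEdge) s fun s' =>
      s'.reg .ptr = s.reg .ptr + 3 * es.length ∧ s'.reg .en = s.reg .en + es.length ∧
      (∀ e < s.reg .en, s'.arr .src e = s.arr .src e ∧ s'.arr .dst e = s.arr .dst e ∧
        s'.arr .lab e = s.arr .lab e) ∧
      (∀ k (hk : k < es.length), s'.arr .src (s.reg .en + k) = s.reg .nn + es[k].1 ∧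
        s'.arr .dst (s.reg .en + k) = s.reg .nn + es[k].2.1 ∧
        s'.arr .lab (s.reg .en + k) = es[k].2.2) ∧
      s'.tick ≤ s.tick + 2 + 14 * es.length := by
  refine runs_for (fun n s' => n ≤ es.length →
      s'.reg .ptr = s.reg .ptr + 3 * n ∧ s'.reg .en = s.reg .en + n ∧
      (∀ e < s.reg .en, s'.arr .src e = s.arr .src e ∧ s'.arr .dst e = s.arr .dst e ∧
        s'.arr .lab e = s.arr .lab e) ∧
      (∀ k (hk : k < es.length), k < n → s'.arr .src (s.reg .en + k) = s.reg .nn + es[k].1 ∧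
        s'.arr .dst (s.reg .en + k) = s.reg .nn + es[k].2.1 ∧
        s'.arr .lab (s.reg .en + k) = es[k].2.2) ∧
      s'.tick ≤ s.tick + 1 + 14 * n) es.length hec rfl rfl (by decide) ?_ ?_ ?_
  · simp
  · rintro k s' hk - - hF h'
    obtain ⟨h1, h2, h3, h4, h5⟩ := h' hk.le
    have hnn : s'.reg .nn = s.reg .nn := hF.reg _ rfl
    obtain ⟨i1, i2, i3⟩ := h.edge hk
    have l1 := es[k].1.2
    have l2 := es[k].2.1.2
    simp only [readEdge, readNext, runs_seq, runs_input, runs_inc, runs_add, runs_store]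
    simp only [add_assoc] at i2 i3
    simp only [St.put_reg, St.set_reg, St.put_arr, St.set_arr, reduceCtorEq, if_false, if_true,
      St.tock_reg, St.tock_arr, St.set_tick, St.put_tick, St.tock_tick, h1, h2, hnn, i1, i2, i3,
      add_assoc, Nat.reduceAdd]
    refine ⟨by omega, by omega, fun _ => ⟨by omega, trivial, fun e he => ?_, fun j hj hjk => ?_,
      by omega⟩⟩
    · simp only [Function.update_of_ne (show e ≠ s.reg .en + k by omega)]
      exact h3 e he
    · rcases Nat.lt_succ_iff_lt_or_eq.1 hjk with hlt | rfl
      · simp only [Function.update_of_ne (show s.reg .en + j ≠ s.reg .en + k by omega)]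
        exact h4 j hj hlt
      · simp
  · rintro s' - h'
    obtain ⟨h1, h2, h3, h4, h5⟩ := h' le_rfl
    exact ⟨h1, h2, h3, fun k hk => h4 k hk hk, by simp; omega⟩

theorem runs_readFinals {fs : List (Fin m)}
    (h : HoldsAt inp (s.reg .ptr) (fs.map Fin.val))
    (hB : s.reg .nn + m ≤ B) (hfc : s.reg .fc = fs.length) (hone : s.reg .one = 1) :
    Runs B inp (.for .i .fc readFinal) s fun s' =>
      s'.reg .ptr = s.reg .ptr + fs.length ∧
      (∀ j, s'.arr .acc j ≠ 0 ↔ s.arr .acc j ≠ 0 ∨ ∃ f ∈ fs, j = s.reg .nn + f) ∧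
      s'.tick ≤ s.tick + 2 + 6 * fs.length := by
  refine runs_for (fun n s' => n ≤ fs.length →
      s'.reg .ptr = s.reg .ptr + n ∧
      (∀ j, s'.arr .acc j ≠ 0 ↔ s.arr .acc j ≠ 0 ∨
        ∃ k, ∃ (hk : k < fs.length), k < n ∧ j = s.reg .nn + fs[k]) ∧
      s'.tick ≤ s.tick + 1 + 6 * n) fs.length hfc rfl rfl (by decide) ?_ ?_ ?_
  · simp
  · rintro k s' hk - - hF h'
    obtain ⟨h1, h2, h3⟩ := h' hk.le
    have hnn : s'.reg .nn = s.reg .nn := hF.reg _ rfl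
    have ho : s'.reg .one = 1 := (hF.reg _ rfl).trans hone
    have i1 := h.final hk
    have l1 := fs[k].2
    simp only [readFinal, readNext, runs_seq, runs_input, runs_inc, runs_add, runs_store]
    simp only [St.put_reg, St.set_reg, St.put_arr, St.set_arr, reduceCtorEq, if_false, if_true,
      St.tock_reg, St.tock_arr, St.set_tick, St.put_tick, St.tock_tick, h1, hnn, i1, ho]
    refine ⟨by omega, fun _ => ⟨by omega, fun j => ?_, by omega⟩⟩
    by_cases hj : j = s.reg .nn + fs[k]
    · rw [hj, Function.update_self]
      simp only [ne_eq, one_ne_zero, not_false_eq_true, true_iff]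
      exact .inr ⟨k, hk, by omega, rfl⟩
    · rw [Function.update_of_ne hj, h2]
      refine or_congr_right ⟨fun ⟨i, hi, hik, e⟩ => ⟨i, hi, by omega, e⟩, ?_⟩
      rintro ⟨i, hi, hik, e⟩
      refine ⟨i, hi, ?_, e⟩
      rcases Nat.lt_succ_iff_lt_or_eq.1 hik with hlt | rfl
      · exact hlt
      · exact absurd e hj
  · rintro s' - h'
    obtain ⟨h1, h2, h3⟩ := h' le_rfl
    refine ⟨h1, fun j => (h2 j).trans (or_congr_right ⟨?_, ?_⟩), by simp; omega⟩
    · rintro ⟨k, hk, -, e⟩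
      exact ⟨fs[k], List.getElem_mem hk, e⟩
    · rintro ⟨f, hf, e⟩
      obtain ⟨k, hk, rfl⟩ := List.getElem_of_mem hf
      exact ⟨k, hk, hk, e⟩

theorem encodeData_eq (q : Fin m) (es : List (Fin m × Fin m × Fin σ)) (fs : List (Fin m)) :
    Colex.encodeData q es fs =
      [m, (q : ℕ), es.length] ++ (es.flatMap fun e => [(e.1 : ℕ), (e.2.1 : ℕ), (e.2.2 : ℕ)]) ++
        fs.length :: fs.map Fin.val := by
  simp [Colex.encodeData, List.map_eq_flatMap]

theorem length_encodeData (q : Fin m) (es : List (Fin m × Fin m × Fin σ)) (fs : List (Fin m)) :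
    (Colex.encodeData q es fs).length = 4 + 3 * es.length + fs.length := by
  simp [encodeData_eq]
  omega

theorem runs_readAutomaton {d : Var} (hd : d = .s₁ ∨ d = .s₂) {q : Fin m}
    {es : List (Fin m × Fin m × Fin σ)} {fs : List (Fin m)}
    (h : HoldsAt inp (s.reg .ptr) (Colex.encodeData q es fs))
    (hB : s.reg .nn + m ≤ B) (hone : s.reg .one = 1) :
    Runs B inp (readAutomaton d) s fun s' =>
      s'.reg .ptr = s.reg .ptr + (Colex.encodeData q es fs).length ∧
      s'.reg .nn = s.reg .nn + m ∧ s'.reg d = s.reg .nn + q ∧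
      s'.reg .en = s.reg .en + es.length ∧
      (∀ e < s.reg .en, s'.arr .src e = s.arr .src e ∧ s'.arr .dst e = s.arr .dst e ∧
        s'.arr .lab e = s.arr .lab e) ∧
      (∀ k (hk : k < es.length), s'.arr .src (s.reg .en + k) = s.reg .nn + es[k].1 ∧
        s'.arr .dst (s.reg .en + k) = s.reg .nn + es[k].2.1 ∧
        s'.arr .lab (s.reg .en + k) = es[k].2.2) ∧
      (∀ j, s'.arr .acc j ≠ 0 ↔ s.arr .acc j ≠ 0 ∨ ∃ f ∈ fs, j = s.reg .nn + f) ∧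
      s'.tick ≤ s.tick + 20 + 14 * es.length + 6 * fs.length := by
  have hlen : (es.flatMap fun e => [(e.1 : ℕ), (e.2.1 : ℕ), (e.2.2 : ℕ)]).length =
      3 * es.length := by simp [mul_comm]
  rw [length_encodeData]
  simp only [encodeData_eq, holdsAt_append, HoldsAt, hlen, List.length_append,
    List.length_cons, List.length_nil] at h
  obtain ⟨⟨⟨i1, i2, i3, -⟩, hes⟩, i4, hfs⟩ := h
  have hq := q.2
  have d1 : d ≠ .ptr := by rcases hd with rfl | rfl <;> decide
  have d2 : d ≠ .nn := by rcases hd with rfl | rfl <;> decide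
  have d3 : d ≠ .m := by rcases hd with rfl | rfl <;> decide
  have d4 : d ≠ .ec := by rcases hd with rfl | rfl <;> decide
  have d5 : d ≠ .en := by rcases hd with rfl | rfl <;> decide
  have d6 : d ≠ .one := by rcases hd with rfl | rfl <;> decide
  have d7 : d ≠ .fc := by rcases hd with rfl | rfl <;> decide
  simp only [readAutomaton, readNext, runs_seq, runs_input, runs_inc, runs_add]
  simp only [St.set_reg, reduceCtorEq, if_false, if_true, d1, d1.symm, d2.symm, i1, i2, i3]
  refine ⟨by omega, (runs_readEdges (m := m) (es := es) ?_ ?_ ?_).mono ?_⟩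
  · simpa [d1.symm, add_assoc] using hes
  · simpa [d2.symm] using hB
  · simp
  rintro s₁ hF₁ ⟨h1, h2, h3, h4, h5⟩
  simp [d2.symm, d5.symm] at h1 h2 h3 h4 h5
  have n₁ : s₁.reg .nn = s.reg .nn := by rw [hF₁.reg _ rfl]; simp [d2.symm]
  have o₁ : s₁.reg .one = 1 := by rw [hF₁.reg _ rfl]; simp [d6.symm, hone]
  have m₁ : s₁.reg .m = m := by rw [hF₁.reg _ rfl]; simp [d3.symm]
  have dd₁ : s₁.reg d = s.reg .nn + q := by
    rw [hF₁.reg _ (by rcases hd with rfl | rfl <;> rfl)]; simp [d1, d4]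
  have a₁ : s₁.arr .acc = s.arr .acc := by rw [hF₁.arr _ rfl]; simp
  have i4' : inp (s₁.reg .ptr) = fs.length := by
    rw [← i4, h1]; congr 1; omega
  refine (runs_readFinals (m := m) (fs := fs) ?_ ?_ ?_ ?_).mono ?_
  · simp only [St.set_reg, reduceCtorEq, if_false, if_true]
    convert hfs using 1
    omega
  · simpa [n₁] using hB
  · simpa using i4'
  · simpa using o₁
  rintro s₂ hF₂ ⟨k1, k2, k3⟩
  simp [n₁, a₁] at k1 k2 k3
  have n₂ : s₂.reg .nn = s.reg .nn := by rw [hF₂.reg _ rfl]; simp [n₁]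
  have m₂ : s₂.reg .m = m := by rw [hF₂.reg _ rfl]; simp [m₁]
  have e₂ : s₂.reg .en = s₁.reg .en := by rw [hF₂.reg _ rfl]; simp
  have dd₂ : s₂.reg d = s.reg .nn + q := by
    rw [hF₂.reg _ (by rcases hd with rfl | rfl <;> rfl)]; simp [d1, d7, dd₁]
  have src₂ : s₂.arr .src = s₁.arr .src := by rw [hF₂.arr _ rfl]; simp
  have dst₂ : s₂.arr .dst = s₁.arr .dst := by rw [hF₂.arr _ rfl]; simp
  have lab₂ : s₂.arr .lab = s₁.arr .lab := by rw [hF₂.arr _ rfl]; simp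
  simp [n₂, m₂, e₂, dd₂, src₂, dst₂, lab₂, d2]
  refine ⟨hB, by omega, h2, h3, h4, k2, by omega⟩

end
end ArrayLang

namespace ArrayLang

/-! ### The whole program -/

/-- The start state of the high-level machine. -/
def St.start : St := ⟨fun _ => 0, fun _ _ => 0, 0⟩

section
variable {B : ℕ} {inp : ℕ → ℕ} {m₁ m₂ σ : ℕ} {M₁ : NFA (Fin σ) (Fin m₁)} {M₂ : NFA (Fin σ) (Fin m₂)}

theorem runs_readInput {q₁ : Fin m₁} {es₁ : List (Fin m₁ × Fin m₁ × Fin σ)} {fs₁ : List (Fin m₁)}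
    {q₂ : Fin m₂} {es₂ : List (Fin m₂ × Fin m₂ × Fin σ)} {fs₂ : List (Fin m₂)}
    (he₁ : ∀ u v a, (u, v, a) ∈ es₁ ↔ v ∈ M₁.step u a) (hf₁ : ∀ f, f ∈ fs₁ ↔ f ∈ M₁.accept)
    (he₂ : ∀ u v a, (u, v, a) ∈ es₂ ↔ v ∈ M₂.step u a) (hf₂ : ∀ f, f ∈ fs₂ ↔ f ∈ M₂.accept)
    (h : HoldsAt inp 0 (σ :: (Colex.encodeData q₁ es₁ fs₁ ++ Colex.encodeData q₂ es₂ fs₂)))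
    (hB : m₁ + m₂ ≤ B) :
    Runs B inp readInput St.start fun s' => ∃ G : Graph, Ready G s' ∧ G.Embeds M₁ Fin.val ∧
      G.Embeds M₂ (fun u => m₁ + u.val) ∧ s'.reg .s₁ = q₁ ∧ s'.reg .s₂ = m₁ + q₂ ∧
      G.nn = m₁ + m₂ ∧ G.en = es₁.length + es₂.length ∧
      s'.tick ≤ 50 + 14 * (es₁.length + es₂.length) + 6 * (fs₁.length + fs₂.length) := by
  simp only [HoldsAt, holdsAt_append] at h
  obtain ⟨i1, h1, h2⟩ := h
  refine Runs.mono (Q := fun s' => s'.reg .sg = σ ∧ s'.reg .one = 1 ∧ s'.reg .s₁ = q₁ ∧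
    s'.reg .s₂ = m₁ + q₂ ∧ s'.reg .nn = m₁ + m₂ ∧ s'.reg .en = es₁.length + es₂.length ∧
    (∀ k (hk : k < es₁.length), s'.arr .src k = es₁[k].1 ∧ s'.arr .dst k = es₁[k].2.1 ∧
      s'.arr .lab k = es₁[k].2.2) ∧
    (∀ k (hk : k < es₂.length), s'.arr .src (es₁.length + k) = m₁ + es₂[k].1 ∧
      s'.arr .dst (es₁.length + k) = m₁ + es₂[k].2.1 ∧
      s'.arr .lab (es₁.length + k) = es₂[k].2.2) ∧
    (∀ j, s'.arr .acc j ≠ 0 ↔ (∃ f ∈ fs₁, j = f) ∨ ∃ f ∈ fs₂, j = m₁ + f) ∧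
    s'.tick ≤ 50 + 14 * (es₁.length + es₂.length) + 6 * (fs₁.length + fs₂.length)) ?_ ?_
  · simp only [readInput, readNext, runs_seq, runs_inc, runs_input]
    refine (runs_readAutomaton (d := .s₁) (.inl rfl) (q := q₁) (es := es₁) (fs := fs₁) ?_ ?_ ?_).mono
      ?_
    · simpa [St.start] using h1
    · simp [St.start]; omega
    · simp [St.start]
    rintro s₁ hF₁ ⟨a1, a2, a3, a4, -, a5, a6, a7⟩
    simp [St.start] at a1 a2 a3 a4 a5 a6 a7
    have o₁ : s₁.reg .one = 1 := by rw [hF₁.reg _ rfl]; simp [St.start]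
    have g₁ : s₁.reg .sg = σ := by rw [hF₁.reg _ rfl]; simpa [St.start] using i1
    refine (runs_readAutomaton (d := .s₂) (.inr rfl) (q := q₂) (es := es₂) (fs := fs₂) ?_ ?_ o₁).mono
      ?_
    · simpa [a1] using h2
    · simpa [a2] using hB
    rintro s₂ hF₂ ⟨b1, b2, b3, b4, b5, b6, b7, b8⟩
    refine ⟨(hF₂.reg _ rfl).trans g₁, (hF₂.reg _ rfl).trans o₁, (hF₂.reg _ rfl).trans a3,
      by rw [b3, a2], by rw [b2, a2], by rw [b4, a4], fun k hk => ?_, fun k hk => ?_, fun j => ?_,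
      by omega⟩
    · obtain ⟨c1, c2, c3⟩ := b5 k (by omega)
      obtain ⟨d1, d2, d3⟩ := a5 k hk
      exact ⟨c1.trans d1, c2.trans d2, c3.trans d3⟩
    · have := b6 k hk
      rwa [a4, a2] at this
    · rw [b7, a2]
      refine or_congr_left ?_
      simpa using a6 j
  · rintro s' hF ⟨r1, r2, r3, r4, r5, r6, k1, k2, k3, k4⟩
    -- Each edge index belongs to exactly one of the two consecutive blocks in the arrays.
    have key : ∀ e < es₁.length + es₂.length, (∃ k, ∃ hk : k < es₁.length, e = k) ∨
        ∃ k, ∃ hk : k < es₂.length, e = es₁.length + k := by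
      intro e he
      by_cases h : e < es₁.length
      · exact .inl ⟨e, h, rfl⟩
      · exact .inr ⟨e - es₁.length, by omega, by omega⟩
    let G : Graph :=
      { nn := m₁ + m₂
        en := es₁.length + es₂.length
        sg := σ
        src := s'.arr .src
        dst := s'.arr .dst
        lab := s'.arr .lab
        acc := s'.arr .acc
        dst_lt := by
          intro e he
          rcases key e he with ⟨k, hk, rfl⟩ | ⟨k, hk, rfl⟩
          · rw [(k1 e hk).2.1]; omega
          · rw [(k2 k hk).2.1]; omega
        src_lt := by
          intro e he
          rcases key e he with ⟨k, hk, rfl⟩ | ⟨k, hk, rfl⟩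
          · rw [(k1 e hk).1]; omega
          · rw [(k2 k hk).1]; omega }
    refine ⟨G, ⟨⟨hF.reg _ rfl, r2, r5, r6, r1, rfl, rfl, rfl, rfl⟩, ?_, ?_⟩, ?_, ?_, r3, r4, rfl, rfl, k4⟩
    · intro v hv
      simp only [List.mem_cons, List.not_mem_nil, or_false] at hv
      rcases hv with rfl | rfl | rfl | rfl | rfl <;> exact hF.reg _ rfl
    · intro v hv
      simp only [List.mem_cons, List.not_mem_nil, or_false] at hv
      rcases hv with rfl | rfl | rfl | rfl <;> exact hF.arr _ rfl
    · refine ⟨Fin.val_injective, fun u v a hv => ?_, fun e he u hu => ?_, fun u => ?_, rfl⟩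
      · obtain ⟨k, hk, hek⟩ := List.getElem_of_mem ((he₁ u v a).2 hv)
        obtain ⟨d1, d2, d3⟩ := k1 k hk
        rw [hek] at d1 d2 d3
        exact ⟨k, show k < es₁.length + es₂.length by omega, d1, d2, d3⟩
      · change s'.arr .src e = _ at hu
        rcases key e he with ⟨k, hk, rfl⟩ | ⟨k, hk, rfl⟩
        · obtain ⟨d1, d2, d3⟩ := k1 e hk
          obtain rfl : es₁[e].1 = u := Fin.ext (d1.symm.trans hu)
          exact ⟨es₁[e].2.1, es₁[e].2.2, (he₁ _ _ _).1 (List.getElem_mem hk), d2, d3⟩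
        -- Sources in the second block are at least `m₁`, so such an edge cannot leave a state of
        -- the first automaton.
        · rw [(k2 k hk).1] at hu
          omega
      · change s'.arr .acc u ≠ 0 ↔ _
        rw [k3, ← hf₁]
        constructor
        · rintro (⟨f, hf, e⟩ | ⟨f, hf, e⟩)
          · rwa [Fin.ext e]
          · omega
        · exact fun hu => .inl ⟨u, hu, rfl⟩
    · refine ⟨fun u v h => Fin.ext (by simpa using h), fun u v a hv => ?_, fun e he u hu => ?_,
        fun u => ?_, rfl⟩
      · obtain ⟨k, hk, hek⟩ := List.getElem_of_mem ((he₂ u v a).2 hv)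
        obtain ⟨d1, d2, d3⟩ := k2 k hk
        rw [hek] at d1 d2 d3
        exact ⟨es₁.length + k, show _ < es₁.length + es₂.length by omega, d1, d2, d3⟩
      · change s'.arr .src e = _ at hu
        rcases key e he with ⟨k, hk, rfl⟩ | ⟨k, hk, rfl⟩
        · rw [(k1 e hk).1] at hu
          omega
        · obtain ⟨d1, d2, d3⟩ := k2 k hk
          obtain rfl : es₂[k].1 = u := Fin.ext (by omega)
          exact ⟨es₂[k].2.1, es₂[k].2.2, (he₂ _ _ _).1 (List.getElem_mem hk), d2, d3⟩
      · change s'.arr .acc (m₁ + u) ≠ 0 ↔ _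
        rw [k3, ← hf₂]
        constructor
        · rintro (⟨f, hf, e⟩ | ⟨f, hf, e⟩)
          · omega
          · rwa [show u = f from Fin.ext (by omega)]
        · exact fun hu => .inr ⟨u, hu, rfl⟩

/-- Decide whether the two automata in the input are equivalent. -/
def nfaEquivalence : Prog := readInput ;; equivalence

/-- A bound on the number of steps for automata with `m` states, `e` edges and `f` final states in
total, if they reach at most `N` sets of states. -/
def timeBound (m e f σ N : ℕ) : ℕ :=
  52 + 14 * e + 6 * f + (100 + 80 * (m + e) + 6 * Nat.log 2 N) +
    N * (4 + σ * (100 + 80 * (m + e) + 6 * Nat.log 2 N))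

theorem runs_nfaEquivalence {q₁ : Fin m₁} {es₁ : List (Fin m₁ × Fin m₁ × Fin σ)}
    {fs₁ : List (Fin m₁)} {q₂ : Fin m₂} {es₂ : List (Fin m₂ × Fin m₂ × Fin σ)} {fs₂ : List (Fin m₂)}
    (hq₁ : M₁.start = {q₁}) (hq₂ : M₂.start = {q₂})
    (he₁ : ∀ u v a, (u, v, a) ∈ es₁ ↔ v ∈ M₁.step u a) (hf₁ : ∀ f, f ∈ fs₁ ↔ f ∈ M₁.accept)
    (he₂ : ∀ u v a, (u, v, a) ∈ es₂ ↔ v ∈ M₂.step u a) (hf₂ : ∀ f, f ∈ fs₂ ↔ f ∈ M₂.accept)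
    (h : HoldsAt inp 0 (σ :: (Colex.encodeData q₁ es₁ fs₁ ++ Colex.encodeData q₂ es₂ fs₂)))
    (hB : m₁ + m₂ ≤ B) {N : ℕ}
    (hN : (Set.range M₁.eval).ncard + (Set.range M₂.eval).ncard ≤ N) (hNB : N ≤ B) :
    Runs B inp nfaEquivalence St.start fun s' =>
      (M₁.accepts = M₂.accepts → s'.reg .res = 1) ∧ (M₁.accepts ≠ M₂.accepts → s'.reg .res = 0) ∧
      s'.tick ≤ timeBound (m₁ + m₂) (es₁.length + es₂.length) (fs₁.length + fs₂.length) σ N := by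
  rw [nfaEquivalence, runs_seq]
  refine (runs_readInput he₁ hf₁ he₂ hf₂ h hB).mono ?_
  rintro s - ⟨G, hG, e₁, e₂, h1, h2, hnn, hen, ht⟩
  have hfin := e₁.reached_finite e₂ hq₁ hq₂
  have hcard := (e₁.ncard_reached_le e₂ hq₁ hq₂).trans hN
  rw [← h1, ← h2] at hfin hcard
  refine (runs_equivalence hG (by rw [h1, hnn]; omega) (by rw [h2, hnn]; omega) hfin hcard hNB).mono ?_
  rintro s' - ⟨k1, k2, k3⟩
  have hiff := e₁.accepts_eq_iff e₂ hq₁ hq₂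
  rw [← h1, ← h2] at hiff
  refine ⟨fun heq => k1 (hiff.1 heq), fun hne => k2 (mt hiff.2 hne), k3.trans ?_⟩
  rw [Graph.cost, hnn, hen, e₁.sg, timeBound]
  omega

/-- A program that decides `P` on the high-level machine also does so on the word RAM. -/
theorem decidesWithin_of_runs {c : Prog} {input : List ℕ} {P : Prop} {T w : ℕ}
    (h : Runs B (fun i => input.getD i 0) c St.start fun s' =>
      (P → s'.reg .res = 1) ∧ (¬ P → s'.reg .res = 0) ∧ s'.tick ≤ T)
    (hlen : input.length ≤ B) (hinp : ∀ x ∈ input, x ≤ B) (hw : 17 * (B + T + 2) ≤ 2 ^ w) :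
    c.compile.DecidesWithin w input P (7 * T) := by
  obtain ⟨s', hs, h1, h2, h3⟩ := h
  have hinp' : ∀ i, input.getD i 0 ≤ B := by
    intro i
    rw [List.getD_eq_getElem?_getD]
    by_cases hi : i < input.length
    · rw [List.getElem?_eq_getElem hi]
      exact hinp _ (List.getElem_mem hi)
    · rw [List.getElem?_eq_none (by omega)]
      exact Nat.zero_le _
  have hmem : ∀ i, (WordRAM.State.init w input).mem i = input.getD i 0 := fun i =>
    Nat.mod_eq_of_lt (by have := hinp' i; omega)
  obtain ⟨-, s, t, he, hsim, ht⟩ := hs.compile (w := w) (T := T) (s := WordRAM.State.init w input) hinp' h3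
    hw ⟨fun _ => Nat.zero_le _, fun _ _ => Nat.zero_le _⟩
    -- The array cells lie beyond the end of the input and are therefore zero at the start.
    ⟨fun _ => rfl, fun k i hi => by
      rw [hmem, List.getD_eq_default]
      · rfl
      · have := k.idx_lt
        unfold addr
        omega, fun i _ => hmem i⟩
  have hres : s.reg 0 = s'.reg .res := hsim.reg .res
  refine ⟨s, t, he, ?_, fun hP => hres.trans (h1 hP), fun hP => hres.trans (h2 hP)⟩
  have : St.start.tick = 0 := rfl
  omega

end

end ArrayLang

namespace Colex

/-! ### The number of sets of states that a sortable automaton reaches -/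

section
variable {α Q : Type*} {M : NFA α Q}

theorem inLabel_start (hM : IsAutomaton M) {u : Q} (hu : u ∈ M.start) : inLabel M u = ⊥ := by
  rw [inLabel, dif_neg]
  rintro ⟨a, v, h⟩
  exact hM.start_no_edge u hu v a h

theorem mem_eval_reverse_cons {a : α} {r : List α} {v : Q} :
    v ∈ M.eval (a :: r).reverse ↔ ∃ u ∈ M.eval r.reverse, v ∈ M.step u a := by
  rw [List.reverse_cons, NFA.eval_append_singleton, NFA.mem_stepSet]

variable [LinearOrder α] {le : Q → Q → Prop}

/-- If `r₁` is smaller than `r₂`, no state reached by (the reverse of) `r₂` is smaller than a state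
reached by `r₁`, unless both are reached by both words. -/
theorem not_lt_of_lex (hM : IsAutomaton M) (hle : IsColexOrder M le) {r₁ r₂ : List α}
    (h : List.Lex (· < ·) r₁ r₂) {u v : Q} (hu : u ∈ M.eval r₁.reverse) (hv : v ∈ M.eval r₂.reverse)
    (huv : ¬ (u ∈ M.eval r₂.reverse ∧ v ∈ M.eval r₁.reverse)) : ¬ (le v u ∧ v ≠ u) := by
  induction h generalizing u v with
  | nil =>
    rintro ⟨h1, h2⟩
    obtain ⟨v', -, hv'⟩ := mem_eval_reverse_cons.1 hv
    have := hle.axiom_one u v (by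
      rw [inLabel_start hM hu, inLabel_eq hM hv']
      exact WithBot.bot_lt_coe _)
    exact h2 (hle.antisymm _ _ h1 this.1)
  -- With a common last letter, `axiom_two` carries the inequality to predecessors. If these were
  -- both reached by both shorter words, then `u` and `v` would be reached by both words, which
  -- `huv` excludes; the same argument shows that the predecessors differ.
  | cons _ ih =>
    rintro ⟨h1, h2⟩
    obtain ⟨u', hu', huu⟩ := mem_eval_reverse_cons.1 hu
    obtain ⟨v', hv', hvv⟩ := mem_eval_reverse_cons.1 hv
    have h3 := hle.axiom_two v' v u' u _ _ hvv huu
      ((inLabel_eq hM hvv).trans (inLabel_eq hM huu).symm) ⟨h1, h2⟩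
    have h4 : ¬ (u' ∈ M.eval _ ∧ v' ∈ M.eval _) := fun ⟨h5, h6⟩ =>
      huv ⟨mem_eval_reverse_cons.2 ⟨u', h5, huu⟩, mem_eval_reverse_cons.2 ⟨v', h6, hvv⟩⟩
    refine ih hu' hv' h4 ⟨h3, ?_⟩
    rintro rfl
    exact h4 ⟨hv', hu'⟩
  | rel hab =>
    rintro ⟨h1, h2⟩
    obtain ⟨u', -, huu⟩ := mem_eval_reverse_cons.1 hu
    obtain ⟨v', -, hvv⟩ := mem_eval_reverse_cons.1 hv
    have := hle.axiom_one u v (by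
      rw [inLabel_eq hM huu, inLabel_eq hM hvv]
      exact WithBot.coe_lt_coe.2 hab)
    exact h2 (hle.antisymm _ _ h1 this.1)

theorem lex_or_eq_or_lex (r₁ r₂ : List α) :
    List.Lex (· < ·) r₁ r₂ ∨ r₁ = r₂ ∨ List.Lex (· < ·) r₂ r₁ :=
  lt_trichotomy r₁ r₂

variable {p : ℕ} {chain : Q → Fin p}

/-- The states below a state of `S` in the same chain. -/
def lowerPart (le : Q → Q → Prop) (chain : Q → Fin p) (S : Set Q) : Set Q :=
  {x | ∃ y ∈ S, chain x = chain y ∧ le x y}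

/-- The states above a state of `S` in the same chain. -/
def upperPart (le : Q → Q → Prop) (chain : Q → Fin p) (S : Set Q) : Set Q :=
  {x | ∃ y ∈ S, chain x = chain y ∧ le y x}

/-- Since both sets meet the same chains, each state of one has a partner in the same chain in the
other. The partners are comparable, and `not_lt_of_lex` fixes the direction; states common to both
sets need no partner. -/
theorem parts_mono (hM : IsAutomaton M) (hle : IsColexOrder M le)
    (hchain : ∀ i, IsChain le {u | chain u = i}) {r₁ r₂ : List α} (h : List.Lex (· < ·) r₁ r₂)
    (hK : chain '' M.eval r₁.reverse = chain '' M.eval r₂.reverse) :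
    lowerPart le chain (M.eval r₁.reverse) ⊆ lowerPart le chain (M.eval r₂.reverse) ∧
      upperPart le chain (M.eval r₂.reverse) ⊆ upperPart le chain (M.eval r₁.reverse) := by
  have key : ∀ u ∈ M.eval r₁.reverse, ∀ v ∈ M.eval r₂.reverse, chain u = chain v →
      (u ∉ M.eval r₂.reverse ∨ v ∉ M.eval r₁.reverse) → le u v := by
    intro u hu v hv huv hn
    have h1 := not_lt_of_lex hM hle h hu hv (by tauto)
    by_cases huv' : u = v
    · subst huv'; exact hle.refl u
    · rcases hchain (chain v) huv rfl huv' with h2 | h2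
      · exact h2
      · exact absurd ⟨h2, Ne.symm huv'⟩ h1
  constructor
  · rintro x ⟨y, hy, hc, hxy⟩
    by_cases hy2 : y ∈ M.eval r₂.reverse
    · exact ⟨y, hy2, hc, hxy⟩
    · obtain ⟨v, hv, hcv⟩ : chain y ∈ chain '' M.eval r₂.reverse := hK ▸ ⟨y, hy, rfl⟩
      exact ⟨v, hv, hc.trans hcv.symm, hle.trans _ _ _ hxy (key y hy v hv hcv.symm (.inl hy2))⟩
  · rintro x ⟨v, hv, hc, hvx⟩
    by_cases hv1 : v ∈ M.eval r₁.reverse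
    · exact ⟨v, hv1, hc, hvx⟩
    · obtain ⟨y, hy, hcy⟩ : chain v ∈ chain '' M.eval r₁.reverse := hK ▸ ⟨v, hv, rfl⟩
      exact ⟨y, hy, hc.trans hcy.symm, hle.trans _ _ _ (key y hy v hv hcy (.inr hv1)) hvx⟩

/-- Convexity of reached sets: a state `z` between two states of the set is reached by some word. If
it is not in the set, that word is smaller or larger than the given one, and `not_lt_of_lex`
contradicts one of the two inequalities. -/
theorem lowerPart_inter_upperPart (hM : IsAutomaton M) (hle : IsColexOrder M le) (r : List α) :
    lowerPart le chain (M.eval r.reverse) ∩ upperPart le chain (M.eval r.reverse) =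
      M.eval r.reverse := by
  ext z
  constructor
  · rintro ⟨⟨y, hy, -, hzy⟩, x, hx, -, hxz⟩
    by_contra hz
    obtain ⟨w, hw⟩ := hM.reachable z
    obtain ⟨r', rfl⟩ : ∃ r', w = r'.reverse := ⟨w.reverse, by simp⟩
    rcases lex_or_eq_or_lex r r' with h | rfl | h
    · exact not_lt_of_lex hM hle h hy hw (fun hh => hz hh.2) ⟨hzy, by rintro rfl; exact hz hy⟩
    · exact hz hw
    · exact not_lt_of_lex hM hle h hw hx (fun hh => hz hh.1) ⟨hxz, by rintro rfl; exact hz hx⟩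
  · exact fun hz => ⟨⟨z, hz, rfl, hle.refl z⟩, z, hz, rfl, hle.refl z⟩

theorem image_lowerPart (hle : IsColexOrder M le) (S : Set Q) :
    chain '' lowerPart le chain S = chain '' S := by
  ext i
  constructor
  · rintro ⟨x, ⟨y, hy, hc, -⟩, rfl⟩
    exact ⟨y, hy, hc.symm⟩
  · rintro ⟨y, hy, rfl⟩
    exact ⟨y, ⟨y, hy, rfl, hle.refl y⟩, rfl⟩

theorem image_upperPart (hle : IsColexOrder M le) (S : Set Q) :
    chain '' upperPart le chain S = chain '' S := by
  ext i
  constructor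
  · rintro ⟨x, ⟨y, hy, hc, -⟩, rfl⟩
    exact ⟨y, hy, hc.symm⟩
  · rintro ⟨y, hy, rfl⟩
    exact ⟨y, ⟨y, hy, rfl, hle.refl y⟩, rfl⟩

end

/-! ### Counting the reached sets -/

section
variable {Q : Type*} [Fintype Q] {p : ℕ} {chain : Q → Fin p}

/-- A set that meets exactly the chains in `K` has at least `|K|` elements, and it misses at most
`|Q| - p` elements of these chains. -/
theorem ncard_le_of_image_eq (hsurj : Function.Surjective chain) {K : Set (Fin p)} {D : Set Q}
    (hD : chain '' D = K) : K.ncard ≤ D.ncard ∧ D.ncard ≤ (chain ⁻¹' K).ncard ∧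
      (chain ⁻¹' K).ncard + p ≤ Fintype.card Q + K.ncard := by
  refine ⟨?_, ?_, ?_⟩
  · rw [← hD]
    exact Set.ncard_image_le (Set.toFinite _)
  · exact Set.ncard_le_ncard (fun x hx => hD ▸ Set.mem_image_of_mem _ hx) (Set.toFinite _)
  · have h1 : (chain ⁻¹' K).ncard + (chain ⁻¹' K)ᶜ.ncard = Fintype.card Q := by
      rw [Set.ncard_add_ncard_compl, Nat.card_eq_fintype_card]
    have h2 : K.ncard + Kᶜ.ncard = p := by
      rw [Set.ncard_add_ncard_compl, Nat.card_eq_fintype_card, Fintype.card_fin]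
    -- No chain is empty, so every chain outside `K` contributes a state outside the preimage.
    have h3 : Kᶜ.ncard ≤ (chain ⁻¹' K)ᶜ.ncard := by
      conv_lhs => rw [← Set.image_preimage_eq Kᶜ hsurj]
      exact Set.ncard_image_le (Set.toFinite _)
    omega

/-- Powerset determinization of a `p`-sortable automaton yields few states. -/
theorem ncard_range_eval_le {α : Type*} [LinearOrder α] {M : NFA α Q} (hM : IsAutomaton M)
    (hp : Sortable M p) :
    (Set.range M.eval).ncard ≤ 2 ^ p * (2 * (Fintype.card Q - p) + 1) := by
  obtain ⟨le, hle, chain, hsurj, hchain⟩ := hp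
  have hpn : p ≤ Fintype.card Q := by
    simpa using Fintype.card_le_of_surjective chain hsurj
  -- A lower bound for `f` on sets that meet exactly the chains in `K`: a least possible lower part
  -- and a largest possible upper part.
  let base : Set (Fin p) → ℕ := fun K => K.ncard + (Fintype.card Q - (chain ⁻¹' K).ncard)
  let f : Set Q → ℕ := fun S =>
    (lowerPart le chain S).ncard + (Fintype.card Q - (upperPart le chain S).ncard)
  have hf : ∀ S, base (chain '' S) ≤ f S ∧ f S < base (chain '' S) + (2 * (Fintype.card Q - p) + 1) := by
    intro S
    obtain ⟨h1, h2, h3⟩ := ncard_le_of_image_eq hsurj (image_lowerPart (chain := chain) hle S)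
    obtain ⟨h4, h5, -⟩ := ncard_le_of_image_eq hsurj (image_upperPart (chain := chain) hle S)
    simp only [base, f]
    omega
  have hle_card : ∀ S : Set Q, S.ncard ≤ Fintype.card Q := fun S => by
    rw [← Nat.card_eq_fintype_card, ← Set.ncard_univ]
    exact Set.ncard_le_ncard (Set.subset_univ _)
  -- For fixed chains both summands of `f` grow weakly with the word. Equality of `f` forces
  -- equality of both parts, hence of the sets.
  have hlex : ∀ r₁ r₂ : List α, List.Lex (· < ·) r₁ r₂ →
      chain '' M.eval r₁.reverse = chain '' M.eval r₂.reverse →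
      f (M.eval r₁.reverse) = f (M.eval r₂.reverse) → M.eval r₁.reverse = M.eval r₂.reverse := by
    intro r₁ r₂ h hK hfe
    obtain ⟨hD, hU⟩ := parts_mono hM hle hchain h hK
    have c1 := Set.ncard_le_ncard hD
    have c2 := Set.ncard_le_ncard hU
    have c3 := hle_card (upperPart le chain (M.eval r₁.reverse))
    simp only [f] at hfe
    have eD := Set.eq_of_subset_of_ncard_le hD (by omega)
    have eU := Set.eq_of_subset_of_ncard_le hU (by omega)
    rw [← lowerPart_inter_upperPart (chain := chain) hM hle r₁, eD, ← eU,
      lowerPart_inter_upperPart hM hle]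
  have hcard : ((Set.univ : Set (Set (Fin p))) ×ˢ
      (Finset.range (2 * (Fintype.card Q - p) + 1) : Set ℕ)).ncard =
      2 ^ p * (2 * (Fintype.card Q - p) + 1) := by
    rw [Set.ncard_prod, Set.ncard_univ, Nat.card_eq_fintype_card, Fintype.card_set,
      Fintype.card_fin, Set.ncard_coe_finset, Finset.card_range]
  rw [← hcard]
  refine Set.ncard_le_ncard_of_injOn (fun S => (chain '' S, f S - base (chain '' S))) ?_ ?_
    (Set.toFinite _)
  · rintro S -
    have := hf S
    simp only [Set.mem_prod, Set.mem_univ, true_and, Finset.coe_range, Set.mem_Iio]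
    omega
  · rintro _ ⟨w₁, rfl⟩ _ ⟨w₂, rfl⟩ heq
    obtain ⟨r₁, rfl⟩ : ∃ r, w₁ = r.reverse := ⟨w₁.reverse, by simp⟩
    obtain ⟨r₂, rfl⟩ : ∃ r, w₂ = r.reverse := ⟨w₂.reverse, by simp⟩
    simp only [Prod.mk.injEq] at heq
    obtain ⟨hK, hb⟩ := heq
    have hfe : f (M.eval r₁.reverse) = f (M.eval r₂.reverse) := by
      have h1 := (hf (M.eval r₁.reverse)).1
      have h2 := (hf (M.eval r₂.reverse)).1
      rw [hK] at h1 hb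
      omega
    rcases lex_or_eq_or_lex r₁ r₂ with h | rfl | h
    · exact hlex _ _ h hK hfe
    · rfl
    · exact (hlex _ _ h hK.symm hfe.symm).symm

end

end Colex

namespace Colex

/-! ### Sizes -/

section
variable {m σ : ℕ} {M : NFA (Fin σ) (Fin m)}

/-- Each letter labels an edge, and by input consistency edges with different labels have different
targets. This lets a word size bound without `σ` suffice. -/
theorem card_alphabet_le (hM : IsAutomaton M) : σ ≤ m := by
  choose u v h using hM.effective
  have hinj : Function.Injective v := fun a b hab =>
    hM.input_consistent (u a) (u b) (v a) a b (h a) (hab ▸ h b)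
  simpa using Fintype.card_le_of_injective v hinj

/-- By input consistency the target determines the label, so an edge is determined by its endpoints;
no further factor `σ` arises from scanning the edges. -/
theorem length_edges_le (hM : IsAutomaton M) {es : List (Fin m × Fin m × Fin σ)} (hes : es.Nodup)
    (he : ∀ u v a, (u, v, a) ∈ es ↔ v ∈ M.step u a) : es.length ≤ m ^ 2 := by
  have hnd : (es.map fun e => (e.1, e.2.1)).Nodup := by
    refine List.Nodup.map_on ?_ hes
    rintro ⟨u, v, a⟩ h ⟨u', v', b⟩ h' heq
    simp only [Prod.mk.injEq] at heq
    obtain ⟨rfl, rfl⟩ := heq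
    rw [hM.input_consistent u u v a b ((he _ _ _).1 h) ((he _ _ _).1 h')]
  have := hnd.length_le_card
  simpa [sq] using this

/-- Every state but the initial one is reached through an edge and hence is the target of one. This
bounds the number of states by the input length. -/
theorem card_states_le (hM : IsAutomaton M) {es : List (Fin m × Fin m × Fin σ)}
    (he : ∀ u v a, (u, v, a) ∈ es ↔ v ∈ M.step u a) : m ≤ es.length + 1 := by
  obtain ⟨s, hs⟩ := hM.unique_start
  have hsub : (Finset.univ : Finset (Fin m)) ⊆ insert s (es.map fun e => e.2.1).toFinset := by
    intro v _
    obtain ⟨x, hx⟩ := hM.reachable v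
    rw [Finset.mem_insert, List.mem_toFinset, List.mem_map]
    rcases List.eq_nil_or_concat x with rfl | ⟨y, a, rfl⟩
    · left
      have : v ∈ M.start := hx
      rwa [hs] at this
    · right
      rw [List.concat_eq_append, NFA.eval_append_singleton, NFA.mem_stepSet] at hx
      obtain ⟨u, -, hu⟩ := hx
      exact ⟨(u, v, a), (he _ _ _).2 hu, rfl⟩
  have h1 := Finset.card_le_card hsub
  have h2 := Finset.card_insert_le s (es.map fun e => e.2.1).toFinset
  have h3 := List.toFinset_card_le (es.map fun e => e.2.1)
  simp only [Finset.card_univ, Fintype.card_fin, List.length_map] at h1 h3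
  omega

theorem Sortable.le_card {p : ℕ} (h : Sortable M p) : p ≤ m := by
  obtain ⟨-, -, chain, hsurj, -⟩ := h
  simpa using Fintype.card_le_of_surjective chain hsurj

theorem Sortable.pos {p : ℕ} (h : Sortable M p) (hM : IsAutomaton M) : 1 ≤ p := by
  obtain ⟨-, -, chain, -, -⟩ := h
  obtain ⟨s, -⟩ := hM.unique_start
  exact Nat.one_le_of_lt (chain s).2

/-- Order states by their labels alone. Distinct states with equal labels are then incomparable, so
`axiom_two` holds vacuously, and singletons serve as chains. Consequently the infimum that defines
`width` is attained. -/
theorem sortable_card (M : NFA (Fin σ) (Fin m)) : Sortable M m := by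
  refine ⟨fun u v => u = v ∨ inLabel M u < inLabel M v, ⟨fun _ => .inl rfl, ?_, ?_, ?_, ?_⟩, id,
    Function.surjective_id, ?_⟩
  · rintro u v (h | h) (h' | h')
    · exact h
    · exact h
    · exact h'.symm
    · exact absurd h h'.asymm
  · rintro u v z (rfl | h) (rfl | h')
    · exact .inl rfl
    · exact .inr h'
    · exact .inr h
    · exact .inr (h.trans h')
  · exact fun u v h => ⟨.inr h, fun e => h.ne (congrArg _ e)⟩
  · rintro u' u v' v a b - - hl ⟨h | h, hne⟩
    · exact absurd h hne
    · exact absurd hl h.ne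
  · intro i u hu v hv huv
    exact absurd (Eq.trans hu (Eq.symm hv)) huv

theorem sortable_width (M : NFA (Fin σ) (Fin m)) : Sortable M (width M) :=
  Nat.sInf_mem (s := {p | Sortable M p}) ⟨m, sortable_card M⟩

theorem encodeData_le {n : ℕ} {s : Fin m} {es : List (Fin m × Fin m × Fin σ)} {fs : List (Fin m)}
    (hm : m ≤ n) (hσ : σ ≤ n) (he : es.length ≤ n) (hf : fs.length ≤ n) :
    ∀ x ∈ encodeData s es fs, x ≤ n := by
  intro x hx
  have hs := s.2
  rw [ArrayLang.encodeData_eq] at hx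
  simp only [List.mem_append, List.mem_cons, List.not_mem_nil, or_false, List.mem_flatMap,
    List.mem_map] at hx
  rcases hx with ((rfl | rfl | rfl) | ⟨⟨u, v, a⟩, -, h⟩) | rfl | ⟨f, -, rfl⟩
  · exact hm
  · omega
  · exact he
  · have := u.2
    have := v.2
    have := a.2
    simp only at h
    omega
  · exact hf
  · have := f.2
    omega

end

theorem length_pairEncoding {m₁ m₂ σ : ℕ} {A : NFA (Fin σ) (Fin m₁)} {B : NFA (Fin σ) (Fin m₂)}
    {input : List ℕ} (hA : IsAutomaton A) (hB : IsAutomaton B) (h : IsPairEncoding A B input) :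
    m₁ ≤ input.length ∧ m₂ ≤ input.length := by
  obtain ⟨_, _, ⟨s₁, es₁, fs₁, -, -, he₁, -, -, rfl⟩, ⟨s₂, es₂, fs₂, -, -, he₂, -, -, rfl⟩, rfl⟩ := h
  have h1 := card_states_le hA he₁
  have h2 := card_states_le hB he₂
  rw [List.length_cons, List.length_append, ArrayLang.length_encodeData,
    ArrayLang.length_encodeData]
  omega

/-! ### Time and word size -/

/-- The program decides equivalence if the numbers of reached sets are at most `2 * X`. -/
theorem decidesWithin_of_ncard_le {m₁ m₂ σ n X w : ℕ} {A : NFA (Fin σ) (Fin m₁)}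
    {B : NFA (Fin σ) (Fin m₂)} {input : List ℕ} (hσ : 0 < σ) (hA : IsAutomaton A)
    (hB : IsAutomaton B) (h : IsPairEncoding A B input) (hm₁ : m₁ ≤ n) (hm₂ : m₂ ≤ n)
    (hXA : (Set.range A.eval).ncard ≤ 2 * X) (hXB : (Set.range B.eval).ncard ≤ 2 * X)
    (hX1 : 1 ≤ X) (hX2 : X ≤ 2 ^ (2 * n)) (hw : 2 ^ 16 * (X * n ^ 3) ≤ 2 ^ w) :
    ArrayLang.nfaEquivalence.compile.DecidesWithin w input (A.accepts = B.accepts)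
      (21000 * (X * n ^ 2 * σ)) := by
  have hσn : σ ≤ n := (card_alphabet_le hA).trans hm₁
  have hn : 1 ≤ n := hσ.trans_le hσn
  obtain ⟨_, _, ⟨s₁, es₁, fs₁, hs₁, hes₁, he₁, hfs₁, hf₁, rfl⟩,
    ⟨s₂, es₂, fs₂, hs₂, hes₂, he₂, hfs₂, hf₂, rfl⟩, rfl⟩ := h
  have le₁ : es₁.length ≤ n ^ 2 := (length_edges_le hA hes₁ he₁).trans (Nat.pow_le_pow_left hm₁ 2)
  have le₂ : es₂.length ≤ n ^ 2 := (length_edges_le hB hes₂ he₂).trans (Nat.pow_le_pow_left hm₂ 2)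
  have lf₁ : fs₁.length ≤ n := by simpa using (hfs₁.length_le_card.trans (by simpa using hm₁))
  have lf₂ : fs₂.length ≤ n := by simpa using (hfs₂.length_le_card.trans (by simpa using hm₂))
  have hnn : n ≤ n ^ 2 := Nat.le_self_pow two_ne_zero n
  have hY : n ^ 2 ≤ X * n ^ 2 := Nat.le_mul_of_pos_left _ hX1
  have hZ : X * n ^ 2 ≤ X * n ^ 2 * σ := Nat.le_mul_of_pos_right _ hσ
  have hX : X ≤ X * n ^ 2 := Nat.le_mul_of_pos_right _ (by positivity)
  have hZ' : X * n ^ 2 * σ ≤ X * n ^ 3 := by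
    rw [pow_succ n 2, ← mul_assoc]
    exact Nat.mul_le_mul_left _ hσn
  -- As `X ≤ 2 ^ (2 * n)`, the root searches cost no more than order `n ^ 2`, like the edge scans.
  have hlog : Nat.log 2 (4 * X) ≤ 4 * n ^ 2 := by
    refine (Nat.log_mono_right (b := 2) (m := 2 ^ (2 * n + 2)) ?_).trans ?_
    · rw [pow_add]; omega
    · rw [Nat.log_pow (by norm_num)]; omega
  have hT : ArrayLang.timeBound (m₁ + m₂) (es₁.length + es₂.length) (fs₁.length + fs₂.length) σ
      (4 * X) ≤ 3000 * (X * n ^ 2 * σ) := by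
    have hcost : 100 + 80 * (m₁ + m₂ + (es₁.length + es₂.length)) + 6 * Nat.log 2 (4 * X) ≤
        450 * n ^ 2 := by omega
    rw [ArrayLang.timeBound]
    have h1 : 4 * X * (4 + σ * (100 + 80 * (m₁ + m₂ + (es₁.length + es₂.length)) +
        6 * Nat.log 2 (4 * X))) ≤ 16 * X + 1800 * (X * n ^ 2 * σ) := by
      calc _ ≤ 4 * X * (4 + σ * (450 * n ^ 2)) := by gcongr
        _ = _ := by ring
    omega
  -- Two automata with at most `2 * X` reached sets each give `N = 4 * X`. The value of `B` covers
  -- the input length, all input words, the states and the nodes.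
  have hruns := ArrayLang.runs_nfaEquivalence (B := 20 * (X * n ^ 2)) (N := 4 * X)
    (inp := fun i => (σ :: (encodeData s₁ es₁ fs₁ ++ encodeData s₂ es₂ fs₂)).getD i 0)
    hs₁ hs₂ he₁ hf₁ he₂ hf₂ (ArrayLang.holdsAt_getD _ []) (by omega) (by omega) (by omega)
  have := ArrayLang.decidesWithin_of_runs (w := w) (T := 3000 * (X * n ^ 2 * σ))
    (P := A.accepts = B.accepts)
    (hruns.mono fun s' _ ⟨h1, h2, h3⟩ => ⟨h1, h2, h3.trans hT⟩) ?_ ?_ ?_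
  · rwa [← mul_assoc] at this
  · rw [List.length_cons, List.length_append, ArrayLang.length_encodeData,
      ArrayLang.length_encodeData]
    omega
  · intro x hx
    have hle : n ^ 2 ≤ 20 * (X * n ^ 2) := by omega
    rcases List.mem_cons.1 hx with rfl | hx
    · omega
    · refine le_trans ?_ hle
      rcases List.mem_append.1 hx with hx | hx
      · exact encodeData_le (by omega) (by omega) le₁ (by omega) x hx
      · exact encodeData_le (by omega) (by omega) le₂ (by omega) x hx
  -- The constants fit because `17 * (20 + 3000 + 2) = 51374` is below `2 ^ 16`.
  · omega

/-- A word size that suffices. -/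
theorem le_two_pow_of_le {p n X w : ℕ} (hp : 1 ≤ p) (hX : X ≤ 2 ^ p * n)
    (hw : 24 * (p + Nat.log 2 n) ≤ w) : 2 ^ 16 * (X * n ^ 3) ≤ 2 ^ w := by
  have hn : n ≤ 2 ^ (Nat.log 2 n + 1) := (Nat.lt_pow_succ_log_self (by norm_num) n).le
  calc 2 ^ 16 * (X * n ^ 3) ≤ 2 ^ 16 * (2 ^ p * n * n ^ 3) := by gcongr
    _ = 2 ^ 16 * (2 ^ p * n ^ 4) := by ring
    _ ≤ 2 ^ 16 * (2 ^ p * (2 ^ (Nat.log 2 n + 1)) ^ 4) := by gcongr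
    _ = 2 ^ (16 + p + (Nat.log 2 n + 1) * 4) := by
      rw [pow_add _ (16 + p), pow_add _ 16, pow_mul _ (Nat.log 2 n + 1), mul_assoc]
    -- As `p ≥ 1`, the exponent `20 + p + 4 * log₂ n` is at most `24 * (p + log₂ n)`; this
    -- determines the word size constant.
    _ ≤ 2 ^ w := Nat.pow_le_pow_right (by norm_num) (by omega)

theorem le_two_pow_two_mul {p n X : ℕ} (hp : p ≤ n) (hX : X ≤ 2 ^ p * n) : X ≤ 2 ^ (2 * n) := by
  calc X ≤ 2 ^ p * n := hX
    _ ≤ 2 ^ n * 2 ^ n :=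
      Nat.mul_le_mul (Nat.pow_le_pow_right (by norm_num) hp) Nat.lt_two_pow_self.le
    _ = 2 ^ (2 * n) := by rw [two_mul, pow_add]

end Colex

/-! ### The main theorem -/

theorem mainTheorem9 :
    ∃ (prog : WordRAM.Cmd) (c : ℕ),
      (∃ C : ℕ, ∀ (p n σ m₁ m₂ w : ℕ) (A : NFA (Fin σ) (Fin m₁)) (B : NFA (Fin σ) (Fin m₂))
        (input : List ℕ),
        0 < σ → m₁ ≤ n → m₂ ≤ n →
        Colex.IsAutomaton A → Colex.IsAutomaton B →
        Colex.Sortable A p → Colex.Sortable B p →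
        Colex.IsPairEncoding A B input →
        c * (p + Nat.log 2 n) ≤ w →
        prog.DecidesWithin w input (A.accepts = B.accepts)
          (C * (2 ^ p * (n - p + 1) * n ^ 2 * σ))) ∧
      (∃ K k : ℕ, ∀ (p σ m₁ m₂ w : ℕ) (A : NFA (Fin σ) (Fin m₁)) (B : NFA (Fin σ) (Fin m₂))
        (input : List ℕ),
        0 < σ →
        Colex.IsAutomaton A → Colex.IsAutomaton B →
        p = max (Colex.width A) (Colex.width B) →
        Colex.IsPairEncoding A B input →
        c * (p + Nat.log 2 (max m₁ m₂)) ≤ w →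
        prog.DecidesWithin w input (A.accepts = B.accepts) (K * 2 ^ p * input.length ^ k)) := by
  refine ⟨ArrayLang.nfaEquivalence.compile, 24, ⟨21000, ?_⟩, 21000, 4, ?_⟩
  · intro p n σ m₁ m₂ w A B input hσ hm₁ hm₂ hA hB hpA hpB henc hw
    have hp1 := hpA.pos hA
    have hpn := hpA.le_card.trans hm₁
    -- Uses `1 ≤ p`: there is an initial state, hence at least one chain.
    have hX : 2 ^ p * (n - p + 1) ≤ 2 ^ p * n := Nat.mul_le_mul_left _ (by omega)
    refine Colex.decidesWithin_of_ncard_le hσ hA hB henc hm₁ hm₂ ?_ ?_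
      (Nat.succ_le_of_lt (by positivity))
      (Colex.le_two_pow_two_mul hpn hX) (Colex.le_two_pow_of_le hp1 hX hw)
    · refine (Colex.ncard_range_eval_le hA hpA).trans ?_
      rw [Fintype.card_fin, mul_left_comm]
      exact Nat.mul_le_mul_left _ (by omega)
    · refine (Colex.ncard_range_eval_le hB hpB).trans ?_
      rw [Fintype.card_fin, mul_left_comm]
      exact Nat.mul_le_mul_left _ (by omega)
  · intro p σ m₁ m₂ w A B input hσ hA hB hp henc hw
    have sA := Colex.sortable_width A
    have sB := Colex.sortable_width B
    have lA := sA.le_card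
    have lB := sB.le_card
    have pA := sA.pos hA
    have pB := sB.pos hB
    have hpA : Colex.width A ≤ p := hp ▸ le_max_left _ _
    have hpB : Colex.width B ≤ p := hp ▸ le_max_right _ _
    have hpn : p ≤ max m₁ m₂ := hp ▸ max_le_max lA lB
    obtain ⟨L₁, L₂⟩ := Colex.length_pairEncoding hA hB henc
    have hσm := Colex.card_alphabet_le hA
    set n := max m₁ m₂
    have hm₁ : m₁ ≤ n := le_max_left _ _
    have hm₂ : m₂ ≤ n := le_max_right _ _
    have hn : 0 < n := by omega
    have hnL : n ≤ input.length := max_le L₁ L₂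
    have hσL : σ ≤ input.length := hσm.trans L₁
    -- The cruder `X` suffices here: `n`, `n ^ 2` and `σ` together contribute at most the fourth
    -- power of the input length.
    have key := Colex.decidesWithin_of_ncard_le (X := 2 ^ p * n) hσ hA hB henc hm₁ hm₂ ?_ ?_
      (Nat.succ_le_of_lt (by positivity)) (Colex.le_two_pow_two_mul hpn le_rfl)
      (Colex.le_two_pow_of_le (pA.trans hpA) le_rfl hw)
    · obtain ⟨s, t, he, ht, hP⟩ := key
      refine ⟨s, t, he, ht.trans ?_, hP⟩
      calc 21000 * (2 ^ p * n * n ^ 2 * σ)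
          ≤ 21000 * (2 ^ p * input.length * input.length ^ 2 * input.length) := by gcongr
        _ = 21000 * 2 ^ p * input.length ^ 4 := by ring
    -- Each automaton is counted at its own width, so sortability need not be transferred to the
    -- maximum `p`.
    · refine (Colex.ncard_range_eval_le hA sA).trans ?_
      rw [Fintype.card_fin, mul_left_comm]
      exact Nat.mul_le_mul (Nat.pow_le_pow_right (by norm_num) hpA) (by omega)
    · refine (Colex.ncard_range_eval_le hB sB).trans ?_
      rw [Fintype.card_fin, mul_left_comm]
      exact Nat.mul_le_mul (Nat.pow_le_pow_right (by norm_num) hpB) (by omega)
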